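/- **Setting.** Let $S^2\subset\mathbb R^3$ be the unit sphere with round metric $\sigma_{AB}$, Levi-Civita connection $\nabla$, Laplacian $\Delta$, volume form $\epsilon_{AB}$ (oriented by the outer normal), and coordinate functions $\tilde X^1,\tilde X^2,\tilde X^3$; indices are moved with $\sigma$ and all integrals over $S^2$ use the area measure. A smooth $\varphi$ is of mode $\ell$ if $\Delta\varphi=-\ell(\ell+1)\varphi$; a function is supported in the modes $\ell\ge 2$ if it is $L^2$-orthogonal to all functions of mode $0$ and $1$. The Bondi–Sachs data of a complete future null infinity $\mathbb R_u\times S^2$ of a vacuum spacetime consist of a smooth function $m$ (mass aspect), a smooth one-form $N_A$ (angular momentum aspect) and a smooth symmetric traceless 2-tensor $C_{AB}$ (shear) on $S^2$, depending smoothly on $u$, which satisfy, with the news $N_{AB}=\partial_uC_{AB}$, $$\partial_u m=-\tfrac18N_{AB}N^{AB}+\tfrac14\nabla^A\nabla^BN_{AB},$$ $$\partial_uN_A=\nabla_Am-\tfrac14\nabla^D(\nabla_D\nabla^EC_{EA}-\nabla_A\nabla^EC_{ED})+\tfrac14\nabla_A(C_{BE}N^{BE})-\tfrac14\nabla_B(C^{BD}N_{DA})+\tfrac12C_{AB}\nabla_DN^{DB}.$$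 The potentials $c,\underline c$ of $C_{AB}$ (at each $u$) are the smooth functions supported in the modes $\ell\ge2$ with $$C_{AB}=\nabla_A\nabla_Bc-\tfrac12\sigma_{AB}\Delta c+\tfrac12(\epsilon_A{}^E\nabla_E\nabla_B\underline c+\epsilon_B{}^E\nabla_E\nabla_A\underline c).$$ The linear momentum and the Chen–Wang–Yau angular momentum are $$P^k(u)=\int_{S^2}2m\tilde X^k,\qquad J^k(u)=\int_{S^2}\epsilon^{AB}\nabla_B\tilde X^k\Big(N_A-\tfrac14C_{AB}\nabla_DC^{DB}-c\nabla_Am\Big),\qquad k=1,2,3$$ (in the second term of $J^k$ the index $B$ of $C_{AB}\nabla_DC^{DB}$ is summed within that term). Let $f=\alpha_0+\alpha_i\tilde X^i+f_{\ell\ge2}$ with $\alpha_0,\alpha_i\in\mathbb R$ and $f_{\ell\ge2}$ smooth and supported in the modes $\ell\ge2$. Under the supertranslation $u=\bar u+f(x)$, the data $\bar m,\bar N_A,\bar C_{AB}$ in the coordinates $(\bar u,x)$ satisfy the same evolution equations and $$\bar C_{AB}(\bar u,x)=C_{AB}(\bar u+f,x)-2\nabla_A\nabla_Bf+\Delta f\,\sigma_{AB},$$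 $$\bar m(\bar u,x)=\big(m+\tfrac12\nabla^BN_{BD}\nabla^Df+\tfrac14\partial_uN_{BD}\nabla^Bf\nabla^Df+\tfrac14N_{BD}\nabla^B\nabla^Df\big)(\bar u+f,x).$$ ($\bar N_A$ is thereby fixed up to a $\bar u$-independent one-form, which does not affect the flux; the statement holds for every such $\bar N_A$.) Let $J_f^k(\bar u)$ be the Chen–Wang–Yau angular momentum of the barred data. **Theorem.** Suppose that for some $\varepsilon>0$ $$N_{AB}(u,x)=O(|u|^{-1-\varepsilon})\quad\text{as }u\to\pm\infty,$$ uniformly on $S^2$ and together with the first angular derivative $\nabla_DN_{AB}$. Then the limits $J^k(\pm)$, $J_f^k(\pm)$ and $P^k(\pm)$ of $J^k$, $J^k_f$, $P^k$ as the retarded time tends to $\pm\infty$ exist, and the total flux of $J^k$ is supertranslation invariant in the following sense: for $k=1,2,3$, $$\big(J_f^k(+)-J_f^k(-)\big)-\big(J^k(+)-J^k(-)\big)=\sum_{i,j}\alpha_i\,\varepsilon_{ikj}\,\big(P^j(+)-P^j(-)\big),$$ where $\varepsilon_{ikj}$ is the Levi-Civita symbol. -/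

import Mathlib

open MeasureTheory Filter Topology Asymptotics
open scoped Manifold ContDiff

noncomputable section

/-! ### Tensor calculus on the round unit sphere

The sphere `S2` sits in Euclidean `ℝ³`. A (covariant) tensor field on `S2` is given by its
components in the standard frame of `ℝ³`, annihilated by the normal `x` in every slot; indices are
then raised, lowered and contracted by plain sums over `Fin 3`, because the round metric is the
restriction of the Euclidean one. The Levi-Civita derivative is the tangential projection of the
Euclidean derivative. -/

/-- Euclidean three-space. -/
abbrev E3 : Type := EuclideanSpace ℝ (Fin 3)

/-- The unit sphere in Euclidean three-space. -/
abbrev S2 : Type := Metric.sphere (0 : E3) 1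

/-- The coordinate function `X̃ᵏ` restricted to the sphere. -/
def coordX (k : Fin 3) (x : S2) : ℝ := (x : E3) k

/-- Smooth functions on the sphere. -/
def SmoothS2 (F : S2 → ℝ) : Prop := ContMDiff (𝓡 2) 𝓘(ℝ, ℝ) ∞ F

/-- Smooth functions on `ℝ × S²`. -/
def SmoothScri (F : ℝ → S2 → ℝ) : Prop :=
  ContMDiff ((𝓘(ℝ, ℝ)).prod (𝓡 2)) 𝓘(ℝ, ℝ) ∞ (fun p : ℝ × S2 => F p.1 p.2)

/-- Integral over the sphere with respect to the surface measure of the round metric. -/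
def integralS2 (F : S2 → ℝ) : ℝ := ∫ x, F x ∂((volume : Measure E3).toSphere)

/-- The Levi-Civita symbol with values in `ℝ`, normalised by `ε₀₁₂ = 1`. -/
def leviCivita (i j k : Fin 3) : ℝ :=
  (((j : ℕ) : ℝ) - ((i : ℕ) : ℝ)) * (((k : ℕ) : ℝ) - ((i : ℕ) : ℝ)) *
    (((k : ℕ) : ℝ) - ((j : ℕ) : ℝ)) / 2

/-- The round metric `σ`, that is, the orthogonal projection onto the tangent plane at `x`. -/
def sigma (x : S2) (a b : Fin 3) : ℝ := (if a = b then 1 else 0) - (x : E3) a * (x : E3) b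

/-- The volume form of the round metric (for the orientation by the outer normal). -/
def epsS2 (x : S2) (a b : Fin 3) : ℝ := ∑ c, leviCivita a b c * (x : E3) c

/-- The extension of a function on the sphere to `ℝ³ ∖ {0}` that is constant along rays. -/
def radialExt (F : S2 → ℝ) (y : E3) : ℝ :=
  if h : y = 0 then 0 else
    F ⟨‖y‖⁻¹ • y, by
      rw [mem_sphere_zero_iff_norm, norm_smul, norm_inv, norm_norm,
        inv_mul_cancel₀ (norm_ne_zero_iff.mpr h)]⟩

/-- `∇ₐ F` for a function `F`. The radial extension has no normal derivative, so this is the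
tangential gradient. -/
def grad0 (F : S2 → ℝ) (x : S2) (a : Fin 3) : ℝ :=
  fderiv ℝ (radialExt F) (x : E3) (EuclideanSpace.single a 1)

/-- `∇ₐ w_b` for a one-form `w`. -/
def grad1 (w : S2 → Fin 3 → ℝ) (x : S2) (a b : Fin 3) : ℝ :=
  ∑ d, sigma x b d * grad0 (fun y => w y d) x a

/-- `∇ₐ T_{bc}` for a two-tensor `T`. -/
def grad2 (T : S2 → Fin 3 → Fin 3 → ℝ) (x : S2) (a b c : Fin 3) : ℝ :=
  ∑ d, ∑ e, sigma x b d * sigma x c e * grad0 (fun y => T y d e) x a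

/-- The Hessian `∇ₐ∇_b F`. -/
def hess (F : S2 → ℝ) : S2 → Fin 3 → Fin 3 → ℝ := grad1 (grad0 F)

/-- The divergence `∇ᴬ w_A` of a one-form. -/
def div1 (w : S2 → Fin 3 → ℝ) (x : S2) : ℝ := ∑ a, grad1 w x a a

/-- The divergence `∇ᴬ T_{AB}` of a two-tensor. -/
def div2 (T : S2 → Fin 3 → Fin 3 → ℝ) (x : S2) (b : Fin 3) : ℝ := ∑ a, grad2 T x a a b

/-- The Laplacian of a function. -/
def lap (F : S2 → ℝ) (x : S2) : ℝ := ∑ a, hess F x a a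

/-! ### Modes and potentials -/

/-- `φ` is of mode `ℓ`. -/
def IsMode (ℓ : ℕ) (φ : S2 → ℝ) : Prop :=
  SmoothS2 φ ∧ ∀ x, lap φ x = -((ℓ : ℝ) * ((ℓ : ℝ) + 1)) * φ x

/-- `F` is supported in the modes `ℓ ≥ 2`: it is orthogonal to all functions of mode `0` or `1`. -/
def SupportedGE2 (F : S2 → ℝ) : Prop :=
  ∀ ℓ < 2, ∀ φ, IsMode ℓ φ → integralS2 (fun x => F x * φ x) = 0

/-- `c` and `cu` are the closed and the co-closed potential of the two-tensor `C`, normalised to be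
supported in the modes `ℓ ≥ 2`. -/
structure IsPotentialPair (C : S2 → Fin 3 → Fin 3 → ℝ) (c cu : S2 → ℝ) : Prop where
  smooth_c : SmoothS2 c
  smooth_cu : SmoothS2 cu
  supported_c : SupportedGE2 c
  supported_cu : SupportedGE2 cu
  eq : ∀ x a b, C x a b =
    hess c x a b - 1 / 2 * sigma x a b * lap c x
      + 1 / 2 * (∑ e, epsS2 x a e * hess cu x e b + ∑ e, epsS2 x b e * hess cu x e a)

/-! ### Data on future null infinity -/

/-- The news tensor `N_{AB} = ∂_u C_{AB}` of a shear tensor. -/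
def news (C : ℝ → S2 → Fin 3 → Fin 3 → ℝ) (u : ℝ) (x : S2) (a b : Fin 3) : ℝ :=
  deriv (fun s => C s x a b) u

/-- The Bondi-Sachs data of a complete future null infinity `ℝ × S²` of a vacuum spacetime: mass
aspect, angular momentum aspect and shear, all smooth, with the evolution equations that the vacuum
Einstein equations impose on them. -/
structure NullInfinityData where
  /-- mass aspect `m` -/
  m : ℝ → S2 → ℝ
  /-- angular momentum aspect `N_A` -/
  NA : ℝ → S2 → Fin 3 → ℝ
  /-- shear tensor `C_{AB}` -/
  C : ℝ → S2 → Fin 3 → Fin 3 → ℝ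
  smooth_m : SmoothScri m
  smooth_NA : ∀ a, SmoothScri (fun u x => NA u x a)
  smooth_C : ∀ a b, SmoothScri (fun u x => C u x a b)
  tangent_NA : ∀ (u : ℝ) (x : S2), ∑ a, (x : E3) a * NA u x a = 0
  tangent_C : ∀ (u : ℝ) (x : S2) (b : Fin 3), ∑ a, (x : E3) a * C u x a b = 0
  symm_C : ∀ u x a b, C u x a b = C u x b a
  traceless_C : ∀ u x, ∑ a, C u x a a = 0
  /-- `∂_u m = -(1/8) N_{AB} N^{AB} + (1/4) ∇^A ∇^B N_{AB}` -/
  evol_m : ∀ u x, deriv (fun s => m s x) u =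
    -(1 / 8) * ∑ a, ∑ b, news C u x a b ^ 2 + 1 / 4 * div1 (div2 (news C u)) x
  /-- `∂_u N_A = ∇_A m - (1/4) ∇^D (∇_D ∇^E C_{EA} - ∇_A ∇^E C_{ED}) + (1/4) ∇_A (C_{BE} N^{BE})
  - (1/4) ∇_B (C^{BD} N_{DA}) + (1/2) C_{AB} ∇_D N^{DB}` -/
  evol_NA : ∀ u x a, deriv (fun s => NA s x a) u =
    grad0 (m u) x a
      - 1 / 4 * div2 (fun y d b => grad1 (div2 (C u)) y d b - grad1 (div2 (C u)) y b d) x a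
      + 1 / 4 * grad0 (fun y => ∑ b, ∑ e, C u y b e * news C u y b e) x a
      - 1 / 4 * div2 (fun y b e => ∑ d, C u y b d * news C u y d e) x a
      + 1 / 2 * ∑ b, C u x a b * div2 (news C u) x b

/-- The news decays like `|u|^{-1-ε}` as `u → ±∞`, uniformly on the sphere and together with its
first angular derivative, for some `ε > 0`. -/
def NewsDecay (D : NullInfinityData) : Prop :=
  ∃ ε : ℝ, 0 < ε ∧
    (∀ a b, (fun p : ℝ × S2 => news D.C p.1 p.2 a b)
      =O[(atBot ⊔ atTop) ×ˢ ⊤] (fun p : ℝ × S2 => |p.1| ^ (-1 - ε))) ∧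
    (∀ d a b, (fun p : ℝ × S2 => grad2 (news D.C p.1) p.2 d a b)
      =O[(atBot ⊔ atTop) ×ˢ ⊤] (fun p : ℝ × S2 => |p.1| ^ (-1 - ε)))

/-- `D'` is the data, in the coordinates `(ū, x)`, of the null infinity with data `D` in the
coordinates `(u, x)`, where `u = ū + f(x)`. The aspect `N_A` of `D'` is constrained only by its
evolution equation, which determines it up to a `ū`-independent one-form. -/
structure IsSupertranslation (f : S2 → ℝ) (D D' : NullInfinityData) : Prop where
  /-- `C̄_{AB}(ū, x) = C_{AB}(ū + f, x) - 2 ∇_A ∇_B f + Δf σ_{AB}` -/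
  shear : ∀ u x a b, D'.C u x a b =
    D.C (u + f x) x a b - 2 * hess f x a b + lap f x * sigma x a b
  /-- `m̄(ū, x) = (m + (1/2) ∇^B N_{BD} ∇^D f + (1/4) ∂_u N_{BD} ∇^B f ∇^D f
  + (1/4) N_{BD} ∇^B ∇^D f)(ū + f, x)` -/
  mass : ∀ u x, D'.m u x =
    D.m (u + f x) x
      + 1 / 2 * ∑ d, div2 (news D.C (u + f x)) x d * grad0 f x d
      + 1 / 4 * ∑ b, ∑ d,
          deriv (fun s => news D.C s x b d) (u + f x) * grad0 f x b * grad0 f x d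
      + 1 / 4 * ∑ b, ∑ d, news D.C (u + f x) x b d * hess f x b d

/-- The linear momentum `Pᵏ = ∫ 2 m X̃ᵏ` at retarded time `u`. -/
def linearMomentum (D : NullInfinityData) (k : Fin 3) (u : ℝ) : ℝ :=
  integralS2 (fun x => 2 * D.m u x * coordX k x)

/-- The Chen–Wang–Yau angular momentum
`Jᵏ = ∫ ε^{AB} ∇_B X̃ᵏ (N_A - (1/4) C_{AD} ∇_E C^{ED} - c ∇_A m)` at retarded time `u`, where `c` is
the closed potential of the shear. -/
def cwyAngularMomentum (D : NullInfinityData) (c : ℝ → S2 → ℝ) (k : Fin 3) (u : ℝ) : ℝ :=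
  integralS2 (fun x => ∑ a, (∑ b, epsS2 x a b * grad0 (coordX k) x b) *
    (D.NA u x a - 1 / 4 * ∑ d, D.C u x a d * div2 (D.C u) x d - c u x * grad0 (D.m u) x a))

end

noncomputable section

/-! ### Smooth functions on `ℝ × S²` and their extensions that are constant along rays -/

/-! Let Y be the rotation field with components ε^{AB}∇_B X^k. The angular momentum is a local part
∫ Y^A(N_A − ¼ C_{AB}∇_D C^{DB}) minus the potential term ∫ c Y(m). Write m = q + ¼ div div C. The
double divergence kills the co-closed part of C, so div div C = ½ Δ(Δ+2)c. Since Δ(Δ+2) is symmetric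
and commutes with the skew operator Y, ∫ c Y(div div C) = 0, and m may be replaced by q. This makes
limits accessible: ∂_u q = −⅛|N|² decays together with its first angular derivative, while m
contains two derivatives of C. Likewise P^j = 2∫ q X^j, because X^j has vanishing traceless Hessian.

The evolution equations give −¼ ∫ N·L_Y C for the u-derivative of the local part (`I_angular_flux`,
resting on the two-dimensional identity `stt_codazzi`). Put h = 2∇∇f − σΔf. A supertranslation
shifts C, N and q in time, subtracts h from C and adds ¼ Δ(Δ+2)f to q (`q_eq`). The new flux density
is the old one plus |N|² Y(f) − N·L_Y h, both at the shifted time, and this addition is the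
u-derivative of −8q Y(f) − C·L_Y h. A bounded shift of time does not change limits of sphere
integrals, so the local part changes asymptotically by K + 2∫ q Y(f) + ¼∫ c Y(Δ(Δ+2)f), with the
same constant K at both ends (`exists_tendsto_localJ_sub`).

Meanwhile the potential is asymptotically replaced by c − 2 f_{ℓ≥2}, so the potential part of J
changes by −¼∫ c Y(Δ(Δ+2)f) − 2∫ q Y(f_{ℓ≥2}). The sum of the two changes is K + 2∫ q Y(α_i X^i) = K
+ Σ α_i ε_{ikj} P^j (`exists_limits`); subtracting the two ends removes K.

The analytic point is the convergence of c, which is only given slice by slice in u. It follows from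
‖c‖ ≤ ‖C‖ in L² (`int_mul_self_le_of_lp2_eq`), proved by testing c against finite sums of modes.
These are dense by Stone–Weierstrass, because multiplication by X^j sends mode ℓ into modes ℓ ± 1.
All tensor algebra is carried out in ambient components from the few axioms of `SphereCalculus`. -/

theorem factFinrankE3 : Fact (Module.finrank ℝ E3 = 2 + 1) := ⟨finrank_euclideanSpace_fin⟩

/-- The radial extension in families. -/
def famExt (F : ℝ → S2 → ℝ) (p : ℝ × E3) : ℝ := radialExt (F p.1) p.2

/-- The domain of the radial extension of a family. -/
def famDom : TopologicalSpace.Opens (ℝ × E3) :=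
  ⟨{p | p.2 ≠ 0}, isOpen_ne.preimage continuous_snd⟩

lemma coe_ne_zero (x : S2) : (x : E3) ≠ 0 := ne_zero_of_mem_unit_sphere x

lemma coe_mem_famDom (u : ℝ) (x : S2) : ((u, (x : E3)) : ℝ × E3) ∈ famDom := coe_ne_zero x

@[simp] lemma radialExt_coe (F : S2 → ℝ) (x : S2) : radialExt F (x : E3) = F x := by
  have hx : ‖(x : E3)‖ = 1 := norm_eq_of_mem_sphere x
  rw [radialExt, dif_neg (coe_ne_zero x)]
  congr 1
  ext1
  simp [hx]

lemma famExt_coe (F : ℝ → S2 → ℝ) (u : ℝ) (x : S2) : famExt F (u, (x : E3)) = F u x := by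
  simp [famExt]

/-- The projection of a nonzero vector to the unit sphere. -/
def toS2 (y : E3) (hy : y ≠ 0) : S2 := ⟨‖y‖⁻¹ • y, by
  rw [mem_sphere_zero_iff_norm, norm_smul, norm_inv, norm_norm,
    inv_mul_cancel₀ (norm_ne_zero_iff.mpr hy)]⟩

lemma radialExt_of_ne (F : S2 → ℝ) {y : E3} (hy : y ≠ 0) : radialExt F y = F (toS2 y hy) := by
  rw [radialExt, dif_neg hy]; rfl

lemma radialExt_smul (F : S2 → ℝ) {r : ℝ} (hr : 0 < r) (y : E3) :
    radialExt F (r • y) = radialExt F y := by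
  by_cases hy : y = 0
  · simp [hy]
  · have hry : r • y ≠ 0 := smul_ne_zero hr.ne' hy
    rw [radialExt_of_ne F hy, radialExt_of_ne F hry]
    congr 1
    ext1
    simp only [toS2, norm_smul, Real.norm_eq_abs, abs_of_pos hr, smul_smul, mul_inv]
    congr 1
    field_simp

/-- The extension is F composed with the smooth projection to the sphere. Manifold smoothness
thereby becomes ordinary smoothness on ℝ × (ℝ³ ∖ 0), where `fderiv` and the symmetry of second
derivatives are available. -/
lemma SmoothScri.contDiffOn {F : ℝ → S2 → ℝ} (hF : SmoothScri F) :
    ContDiffOn ℝ ∞ (famExt F) famDom := by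
  have := factFinrankE3
  have h1 : ContMDiff 𝓘(ℝ, ℝ × E3) 𝓘(ℝ, E3) ∞
      (fun p : famDom => ‖(p : ℝ × E3).2‖⁻¹ • (p : ℝ × E3).2) := by
    intro p
    refine (contMDiffAt_subtype_iff (U := famDom)
      (f := fun p : ℝ × E3 => ‖p.2‖⁻¹ • p.2)).2 ?_
    refine ContDiffAt.contMDiffAt ?_
    have hp : (p : ℝ × E3).2 ≠ 0 := p.2
    exact ((contDiffAt_snd.norm ℝ hp).inv (norm_ne_zero_iff.2 hp)).smul contDiffAt_snd
  have h2 : ContMDiff 𝓘(ℝ, ℝ × E3) (𝓡 2) ∞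
      (fun p : famDom => toS2 (p : ℝ × E3).2 p.2) :=
    ContMDiff.codRestrict_sphere (n := 2) h1 _
  have h3 : ContMDiff 𝓘(ℝ, ℝ × E3) 𝓘(ℝ, ℝ) ∞ (fun p : famDom => (p : ℝ × E3).1) := by
    intro p
    exact (contMDiffAt_subtype_iff (U := famDom) (f := fun p : ℝ × E3 => p.1)).2
      contDiffAt_fst.contMDiffAt
  have h4 : ContMDiff 𝓘(ℝ, ℝ × E3) 𝓘(ℝ, ℝ) ∞ (fun p : famDom => famExt F p) := by
    have h := ContMDiff.comp hF (h3.prodMk h2)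
    convert h using 1
    ext p
    simp only [famExt, Function.comp]
    rw [radialExt_of_ne _ p.2]
  intro p hp
  have h5 := (contMDiffAt_subtype_iff (U := famDom) (f := famExt F)).1 (h4 ⟨p, hp⟩)
  exact h5.contDiffAt.contDiffWithinAt

lemma contMDiff_prod_coe :
    ContMDiff ((𝓘(ℝ, ℝ)).prod (𝓡 2)) 𝓘(ℝ, ℝ × E3) ∞
      (fun p : ℝ × S2 => ((p.1, (p.2 : E3)) : ℝ × E3)) :=
  have := factFinrankE3
  ContMDiff.prodMk_space contMDiff_fst ((contMDiff_coe_sphere (n := 2)).comp contMDiff_snd)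

lemma smoothScri_of_contDiffOn {G : ℝ × E3 → ℝ} (hG : ContDiffOn ℝ ∞ G famDom) :
    SmoothScri (fun u x => G (u, (x : E3))) := by
  intro p
  have h : ContDiffAt ℝ ∞ G (p.1, (p.2 : E3)) :=
    hG.contDiffAt (famDom.isOpen.mem_nhds (coe_mem_famDom p.1 p.2))
  exact (h.contMDiffAt).comp p (contMDiff_prod_coe p)

lemma SmoothS2.const_scri {F : S2 → ℝ} (hF : SmoothS2 F) : SmoothScri (fun _ => F) :=
  ContMDiff.comp hF contMDiff_snd

lemma SmoothScri.slice {F : ℝ → S2 → ℝ} (hF : SmoothScri F) (u : ℝ) : SmoothS2 (F u) :=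
  ContMDiff.comp (g := fun p : ℝ × S2 => F p.1 p.2) hF
    (contMDiff_const.prodMk contMDiff_id)

lemma SmoothScri.continuous {F : ℝ → S2 → ℝ} (hF : SmoothScri F) :
    Continuous (fun p : ℝ × S2 => F p.1 p.2) := ContMDiff.continuous hF

lemma SmoothS2.continuous {F : S2 → ℝ} (hF : SmoothS2 F) : Continuous F :=
  ContMDiff.continuous hF

lemma SmoothScri.contDiffAt {F : ℝ → S2 → ℝ} (hF : SmoothScri F) {p : ℝ × E3} (hp : p ∈ famDom) :
    ContDiffAt ℝ ∞ (famExt F) p :=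
  hF.contDiffOn.contDiffAt (famDom.isOpen.mem_nhds hp)

lemma SmoothScri.differentiableAt {F : ℝ → S2 → ℝ} (hF : SmoothScri F) {p : ℝ × E3}
    (hp : p ∈ famDom) : DifferentiableAt ℝ (famExt F) p :=
  (hF.contDiffAt hp).differentiableAt (by simp)

lemma SmoothS2.contDiffAt {F : S2 → ℝ} (hF : SmoothS2 F) {y : E3} (hy : y ≠ 0) :
    ContDiffAt ℝ ∞ (radialExt F) y := by
  have h := hF.const_scri.contDiffAt (p := (0, y)) hy
  exact h.comp (f := fun y : E3 => ((0 : ℝ), y)) y (contDiffAt_const.prodMk contDiffAt_id)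

lemma SmoothS2.differentiableAt {F : S2 → ℝ} (hF : SmoothS2 F) {y : E3} (hy : y ≠ 0) :
    DifferentiableAt ℝ (radialExt F) y :=
  (hF.contDiffAt hy).differentiableAt (by simp)

lemma smoothS2_coordX (k : Fin 3) : SmoothS2 (coordX k) := by
  have := factFinrankE3
  have h : ContDiff ℝ ∞ (fun y : E3 => y k) := (EuclideanSpace.proj (𝕜 := ℝ) k).contDiff
  exact h.contMDiff.comp (contMDiff_coe_sphere (n := 2))

lemma hasDerivAt_famExt {F : ℝ → S2 → ℝ} (hF : SmoothScri F) {u : ℝ} {y : E3} (hy : y ≠ 0) :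
    HasDerivAt (fun s => famExt F (s, y)) (fderiv ℝ (famExt F) (u, y) (1, 0)) u := by
  have h := (hF.differentiableAt (p := (u, y)) hy).hasFDerivAt
  have h2 : HasDerivAt (fun s : ℝ => ((s, y) : ℝ × E3)) (1, 0) u :=
    (hasDerivAt_id u).prodMk (hasDerivAt_const u y)
  exact h.comp_hasDerivAt u h2

lemma SmoothScri.hasDerivAt {F : ℝ → S2 → ℝ} (hF : SmoothScri F) (u : ℝ) (x : S2) :
    HasDerivAt (fun s => F s x) (fderiv ℝ (famExt F) (u, (x : E3)) (1, 0)) u := by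
  have h := hasDerivAt_famExt hF (u := u) (coe_ne_zero x)
  simpa only [famExt_coe] using h

lemma fderiv_slice {F : ℝ → S2 → ℝ} (hF : SmoothScri F) {u : ℝ} {y : E3} (hy : y ≠ 0) (v : E3) :
    fderiv ℝ (radialExt (F u)) y v = fderiv ℝ (famExt F) (u, y) (0, v) := by
  have h := (hF.differentiableAt (p := (u, y)) hy).hasFDerivAt
  have h2 : HasFDerivAt (fun z : E3 => ((u, z) : ℝ × E3)) (ContinuousLinearMap.inr ℝ ℝ E3) y :=
    hasFDerivAt_prodMk_right u y
  have h3 := (h.comp y h2).fderiv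
  change fderiv ℝ (famExt F ∘ fun z : E3 => ((u, z) : ℝ × E3)) y v = _
  rw [h3]
  simp

lemma SmoothScri.grad0_eq {F : ℝ → S2 → ℝ} (hF : SmoothScri F) (u : ℝ) (x : S2) (a : Fin 3) :
    grad0 (F u) x a = fderiv ℝ (famExt F) (u, (x : E3)) (0, EuclideanSpace.single a 1) :=
  fderiv_slice hF (coe_ne_zero x) _

/-- The `u`-derivative of a family of functions on the sphere. -/
def dU (F : ℝ → S2 → ℝ) (u : ℝ) (x : S2) : ℝ := deriv (fun s => F s x) u

lemma SmoothScri.hasDerivAt_dU {F : ℝ → S2 → ℝ} (hF : SmoothScri F) (u : ℝ) (x : S2) :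
    HasDerivAt (fun s => F s x) (dU F u x) u :=
  (hF.hasDerivAt u x).differentiableAt.hasDerivAt

lemma contDiffOn_fderiv_apply {G : ℝ × E3 → ℝ} (hG : ContDiffOn ℝ ∞ G famDom) (v : ℝ × E3) :
    ContDiffOn ℝ ∞ (fun p => fderiv ℝ G p v) famDom :=
  (hG.fderiv_of_isOpen famDom.isOpen (by simp)).clm_apply contDiffOn_const

lemma SmoothScri.dU {F : ℝ → S2 → ℝ} (hF : SmoothScri F) : SmoothScri (dU F) := by
  have h := smoothScri_of_contDiffOn (contDiffOn_fderiv_apply hF.contDiffOn (1, 0))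
  convert h using 1
  ext u x
  exact (hF.hasDerivAt u x).deriv

lemma SmoothScri.grad0 {F : ℝ → S2 → ℝ} (hF : SmoothScri F) (a : Fin 3) :
    SmoothScri (fun u x => grad0 (F u) x a) := by
  have h := smoothScri_of_contDiffOn
    (contDiffOn_fderiv_apply hF.contDiffOn (0, EuclideanSpace.single a 1))
  convert h using 1
  ext u x
  exact hF.grad0_eq u x a

lemma SmoothS2.grad0 {F : S2 → ℝ} (hF : SmoothS2 F) (a : Fin 3) :
    SmoothS2 (fun x => grad0 F x a) := (hF.const_scri.grad0 a).slice 0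

lemma fderiv_fderiv_apply {G : ℝ × E3 → ℝ} {p : ℝ × E3} (hG : ContDiffAt ℝ ∞ G p)
    (v w : ℝ × E3) :
    fderiv ℝ (fun q => fderiv ℝ G q v) p w = fderiv ℝ (fderiv ℝ G) p w v := by
  have h : DifferentiableAt ℝ (fderiv ℝ G) p :=
    (hG.fderiv_right (m := 1) (by norm_cast)).differentiableAt (by simp)
  rw [fderiv_clm_apply h (differentiableAt_const v)]
  simp

lemma fderiv_fderiv_comm {G : ℝ × E3 → ℝ} {p : ℝ × E3} (hG : ContDiffAt ℝ ∞ G p)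
    (v w : ℝ × E3) :
    fderiv ℝ (fun q => fderiv ℝ G q v) p w = fderiv ℝ (fun q => fderiv ℝ G q w) p v := by
  rw [fderiv_fderiv_apply hG, fderiv_fderiv_apply hG]
  exact (hG.isSymmSndFDerivAt (by simp; norm_cast)).eq w v

/-- The `u`-derivative commutes with the tangential gradient. -/
lemma SmoothScri.dU_grad0 {F : ℝ → S2 → ℝ} (hF : SmoothScri F) (u : ℝ) (x : S2) (a : Fin 3) :
    _root_.dU (fun s y => _root_.grad0 (F s) y a) u x = _root_.grad0 (_root_.dU F u) x a := by
  have hp := coe_mem_famDom u x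
  -- Extending along rays commutes with the u-derivative, so both sides are mixed second derivatives
  -- of the single function `famExt F`.
  have h1 : famExt (_root_.dU F) =ᶠ[𝓝 (u, (x : E3))] fun q => fderiv ℝ (famExt F) q (1, 0) := by
    filter_upwards [famDom.isOpen.mem_nhds hp] with q hq
    have hq' : q.2 ≠ 0 := hq
    rw [famExt, radialExt_of_ne _ hq']
    have h2 := hasDerivAt_famExt hF (u := q.1) hq'
    rw [← h2.deriv]
    simp only [_root_.dU, famExt, radialExt_of_ne _ hq']
  rw [hF.dU.grad0_eq, h1.fderiv_eq, fderiv_fderiv_comm (hF.contDiffAt hp)]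
  have h3 : (fun s => _root_.grad0 (F s) x a) =
      fun s => fderiv ℝ (famExt F) (s, (x : E3)) (0, EuclideanSpace.single a 1) := by
    ext s; exact hF.grad0_eq s x a
  have h4 : DifferentiableAt ℝ (fun q => fderiv ℝ (famExt F) q (0, EuclideanSpace.single a 1))
      (u, (x : E3)) :=
    ((contDiffOn_fderiv_apply hF.contDiffOn _).contDiffAt
      (famDom.isOpen.mem_nhds hp)).differentiableAt (by simp)
  have h5 : HasDerivAt (fun s : ℝ => ((s, (x : E3)) : ℝ × E3)) (1, 0) u :=
    (hasDerivAt_id u).prodMk (hasDerivAt_const u _)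
  rw [_root_.dU, h3]
  exact (h4.hasFDerivAt.comp_hasDerivAt u h5).deriv

lemma SmoothScri.add {F G : ℝ → S2 → ℝ} (hF : SmoothScri F) (hG : SmoothScri G) :
    SmoothScri (fun u x => F u x + G u x) := ContMDiff.add hF hG

lemma SmoothScri.mul {F G : ℝ → S2 → ℝ} (hF : SmoothScri F) (hG : SmoothScri G) :
    SmoothScri (fun u x => F u x * G u x) := ContMDiff.mul hF hG

lemma smoothScri_const (r : ℝ) : SmoothScri (fun _ _ => r) := contMDiff_const

/-- Retarded time shifted by a function on the sphere. -/
lemma SmoothScri.shift {F : ℝ → S2 → ℝ} (hF : SmoothScri F) {f : S2 → ℝ} (hf : SmoothS2 f) :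
    SmoothScri (fun u x => F (u + f x) x) := by
  have h1 : ContMDiff ((𝓘(ℝ, ℝ)).prod (𝓡 2)) 𝓘(ℝ, ℝ) ∞ (fun p : ℝ × S2 => p.1 + f p.2) :=
    ContMDiff.add contMDiff_fst (ContMDiff.comp hf contMDiff_snd)
  exact ContMDiff.comp hF (h1.prodMk contMDiff_snd)

/-- Chain rule for the graph u + f(x): the extra term `dU F * grad0 f` is the source of every
correction caused by the supertranslation. -/
lemma SmoothScri.grad0_shift {F : ℝ → S2 → ℝ} (hF : SmoothScri F) {f : S2 → ℝ} (hf : SmoothS2 f)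
    (u : ℝ) (x : S2) (a : Fin 3) :
    _root_.grad0 (fun y => F (u + f y) y) x a =
      _root_.grad0 (F (u + f x)) x a + _root_.dU F (u + f x) x * _root_.grad0 f x a := by
  have h1 : radialExt (fun y => F (u + f y) y) =ᶠ[𝓝 (x : E3)]
      fun y => famExt F (u + radialExt f y, y) := by
    filter_upwards [isOpen_ne.mem_nhds (coe_ne_zero x)] with y hy
    have hy' : y ≠ 0 := hy
    simp only [famExt, radialExt_of_ne _ hy']
  have h2 : HasFDerivAt (fun y : E3 => ((u + radialExt f y, y) : ℝ × E3))
      ((fderiv ℝ (radialExt f) x).prod (ContinuousLinearMap.id ℝ E3)) x :=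
    ((hf.differentiableAt (coe_ne_zero x)).hasFDerivAt.const_add u).prodMk (hasFDerivAt_id _)
  have h3 : HasFDerivAt (famExt F) (fderiv ℝ (famExt F) (u + f x, (x : E3)))
      (u + radialExt f x, (x : E3)) := by
    rw [radialExt_coe]
    exact (hF.differentiableAt (coe_mem_famDom _ x)).hasFDerivAt
  have h4 := (HasFDerivAt.comp (g := famExt F)
    (f := fun y : E3 => ((u + radialExt f y, y) : ℝ × E3)) (x : E3) h3 h2).fderiv
  simp only [Function.comp_def] at h4
  unfold _root_.grad0
  rw [h1.fderiv_eq, h4, fderiv_slice hF (coe_ne_zero x)]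
  rw [_root_.dU, (hF.hasDerivAt (u + f x) x).deriv]
  rw [ContinuousLinearMap.comp_apply, ContinuousLinearMap.prod_apply, mul_comm, ← smul_eq_mul,
    ← map_smul, ← map_add]
  simp

/-! ### The tangential derivatives: values on coordinates, commutators, integration by parts -/

/-- The area measure of the sphere. -/
abbrev areaS2 : Measure S2 := (volume : Measure E3).toSphere

lemma norm_coe_S2 (x : S2) : ‖(x : E3)‖ = 1 := norm_eq_of_mem_sphere x

lemma hasFDerivAt_norm {y : E3} (hy : y ≠ 0) :
    HasFDerivAt (fun z : E3 => ‖z‖) (‖y‖⁻¹ • innerSL ℝ y) y := by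
  have h1 := (hasStrictFDerivAt_norm_sq y).hasFDerivAt.sqrt (by simpa using hy)
  simp only [Real.sqrt_sq (norm_nonneg _)] at h1
  refine h1.congr_fderiv (ContinuousLinearMap.ext fun v => ?_)
  simp
  field_simp

lemma fderiv_radialExt_smul {F : S2 → ℝ} (hF : SmoothS2 F) {r : ℝ} (hr : 0 < r) {y : E3}
    (hy : y ≠ 0) : fderiv ℝ (radialExt F) (r • y) = r⁻¹ • fderiv ℝ (radialExt F) y := by
  have h1 : (fun z => radialExt F (r • z)) = radialExt F := by
    ext z; exact radialExt_smul F hr z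
  have h2 := (hF.differentiableAt (smul_ne_zero hr.ne' hy)).hasFDerivAt
  have h3 : HasFDerivAt (fun z : E3 => r • z) (r • ContinuousLinearMap.id ℝ E3) y :=
    (hasFDerivAt_id y).const_smul r
  have h4 := (h2.comp y h3).fderiv
  simp only [Function.comp_def] at h4
  rw [h1] at h4
  rw [h4]
  ext v
  simp [hr.ne']

lemma fderiv_radialExt_self {F : S2 → ℝ} (hF : SmoothS2 F) (x : S2) :
    fderiv ℝ (radialExt F) (x : E3) (x : E3) = 0 := by
  have h1 : HasDerivAt (fun t : ℝ => t • (x : E3)) ((1 : ℝ) • (x : E3)) 1 :=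
    (hasDerivAt_id (1 : ℝ)).smul_const _
  have h2 : HasFDerivAt (radialExt F) (fderiv ℝ (radialExt F) (x : E3)) ((1 : ℝ) • (x : E3)) := by
    rw [one_smul]; exact (hF.differentiableAt (coe_ne_zero x)).hasFDerivAt
  have h3 := h2.comp_hasDerivAt (1 : ℝ) h1
  have h4 : (radialExt F ∘ fun t : ℝ => t • (x : E3)) =ᶠ[𝓝 1] fun _ => F x := by
    filter_upwards [lt_mem_nhds (zero_lt_one' ℝ)] with t ht
    simp [radialExt_smul F ht]
  have h5 := h3.unique ((hasDerivAt_const (1 : ℝ) (F x)).congr_of_eventuallyEq h4)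
  simpa using h5

lemma E3_eq_sum (y : E3) : y = ∑ a, y a • EuclideanSpace.single a (1 : ℝ) := by
  ext i; fin_cases i <;> simp [Fin.sum_univ_three]

lemma sum_coe_mul_grad0 {F : S2 → ℝ} (hF : SmoothS2 F) (x : S2) :
    ∑ a, (x : E3) a * grad0 F x a = 0 := by
  have h := fderiv_radialExt_self hF x
  conv_lhs at h => arg 2; rw [E3_eq_sum (x : E3)]
  simpa [grad0] using h

lemma grad0_coordX (x : S2) (a b : Fin 3) :
    grad0 (coordX b) x a = (if a = b then 1 else 0) - coordX a x * coordX b x := by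
  have h1 : radialExt (coordX b) =ᶠ[𝓝 (x : E3)] fun y => ‖y‖⁻¹ * y b := by
    filter_upwards [isOpen_ne.mem_nhds (coe_ne_zero x)] with y hy
    rw [radialExt_of_ne _ hy]
    simp [coordX, toS2]
  have h2 : HasFDerivAt (fun y : E3 => y b) (EuclideanSpace.proj (𝕜 := ℝ) b) (x : E3) :=
    (EuclideanSpace.proj (𝕜 := ℝ) b).hasFDerivAt
  have hx : ‖(x : E3)‖ ≠ 0 := by simp
  have h3 := ((hasDerivAt_inv hx).comp_hasFDerivAt _ (hasFDerivAt_norm (coe_ne_zero x))).mul h2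
  have h4 : HasFDerivAt (fun y : E3 => ‖y‖⁻¹ * y b) _ (x : E3) := h3
  rw [grad0, h1.fderiv_eq, h4.fderiv]
  simp [coordX, EuclideanSpace.inner_single_right, eq_comm]
  ring

/-- A partial derivative of the extension is homogeneous of degree −1, so the ray-constant extension
of the gradient component is ‖y‖ times it. Differentiating the factor ‖y‖ gives the term with
`coordX`; the rest is a symmetric second derivative. -/
lemma grad0_grad0_comm {F : S2 → ℝ} (hF : SmoothS2 F) (x : S2) (a b : Fin 3) :
    grad0 (fun y => grad0 F y b) x a =
      grad0 (fun y => grad0 F y a) x b + coordX a x * grad0 F x b - coordX b x * grad0 F x a := by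
  have key : ∀ a b, grad0 (fun y => grad0 F y b) x a =
      coordX a x * grad0 F x b + fderiv ℝ (fderiv ℝ (radialExt F)) (x : E3)
        (EuclideanSpace.single a 1) (EuclideanSpace.single b 1) := by
    intro a b
    have h1 : radialExt (fun y => grad0 F y b) =ᶠ[𝓝 (x : E3)]
        fun y => ‖y‖ * fderiv ℝ (radialExt F) y (EuclideanSpace.single b 1) := by
      filter_upwards [isOpen_ne.mem_nhds (coe_ne_zero x)] with y hy
      have hy' : 0 < ‖y‖⁻¹ := inv_pos.2 (norm_pos_iff.2 hy)
      rw [radialExt_of_ne _ hy, grad0]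
      simp only [toS2]
      rw [fderiv_radialExt_smul hF hy' hy]
      simp
    have h2 : DifferentiableAt ℝ (fderiv ℝ (radialExt F)) (x : E3) :=
      ((hF.contDiffAt (coe_ne_zero x)).fderiv_right (m := 1) (by norm_cast)).differentiableAt
        (by simp)
    have h3 := (hasFDerivAt_norm (coe_ne_zero x)).mul
      (h2.hasFDerivAt.clm_apply (hasFDerivAt_const (EuclideanSpace.single b (1 : ℝ)) (x : E3)))
    have h4 : HasFDerivAt (fun y : E3 => ‖y‖ * fderiv ℝ (radialExt F) y
      (EuclideanSpace.single b 1)) _ (x : E3) := h3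
    rw [grad0, h1.fderiv_eq, h4.fderiv]
    simp [coordX, EuclideanSpace.inner_single_right, grad0]
    ring
  rw [key a b, key b a]
  have h5 := ((hF.contDiffAt (coe_ne_zero x)).isSymmSndFDerivAt (by simp; norm_cast)).eq
    (EuclideanSpace.single a (1 : ℝ)) (EuclideanSpace.single b 1)
  rw [h5]
  ring

lemma SmoothS2.integrable {F : S2 → ℝ} (hF : Continuous F) : Integrable F areaS2 :=
  hF.integrable_of_hasCompactSupport (HasCompactSupport.of_compactSpace F)

lemma integral_E3_polar (G : E3 → ℝ) :
    ∫ y, G y = ∫ p : S2 × Set.Ioi (0 : ℝ), G ((p.2 : ℝ) • (p.1 : E3))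
      ∂(areaS2.prod (Measure.volumeIoiPow 2)) := by
  have h := (volume : Measure E3).measurePreserving_homeomorphUnitSphereProd.integral_comp
    (Homeomorph.measurableEmbedding _)
    (fun p : S2 × Set.Ioi (0 : ℝ) => G ((p.2 : ℝ) • (p.1 : E3)))
  have h2 : Module.finrank ℝ E3 - 1 = 2 := by simp
  rw [h2] at h
  have h3 : ∫ y, G y = ∫ y : ({0}ᶜ : Set E3), G y ∂((volume : Measure E3).comap (↑)) := by
    rw [integral_subtype_comap (measurableSet_singleton _).compl, restrict_compl_singleton]
  rw [← h, h3]
  congr 1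
  ext y
  have : ‖(y : E3)‖ ≠ 0 := norm_ne_zero_iff.2 y.2
  simp [homeomorphUnitSphereProd, smul_smul, this]

lemma integrable_volumeIoiPow {φ : ℝ → ℝ} (hφ : Continuous φ) (hs : ∀ r, 3 ≤ r → φ r = 0)
    (n : ℕ) : Integrable (fun r : Set.Ioi (0 : ℝ) => φ r) (Measure.volumeIoiPow n) := by
  have h3 : (0 : ℝ) < 3 := by norm_num
  let R : Set.Ioi (0 : ℝ) := ⟨3, h3⟩
  have hsub : Function.support (fun r : Set.Ioi (0 : ℝ) => φ r) ⊆ Set.Iio R := by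
    intro r hr
    by_contra hc
    exact hr (hs r (not_lt.1 hc))
  rw [← integrableOn_iff_integrable_of_support_subset hsub]
  obtain ⟨K, hK⟩ := (isCompact_Icc (a := (0 : ℝ)) (b := 3)).exists_bound_of_continuousOn
    hφ.continuousOn
  refine Measure.integrableOn_of_bounded (M := K) ?_ ?_ ?_
  · rw [Measure.volumeIoiPow_apply_Iio]; exact ENNReal.ofReal_ne_top
  · exact (hφ.comp continuous_subtype_val).aestronglyMeasurable
  · refine (ae_restrict_iff' measurableSet_Iio).2 (Eventually.of_forall fun r hr => ?_)
    have hr' : (r : ℝ) < 3 := hr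
    exact hK r ⟨(le_of_lt r.2), hr'.le⟩

/-- Polar coordinates turn the divergence theorem in space into one on the sphere, up to constants
that depend only on the radial cutoff. -/
lemma exists_radial_constants : ∃ α β : ℝ, 0 < β ∧ ∀ F : S2 → ℝ, SmoothS2 F → ∀ a : Fin 3,
    α * integralS2 (fun x => coordX a x * F x) + β * integralS2 (fun x => grad0 F x a) = 0 := by
  -- A radial cutoff supported in 1 ≤ r ≤ 3, so that φ(‖y‖) times the extension of F is smooth at
  -- the origin and compactly supported.
  let φ : ContDiffBump (2 : ℝ) := ⟨1/2, 1, by norm_num, by norm_num⟩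
  have hφ : ContDiff ℝ ∞ (φ : ℝ → ℝ) := φ.contDiff
  have hout : ∀ r : ℝ, 1 ≤ |r - 2| → φ r = 0 := fun r hr =>
    φ.zero_of_le_dist (by simpa [Real.dist_eq, φ] using hr)
  have hsupp : tsupport (φ : ℝ → ℝ) = Metric.closedBall 2 1 := φ.tsupport_eq
  have hdout : ∀ r : ℝ, 1 < |r - 2| → deriv φ r = 0 := by
    intro r hr
    have h : r ∉ tsupport (φ : ℝ → ℝ) := by
      rw [hsupp]; simpa [Real.dist_eq] using hr
    by_contra hc
    exact h (support_deriv_subset hc)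
  have hdc : Continuous (deriv φ) := hφ.continuous_deriv (by simp)
  have hd3 : ∀ r, 3 ≤ r → deriv φ r = 0 := by
    intro r hr
    -- The radius 3 lies in the closed support, so the derivative vanishes there only by continuity.
    rcases hr.eq_or_lt with rfl | hr
    · have hcl : Set.EqOn (deriv φ) (fun _ => 0) (closure (Set.Ioi 3)) := by
        refine Set.EqOn.closure (fun r hr => hdout r ?_) hdc continuous_const
        have : (3 : ℝ) < r := hr
        rw [abs_of_pos] <;> linarith
      exact hcl (by rw [closure_Ioi]; exact Set.self_mem_Ici)
    · refine hdout r ?_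
      rw [abs_of_pos] <;> linarith
  have hψc : Continuous (fun r : ℝ => φ r * r⁻¹) := by
    rw [continuous_iff_continuousAt]
    intro r
    by_cases hr : r = 0
    · subst hr
      have : (fun r : ℝ => φ r * r⁻¹) =ᶠ[𝓝 0] fun _ => 0 := by
        filter_upwards [gt_mem_nhds (show (0 : ℝ) < 1 by norm_num)] with r hr
        rw [hout r (by rw [abs_of_neg] <;> linarith), zero_mul]
      exact continuousAt_const.congr this.symm
    · exact hφ.continuous.continuousAt.mul (continuousAt_inv₀ hr)
  have hψ3 : ∀ r : ℝ, 3 ≤ r → φ r * r⁻¹ = 0 := by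
    intro r hr
    rw [hout r (by rw [abs_of_pos] <;> linarith), zero_mul]
  have i1 := integrable_volumeIoiPow hdc hd3 2
  have i2 := integrable_volumeIoiPow hψc hψ3 2
  -- The constants are ∫ φ′ r² dr and ∫ φ r dr: the radial part of the gradient of the test function
  -- carries φ′, the tangential part carries φ/r.
  refine ⟨∫ r : Set.Ioi (0 : ℝ), deriv φ r ∂(Measure.volumeIoiPow 2),
    ∫ r : Set.Ioi (0 : ℝ), φ r * (r : ℝ)⁻¹ ∂(Measure.volumeIoiPow 2), ?_, ?_⟩
  · have hnn : 0 ≤ fun r : Set.Ioi (0 : ℝ) => φ r * (r : ℝ)⁻¹ := fun r =>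
      mul_nonneg φ.nonneg (inv_nonneg.2 (le_of_lt r.2))
    rw [integral_pos_iff_support_of_nonneg hnn i2]
    let R₁ : Set.Ioi (0 : ℝ) := ⟨3/2, by norm_num⟩
    let R₂ : Set.Ioi (0 : ℝ) := ⟨5/2, by norm_num⟩
    have hsub : Set.Iio R₂ \ Set.Iio R₁ ⊆
        Function.support (fun r : Set.Ioi (0 : ℝ) => φ r * (r : ℝ)⁻¹) := by
      rintro r ⟨h2, h1⟩
      have h2' : (r : ℝ) < 5/2 := h2
      have h1' : (3/2 : ℝ) ≤ r := not_lt.1 h1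
      have : φ (r : ℝ) = 1 := φ.one_of_mem_closedBall (by
        rw [Metric.mem_closedBall, Real.dist_eq, abs_le]
        simp only [φ]
        constructor <;> linarith)
      simp only [Function.mem_support, this, one_mul]
      have := r.2
      exact inv_ne_zero (ne_of_gt this)
    refine lt_of_lt_of_le ?_ (measure_mono hsub)
    refine lt_of_lt_of_le ?_ (le_measure_sdiff (μ := Measure.volumeIoiPow 2))
    rw [Measure.volumeIoiPow_apply_Iio, Measure.volumeIoiPow_apply_Iio]
    refine tsub_pos_of_lt ?_
    rw [ENNReal.ofReal_lt_ofReal_iff] <;> norm_num [R₁, R₂]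
  · intro F hF a
    set h : E3 → ℝ := fun y => φ ‖y‖ * radialExt F y with hh
    have hzero : ∀ y : E3, ‖y‖ < 1 → h y = 0 := fun y hy => by
      simp only [hh]; rw [hout _ (by rw [abs_of_neg] <;> linarith), zero_mul]
    have hev0 : h =ᶠ[𝓝 0] fun _ => 0 := by
      filter_upwards [Metric.ball_mem_nhds (0 : E3) zero_lt_one] with y hy
      exact hzero y (by simpa using hy)
    have hsm : ContDiff ℝ 1 h := by
      rw [contDiff_iff_contDiffAt]
      intro y
      by_cases hy : y = 0
      · subst hy
        exact (contDiffAt_const (c := (0 : ℝ))).congr_of_eventuallyEq hev0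
      · exact (((hφ.contDiffAt.comp y (contDiffAt_norm ℝ hy)).mul
          (hF.contDiffAt hy))).of_le (by norm_cast)
    have hcs : HasCompactSupport h := by
      refine HasCompactSupport.intro (isCompact_closedBall (0 : E3) 3) fun y hy => ?_
      have hy' : 3 < ‖y‖ := by simpa using hy
      simp only [hh]; rw [hout _ (by rw [abs_of_pos] <;> linarith), zero_mul]
    have hdi : Integrable (fun y => fderiv ℝ h y (EuclideanSpace.single a 1)) := by
      refine Continuous.integrable_of_hasCompactSupport ?_ ?_
      · exact (hsm.continuous_fderiv (by simp)).clm_apply continuous_const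
      · exact hcs.fderiv_apply ℝ _
    have h0 : ∫ y, fderiv ℝ h y (EuclideanSpace.single a 1) = 0 := by
      have := integral_mul_fderiv_eq_neg_fderiv_mul_of_integrable (μ := (volume : Measure E3))
        (f := fun _ => (1 : ℝ)) (g := h) (v := EuclideanSpace.single a 1) (by simp)
        (by simpa using hdi) (by simpa using hsm.continuous.integrable_of_hasCompactSupport hcs)
        (fun x _ => differentiableAt_const _) (fun x _ => hsm.differentiable (by simp) x)
      simpa using this
    have hder : ∀ p : S2 × Set.Ioi (0 : ℝ),
        fderiv ℝ h ((p.2 : ℝ) • (p.1 : E3)) (EuclideanSpace.single a 1) =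
          (coordX a p.1 * F p.1) * deriv φ p.2 + grad0 F p.1 a * (φ p.2 * (p.2 : ℝ)⁻¹) := by
      rintro ⟨x, r, hr⟩
      have hr' : 0 < r := hr
      have hy : r • (x : E3) ≠ 0 := smul_ne_zero hr'.ne' (coe_ne_zero x)
      have hn : ‖r • (x : E3)‖ = r := by
        rw [norm_smul, norm_coe_S2, mul_one, Real.norm_eq_abs, abs_of_pos hr']
      have d1 : HasDerivAt (φ : ℝ → ℝ) (deriv φ r) ‖r • (x : E3)‖ := by
        rw [hn]; exact (hφ.differentiable (by simp) r).hasDerivAt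
      have d2 := (d1.comp_hasFDerivAt _ (hasFDerivAt_norm hy)).mul
        (hF.differentiableAt hy).hasFDerivAt
      have d3 : HasFDerivAt h _ (r • (x : E3)) := d2
      rw [d3.fderiv, fderiv_radialExt_smul hF hr' (coe_ne_zero x)]
      simp [hn, radialExt_smul F hr', grad0, coordX, EuclideanSpace.inner_single_right]
      field_simp
      ring
    rw [integral_E3_polar] at h0
    simp only [hder] at h0
    rw [integral_add,
      integral_prod_mul (fun x => coordX a x * F x) (fun r : Set.Ioi (0 : ℝ) => deriv φ r),
      integral_prod_mul (fun x => grad0 F x a)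
        (fun r : Set.Ioi (0 : ℝ) => φ r * (r : ℝ)⁻¹)] at h0
    · rw [integralS2, integralS2]; linarith
    · exact (SmoothS2.integrable ((smoothS2_coordX a).continuous.mul hF.continuous)).mul_prod i1
    · exact (SmoothS2.integrable (hF.grad0 a).continuous).mul_prod i2

lemma sum_coordX_sq (x : S2) : ∑ a, coordX a x * coordX a x = 1 := by
  have h := norm_coe_S2 x
  rw [EuclideanSpace.norm_eq, Real.sqrt_eq_one] at h
  simpa [coordX, sq] using h

lemma areaS2_real_univ_pos : 0 < areaS2.real Set.univ := by
  rw [measureReal_def, ENNReal.toReal_pos_iff]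
  exact ⟨Measure.measure_univ_pos.2 (Measure.toSphere_ne_zero (volume : Measure E3)),
    measure_lt_top _ _⟩

/-- The divergence theorem on the sphere, in ambient components. -/
lemma integralS2_grad0 {F : S2 → ℝ} (hF : SmoothS2 F) (a : Fin 3) :
    integralS2 (fun x => grad0 F x a) = 2 * integralS2 (fun x => coordX a x * F x) := by
  obtain ⟨α, β, hβ, h⟩ := exists_radial_constants
  have hi : ∀ b, Integrable (fun x => coordX b x * coordX b x) areaS2 := fun b =>
    SmoothS2.integrable ((smoothS2_coordX b).continuous.mul (smoothS2_coordX b).continuous)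
  have h1 : ∑ b, integralS2 (fun x => coordX b x * coordX b x) = areaS2.real Set.univ := by
    simp only [integralS2]
    rw [← integral_finsetSum _ fun b _ => hi b]
    simp [sum_coordX_sq]
  have h2 : ∀ b, integralS2 (fun x => grad0 (coordX b) x b) =
      areaS2.real Set.univ - integralS2 (fun x => coordX b x * coordX b x) := by
    intro b
    simp only [integralS2, grad0_coordX, if_true]
    rw [integral_sub (integrable_const _) (hi b)]
    simp
  -- The ratio of the two constants is found by testing on F = X_b and summing over b: the squares
  -- X_b² add up to 1 and the D_b X_b to 2, hence α = −2β.
  have h3 := fun b => h (coordX b) (smoothS2_coordX b) b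
  simp only [h2] at h3
  have h4 : ∑ b, (α * integralS2 (fun x => coordX b x * coordX b x) +
      β * (areaS2.real Set.univ - integralS2 (fun x => coordX b x * coordX b x))) = 0 :=
    Finset.sum_eq_zero fun b _ => h3 b
  rw [Finset.sum_add_distrib, ← Finset.mul_sum, ← Finset.mul_sum, Finset.sum_sub_distrib, h1] at h4
  simp only [Finset.sum_const, Finset.card_univ, Fintype.card_fin, nsmul_eq_mul, Nat.cast_ofNat]
    at h4
  have hA := areaS2_real_univ_pos
  have h5 : α = -2 * β := by
    have : (α + 2 * β) * areaS2.real Set.univ = 0 := by linarith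
    rcases mul_eq_zero.1 this with h | h
    · linarith
    · exact absurd h hA.ne'
  have h6 := h F hF a
  rw [h5] at h6
  have : β * (integralS2 (fun x => grad0 F x a) - 2 * integralS2 (fun x => coordX a x * F x)) = 0 := by
    linarith
  rcases mul_eq_zero.1 this with h | h
  · exact absurd h hβ.ne'
  · linarith

/-! ### Algebraic tensor calculus on the sphere in ambient components -/

/-- The algebra of smooth functions on the sphere with the coordinate functions, the components of
the tangential gradient and the integral. -/
structure SphereCalculus (A : Type*) [CommRing A] [Algebra ℝ A] where
  X : Fin 3 → A
  D : Fin 3 → Derivation ℝ A A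
  I : A →ₗ[ℝ] ℝ
  X_sq : ∑ a, X a * X a = 1
  D_X' : ∀ a b, D a (X b) = (if a = b then 1 else 0) - X a * X b
  X_D : ∀ F, ∑ a, X a * D a F = 0
  comm : ∀ a b F, D a (D b F) = D b (D a F) + X a * D b F - X b * D a F
  I_D : ∀ a F, I (D a F) = 2 * I (X a * F)

namespace SphereCalculus

variable {A : Type*} [CommRing A] [Algebra ℝ A] (S : SphereCalculus A)

/-- The round metric. -/
def sg (a b : Fin 3) : A := (if a = b then 1 else 0) - S.X a * S.X b

/-- The Laplacian. -/
def lp (F : A) : A := ∑ a, S.D a (S.D a F)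

/-- The Hessian. -/
def hs (F : A) (a b : Fin 3) : A := S.D a (S.D b F) + S.X b * S.D a F

/-- Twice the traceless Hessian. -/
def hess2 (F : A) (a b : Fin 3) : A := 2 * S.hs F a b - S.sg a b * S.lp F

/-- The operator `Δ(Δ + 2)`. -/
def lp2 (F : A) : A := S.lp (S.lp F) + 2 * S.lp F

/-- Symmetric traceless tangential two-tensors. -/
structure STT (T : Fin 3 → Fin 3 → A) : Prop where
  symm : ∀ a b, T a b = T b a
  tang : ∀ b, ∑ a, S.X a * T a b = 0
  trace : ∑ a, T a a = 0

/-- The divergence of a symmetric traceless two-tensor. -/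
def dv (T : Fin 3 → Fin 3 → A) (b : Fin 3) : A := ∑ a, S.D a (T a b)

/-- The double divergence of a symmetric traceless two-tensor. -/
def ddv (T : Fin 3 → Fin 3 → A) : A := ∑ b, S.D b (S.dv T b)

/-- The covariant derivative of a one-form. -/
def gr (w : Fin 3 → A) (a b : Fin 3) : A := ∑ d, S.sg b d * S.D a (w d)

/-- The divergence of a general two-tensor. -/
def gdv (T : Fin 3 → Fin 3 → A) (b : Fin 3) : A := ∑ e, S.sg b e * ∑ d, S.D d (T d e)

/-- The components of the rotation field generated by `κ`. -/
def rv (κ : Fin 3 → Fin 3 → ℝ) (a : Fin 3) : A := ∑ c, algebraMap ℝ A (κ a c) * S.X c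

/-- The derivative along the rotation field generated by `κ`. -/
def rot (κ : Fin 3 → Fin 3 → ℝ) : Derivation ℝ A A := ∑ a, S.rv κ a • S.D a

/-- The Lie derivative of a two-tensor along the rotation field generated by `κ`. -/
def lie (κ : Fin 3 → Fin 3 → ℝ) (T : Fin 3 → Fin 3 → A) (a b : Fin 3) : A :=
  S.rot κ (T a b) + ∑ d, algebraMap ℝ A (κ d a) * T d b + ∑ d, algebraMap ℝ A (κ d b) * T a d

/-! ### Elementary identities for the ambient components of the tangential derivative. -/

lemma D_X (a b : Fin 3) : S.D a (S.X b) = S.sg a b := S.D_X' a b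

lemma D_mul (a : Fin 3) (F G : A) : S.D a (F * G) = S.D a F * G + F * S.D a G := by
  rw [Derivation.leibniz]; simp only [smul_eq_mul]; ring

lemma D_const (a : Fin 3) (r : ℝ) : S.D a (algebraMap ℝ A r) = 0 := Derivation.map_algebraMap _ _

lemma D_two (a : Fin 3) : S.D a (2 : A) = 0 := by
  have := S.D_const a 2
  rwa [map_ofNat] at this

lemma rot_apply (κ : Fin 3 → Fin 3 → ℝ) (F : A) : S.rot κ F = ∑ a, S.rv κ a * S.D a F := by
  simp [rot, Fin.sum_univ_three]

lemma rot_mul (κ : Fin 3 → Fin 3 → ℝ) (F G : A) :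
    S.rot κ (F * G) = S.rot κ F * G + F * S.rot κ G := by
  rw [Derivation.leibniz]; simp only [smul_eq_mul]; ring

lemma X_sq' : S.X 0 * S.X 0 + S.X 1 * S.X 1 + S.X 2 * S.X 2 = 1 := by
  simpa [Fin.sum_univ_three] using S.X_sq

lemma sg_symm (a b : Fin 3) : S.sg a b = S.sg b a := by
  simp only [sg, eq_comm (a := a)]; ring

lemma sum_sg (b : Fin 3) (v : Fin 3 → A) :
    ∑ a, S.sg a b * v a = v b - S.X b * ∑ a, S.X a * v a := by
  fin_cases b <;> simp [sg, Fin.sum_univ_three] <;> ring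

lemma sum_sg' (b : Fin 3) (v : Fin 3 → A) :
    ∑ a, S.sg b a * v a = v b - S.X b * ∑ a, S.X a * v a := by
  simp only [S.sg_symm b]; exact S.sum_sg b v

lemma sum_sg_D (b : Fin 3) (F : A) : ∑ a, S.sg a b * S.D a F = S.D b F := by
  rw [S.sum_sg b (fun a => S.D a F), S.X_D]; ring

lemma sum_sg_D' (b : Fin 3) (F : A) : ∑ a, S.sg b a * S.D a F = S.D b F := by
  rw [S.sum_sg' b (fun a => S.D a F), S.X_D]; ring

lemma sum_sg_X (b : Fin 3) : ∑ a, S.sg a b * S.X a = 0 := by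
  rw [S.sum_sg b S.X, S.X_sq]; ring

lemma sg_trace : ∑ a, S.sg a a = 2 := by
  simp only [sg, if_true, Fin.sum_univ_three]; linear_combination -S.X_sq'

lemma D_sg (c a b : Fin 3) : S.D c (S.sg a b) = -(S.sg c a * S.X b) - S.X a * S.sg c b := by
  have h : S.D c (if a = b then (1 : A) else 0) = 0 := by split_ifs <;> simp
  conv_lhs => rw [sg]
  rw [map_sub, h, D_mul, D_X, D_X]; ring

/-- Obtained by differentiating `X_D`. It measures how far D_b D_a F is from being tangential in the
slot a, which is why `hs` contains the correction `S.X b * S.D a F`. -/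
lemma X_DD (b : Fin 3) (F : A) : ∑ a, S.X a * S.D b (S.D a F) = -S.D b F := by
  have h := congrArg (S.D b) (S.X_D F)
  have h2 := S.sum_sg_D' b F
  simp only [Fin.sum_univ_three, map_add, D_mul, D_X, map_zero] at h h2 ⊢
  linear_combination h - h2

/-! ### Laplacian, traceless Hessian and integration by parts. -/

lemma lp_add (F G : A) : S.lp (F + G) = S.lp F + S.lp G := by
  simp [lp, Finset.sum_add_distrib]

lemma lp_smul (r : ℝ) (F : A) : S.lp (r • F) = r • S.lp F := by
  simp [lp, Finset.smul_sum]

lemma lp_mul (F G : A) :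
    S.lp (F * G) = S.lp F * G + F * S.lp G + 2 * ∑ a, S.D a F * S.D a G := by
  simp only [lp, D_mul, map_add, Fin.sum_univ_three]; ring

lemma lp_X (k : Fin 3) : S.lp (S.X k) = -2 * S.X k := by
  have h := S.sum_sg_X k
  have h2 := S.sg_trace
  simp only [lp, D_X, D_sg, Fin.sum_univ_three] at h h2 ⊢
  linear_combination -h - S.X k * h2

/-- Two applications of `comm`. The resulting multiples of D_b F, namely −1, 2 and −1, cancel, so no
curvature term appears in ambient components. -/
lemma lp_D (b : Fin 3) (F : A) :
    ∑ a, S.D a (S.D a (S.D b F)) = S.D b (S.lp F) - 2 * S.X b * S.lp F := by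
  have e : ∀ a, S.D a (S.D a (S.D b F)) = S.D b (S.D a (S.D a F)) + S.X a * S.D b (S.D a F)
      - S.X b * S.D a (S.D a F) + S.sg a a * S.D b F + S.X a * S.D a (S.D b F)
      - S.sg a b * S.D a F - S.X b * S.D a (S.D a F) := by
    intro a
    have c1 := congrArg (S.D a) (S.comm a b F)
    have c2 := S.comm a b (S.D a F)
    simp only [map_add, map_sub, D_mul, D_X] at c1
    linear_combination c1 + c2
  have h1 := S.X_DD b F
  have h2 := S.sg_trace
  have h3 := S.X_D (S.D b F)
  have h4 := S.sum_sg_D b F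
  simp only [e, lp, map_add, Fin.sum_univ_three] at h1 h2 h3 h4 ⊢
  linear_combination h1 + S.D b F * h2 + h3 - h4

lemma hs_symm (F : A) (a b : Fin 3) : S.hs F a b = S.hs F b a := by
  rw [hs, hs, S.comm a b F]; ring

lemma hs_tang (F : A) (b : Fin 3) : ∑ a, S.X a * S.hs F a b = 0 := by
  have h1 := S.X_D (S.D b F)
  have h2 := S.X_D F
  simp only [hs, Fin.sum_univ_three] at h1 h2 ⊢
  linear_combination h1 + S.X b * h2

lemma hess2_stt (F : A) : S.STT (S.hess2 F) where
  symm a b := by rw [hess2, hess2, S.hs_symm, S.sg_symm]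
  tang b := by
    have h1 := S.hs_tang F b
    have h2 := S.sum_sg_X b
    simp only [hess2, Fin.sum_univ_three] at h1 h2 ⊢
    linear_combination 2 * h1 - S.lp F * h2
  trace := by
    have h1 := S.sg_trace
    have h2 := S.X_D F
    have h3 : S.lp F = ∑ a, S.D a (S.D a F) := rfl
    simp only [hess2, hs, Fin.sum_univ_three] at h1 h2 h3 ⊢
    linear_combination 2 * h2 - S.lp F * h1 - 2 * h3

/-- The Bochner formula on the unit sphere: Gauss curvature one produces the term 2 D_b F, hence the
operator Δ(Δ+2). -/
lemma dv_hess2 (F : A) (b : Fin 3) : S.dv (S.hess2 F) b = S.D b (S.lp F) + 2 * S.D b F := by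
  have h1 := S.lp_D b F
  have h2 := S.sum_sg_D b F
  have h3 := S.sum_sg_D b (S.lp F)
  have h4 := S.sg_trace
  have h5 := S.sum_sg_X b
  have h6 : S.lp F = ∑ a, S.D a (S.D a F) := rfl
  simp only [dv, hess2, hs, map_sub, map_add, D_mul, D_two, D_X, D_sg, Fin.sum_univ_three]
    at h1 h2 h3 h4 h5 h6 ⊢
  linear_combination 2 * h1 + 2 * h2 - h3 + S.lp F * S.X b * h4 + S.lp F * h5 - 2 * S.X b * h6

lemma ddv_hess2 (F : A) : S.ddv (S.hess2 F) = S.lp2 F := by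
  simp only [ddv, dv_hess2, lp2, map_add, D_mul, D_two, Finset.sum_add_distrib, zero_mul, zero_add,
    ← Finset.mul_sum]
  rfl

/-- The ℓ = 1 half of the kernel of the traceless Hessian. With `hess2_const` it explains why modes
ℓ ≤ 1 of f change the shear only through the shift of time, and why div div C is orthogonal to X^k.
-/
lemma hess2_X (k a b : Fin 3) : S.hess2 (S.X k) a b = 0 := by
  simp only [hess2, hs, lp_X, D_X, D_sg]; ring

lemma hess2_const (r : ℝ) (a b : Fin 3) : S.hess2 (algebraMap ℝ A r) a b = 0 := by
  simp [hess2, hs, lp]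

/-- By `I_D` the integral is 2 ∫ X·v, which vanishes for tangential v. -/
lemma I_div (v : Fin 3 → A) (hv : ∑ a, S.X a * v a = 0) : S.I (∑ a, S.D a (v a)) = 0 := by
  simp only [map_sum, I_D, ← Finset.mul_sum]
  rw [← map_sum, hv, map_zero, mul_zero]

/-- Differentiating the tangency of T gives Σ X_b D_a T_{ab} = −tr T = 0. Thus the unprojected
divergence `dv` is already tangential. -/
lemma STT.dv_tang {T : Fin 3 → Fin 3 → A} {S : SphereCalculus A} (hT : S.STT T) :
    ∑ b, S.X b * S.dv T b = 0 := by
  have e : ∀ a, S.D a (∑ b, S.X b * T b a) = 0 := fun a => by rw [hT.tang, map_zero]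
  have h0 := e 0
  have h1 := e 1
  have h2 := e 2
  have t0 := hT.tang 0
  have t1 := hT.tang 1
  have t2 := hT.tang 2
  have h3 := hT.trace
  simp only [map_add, D_mul, D_X, Fin.sum_univ_three, dv, hT.symm 1 0, hT.symm 2 0, hT.symm 2 1]
    at h0 h1 h2 h3 t0 t1 t2 ⊢
  simp [sg] at h0 h1 h2
  linear_combination h0 + h1 + h2 - h3 + S.X 0 * t0 + S.X 1 * t1 + S.X 2 * t2

/-- Double integration by parts. -/
lemma STT.I_hess2 {T : Fin 3 → Fin 3 → A} {S : SphereCalculus A} (hT : S.STT T) (F : A) :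
    S.I (∑ a, ∑ b, T a b * S.hess2 F a b) = 2 * S.I (S.ddv T * F) := by
  have t1 : ∑ a, ∑ b, T a b * S.hess2 F a b = 2 * ∑ a, ∑ b, T a b * S.D a (S.D b F) := by
    have e : ∀ a, ∑ b, S.X b * T a b = 0 := fun a => by
      rw [← hT.tang a]; simp only [hT.symm a]
    have e0 := e 0
    have e1 := e 1
    have e2 := e 2
    have h3 := hT.trace
    simp only [hess2, hs, sg, Fin.sum_univ_three] at e0 e1 e2 h3 ⊢
    simp
    linear_combination (2 * S.D 0 F + S.X 0 * S.lp F) * e0 + (2 * S.D 1 F + S.X 1 * S.lp F) * e1 +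
      (2 * S.D 2 F + S.X 2 * S.lp F) * e2 - S.lp F * h3
  have t2 : ∑ a, ∑ b, T a b * S.D a (S.D b F) - S.ddv T * F =
      ∑ a, S.D a (∑ b, T a b * S.D b F) - ∑ a, S.D a (S.dv T a * F) := by
    simp only [ddv, dv, map_add, D_mul, Fin.sum_univ_three]; ring
  have t3 := S.I_div (fun a => ∑ b, T a b * S.D b F) (by
    have e0 := hT.tang 0
    have e1 := hT.tang 1
    have e2 := hT.tang 2
    simp only [Fin.sum_univ_three] at e0 e1 e2 ⊢
    linear_combination S.D 0 F * e0 + S.D 1 F * e1 + S.D 2 F * e2)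
  have t4 := S.I_div (fun a => S.dv T a * F) (by
    have e0 := hT.dv_tang
    simp only [Fin.sum_univ_three] at e0 ⊢
    linear_combination F * e0)
  have t5 := congrArg S.I t2
  rw [map_sub, map_sub, t3, t4, sub_zero, sub_eq_zero] at t5
  rw [t1, two_mul, map_add, t5, two_mul]

/-! #### Rotations -/

/-- Antisymmetric matrices, the generators of rotations. -/
def Skew (κ : Fin 3 → Fin 3 → ℝ) : Prop := ∀ a b, κ b a = -κ a b

lemma Skew.entries {κ : Fin 3 → Fin 3 → ℝ} (hκ : Skew κ) :
    κ 0 0 = 0 ∧ κ 1 1 = 0 ∧ κ 2 2 = 0 ∧ κ 1 0 = -κ 0 1 ∧ κ 2 0 = -κ 0 2 ∧ κ 2 1 = -κ 1 2 := by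
  have h0 := hκ 0 0
  have h1 := hκ 1 1
  have h2 := hκ 2 2
  refine ⟨by linarith, by linarith, by linarith, hκ _ _, hκ _ _, hκ _ _⟩

variable {S}
variable {κ : Fin 3 → Fin 3 → ℝ}

lemma rv_tang (hκ : Skew κ) : ∑ a, S.X a * S.rv κ a = 0 := by
  obtain ⟨h0, h1, h2, h3, h4, h5⟩ := hκ.entries
  simp only [rv, Fin.sum_univ_three, h0, h1, h2, h3, h4, h5, map_zero, map_neg]; ring

lemma rot_X (hκ : Skew κ) (b : Fin 3) : S.rot κ (S.X b) = S.rv κ b := by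
  simp only [rot_apply, D_X]
  have h := S.sum_sg b (S.rv κ)
  rw [rv_tang hκ] at h
  simp only [mul_comm (S.rv κ _)]
  rw [h]; ring

/-- The ambient frame is itself rotated, which costs a κ term. The definition of `lie` compensates
for such terms slot by slot. -/
lemma D_rot (hκ : Skew κ) (b : Fin 3) (F : A) :
    S.D b (S.rot κ F) = S.rot κ (S.D b F) + ∑ a, algebraMap ℝ A (κ a b) * S.D a F := by
  have h := rv_tang (S := S) hκ
  obtain ⟨h0, h1, h2, h3, h4, h5⟩ := hκ.entries
  have e : ∀ a, S.D b (S.D a F) = S.D a (S.D b F) + S.X b * S.D a F - S.X a * S.D b F :=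
    fun a => S.comm b a F
  simp only [rot_apply, map_sum, D_mul, e]
  have h' : ∀ a, S.D b (S.rv κ a) = algebraMap ℝ A (κ a b) - S.X b * S.rv κ a := by
    intro a
    simp only [rv, map_sum, D_mul, D_const, D_X, zero_mul, zero_add]
    have := S.sum_sg' b (fun c => algebraMap ℝ A (κ a c))
    simp only [Fin.sum_univ_three] at this ⊢
    linear_combination this
  simp only [h', Fin.sum_univ_three] at h ⊢
  linear_combination -S.D b F * h

lemma I_rot (hκ : Skew κ) (F : A) : S.I (S.rot κ F) = 0 := by
  have h := S.I_div (fun a => S.rv κ a * F) (by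
    have := rv_tang (S := S) hκ
    simp only [Fin.sum_univ_three] at this ⊢
    linear_combination F * this)
  rw [← h]
  congr 1
  obtain ⟨h0, h1, h2, h3, h4, h5⟩ := hκ.entries
  simp [rot_apply, rv, D_X, sg, Fin.sum_univ_three, h0, h1, h2, h3, h4, h5]
  ring

lemma I_rot_mul (hκ : Skew κ) (F G : A) : S.I (S.rot κ F * G) = -S.I (F * S.rot κ G) := by
  have h := I_rot (S := S) hκ (F * G)
  rw [rot_mul, map_add] at h
  linarith

/-- Rotations are isometries: the κ terms of `D_rot` cancel by skewness. -/
lemma lp_rot (hκ : Skew κ) (F : A) : S.lp (S.rot κ F) = S.rot κ (S.lp F) := by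
  simp only [lp, D_rot hκ, map_add, map_sum, D_mul, D_const]
  obtain ⟨h0, h1, h2, h3, h4, h5⟩ := hκ.entries
  simp only [Fin.sum_univ_three, h0, h1, h2, h3, h4, h5, map_zero, map_neg]
  ring

lemma rot_two : S.rot κ (2 : A) = 0 := by simp [rot_apply, D_two]

lemma rot_lp2 (hκ : Skew κ) (F : A) : S.lp2 (S.rot κ F) = S.rot κ (S.lp2 F) := by
  simp only [lp2, lp_rot hκ, map_add, rot_mul, rot_two]; ring

lemma lie_sg (hκ : Skew κ) (a b : Fin 3) : S.lie κ S.sg a b = 0 := by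
  have h : S.rot κ (S.sg a b) = -(S.rv κ a * S.X b) - S.X a * S.rv κ b := by
    have h1 : S.rot κ (if a = b then (1 : A) else 0) = 0 := by split_ifs <;> simp
    conv_lhs => rw [sg]
    rw [map_sub, h1, rot_mul, rot_X hκ, rot_X hκ]; ring
  obtain ⟨h0, h1, h2, h3, h4, h5⟩ := hκ.entries
  rw [lie, h]
  fin_cases a <;> fin_cases b <;>
  · simp [sg, rv, Fin.sum_univ_three, h0, h1, h2, h3, h4, h5]
    try ring

lemma lie_hs (hκ : Skew κ) (F : A) (a b : Fin 3) : S.lie κ (S.hs F) a b = S.hs (S.rot κ F) a b := by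
  have e : ∑ d, algebraMap ℝ A (κ d b) * S.X d = -S.rv κ b := by
    simp only [rv, hκ b, Fin.sum_univ_three, map_neg]; ring
  simp only [lie, hs, D_rot hκ, map_add, map_sum, D_mul, D_const, rot_mul, rot_X hκ]
  simp only [Fin.sum_univ_three] at e ⊢
  linear_combination S.D a F * e

/-- Naturality of the Hessian under isometries. The Lie derivative of a traceless Hessian is again
one, so the double integration by parts `STT.I_hess2` applies to it. -/
lemma lie_hess2 (hκ : Skew κ) (F : A) (a b : Fin 3) :
    S.lie κ (S.hess2 F) a b = S.hess2 (S.rot κ F) a b := by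
  have h1 := lie_hs (S := S) hκ F a b
  have h2 := lie_sg (S := S) hκ a b
  simp only [lie, hess2, map_sub, rot_mul, rot_two, lp_rot hκ, Fin.sum_univ_three] at h1 h2 ⊢
  linear_combination 2 * h1 - S.lp F * h2

end SphereCalculus

namespace SphereCalculus

variable {A : Type*} [CommRing A] [Algebra ℝ A] {S : SphereCalculus A}

/-! #### The co-closed part of a shear tensor -/

variable (S) in
/-- The volume form. -/
def ep (a b : Fin 3) : A := ∑ c, algebraMap ℝ A (leviCivita a b c) * S.X c

variable (S) in
/-- Twice the symmetric traceless tensor with co-closed potential `F`. -/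
def curl2 (F : A) (a b : Fin 3) : A :=
  ∑ e, S.ep a e * S.hs F e b + ∑ e, S.ep b e * S.hs F e a

lemma ep_entries : S.ep 0 0 = 0 ∧ S.ep 1 1 = 0 ∧ S.ep 2 2 = 0 ∧ S.ep 0 1 = S.X 2 ∧
    S.ep 1 2 = S.X 0 ∧ S.ep 2 0 = S.X 1 ∧ S.ep 1 0 = -S.X 2 ∧ S.ep 2 1 = -S.X 0 ∧
    S.ep 0 2 = -S.X 1 := by
  refine ⟨?_, ?_, ?_, ?_, ?_, ?_, ?_, ?_, ?_⟩ <;>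
    · simp [ep, leviCivita, Fin.sum_univ_three]
      try norm_num
      try rw [map_ofNat]; ring

/-- The contraction ε^{ae}∇_a∇_e∇_b F is a pure curvature term, and the Gauss curvature is one. -/
lemma dv_ep_hs (F : A) (b : Fin 3) :
    ∑ a, S.D a (∑ e, S.ep a e * S.hs F e b) = ∑ e, S.ep b e * S.D e F := by
  obtain ⟨e1, e2, e3, e4, e5, e6, e7, e8, e9⟩ := S.ep_entries
  have c1 := fun F => S.comm 1 0 F
  have c2 := fun F => S.comm 2 0 F
  have c3 := fun F => S.comm 2 1 F
  fin_cases b <;>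
  · simp [Fin.sum_univ_three, e1, e2, e3, e4, e5, e6, e7, e8, e9, hs, D_X, sg, c1, c2, c3]
    ring

lemma sum_D_ep_D (F : A) : ∑ b, S.D b (∑ e, S.ep b e * S.D e F) = 0 := by
  obtain ⟨e1, e2, e3, e4, e5, e6, e7, e8, e9⟩ := S.ep_entries
  have c1 := fun F => S.comm 1 0 F
  have c2 := fun F => S.comm 2 0 F
  have c3 := fun F => S.comm 2 1 F
  simp [Fin.sum_univ_three, e1, e2, e3, e4, e5, e6, e7, e8, e9, D_X, sg, c1, c2, c3]
  ring

lemma ddv_comm (Q : Fin 3 → Fin 3 → A) :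
    ∑ b, S.D b (∑ a, S.D a (Q a b)) = ∑ a, S.D a (∑ b, S.D b (Q a b)) +
      ∑ a, ∑ b, (S.X b * S.D a (Q a b) - S.X a * S.D b (Q a b)) := by
  have e : ∀ a b, S.D b (S.D a (Q a b)) = S.D a (S.D b (Q a b)) + S.X b * S.D a (Q a b)
    - S.X a * S.D b (Q a b) := fun a b => S.comm b a _
  simp only [Fin.sum_univ_three, map_add]
  linear_combination e 0 0 + e 0 1 + e 0 2 + e 1 0 + e 1 1 + e 1 2 + e 2 0 + e 2 1 + e 2 2

/-- One half of the tensor has divergence a rotated gradient, which is divergence free. The other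
half reduces to it on exchanging the two derivatives: the commutator terms contract ε with the
symmetric Hessian or with X and vanish. -/
lemma ddv_curl2 (F : A) : S.ddv (S.curl2 F) = 0 := by
  have h1 : S.ddv (S.curl2 F) = ∑ b, S.D b (∑ a, S.D a (∑ e, S.ep a e * S.hs F e b)) +
      ∑ b, S.D b (∑ a, S.D a (∑ e, S.ep b e * S.hs F e a)) := by
    simp only [ddv, dv, curl2, map_add, Fin.sum_univ_three]; ring
  rw [h1, ddv_comm (fun a b => ∑ e, S.ep b e * S.hs F e a)]
  simp only [dv_ep_hs, sum_D_ep_D, zero_add]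
  have h2 : ∀ a, ∑ b, S.X b * S.D a (∑ e, S.ep b e * S.hs F e a) =
      - ∑ b, S.sg a b * ∑ e, S.ep b e * S.hs F e a := by
    intro a
    have h3 : ∑ b, S.X b * ∑ e, S.ep b e * S.hs F e a = 0 := by
      obtain ⟨e1, e2, e3, e4, e5, e6, e7, e8, e9⟩ := S.ep_entries
      simp only [Fin.sum_univ_three, e1, e2, e3, e4, e5, e6, e7, e8, e9]; ring
    have h4 := congrArg (S.D a) h3
    rw [map_sum, map_zero] at h4
    simp only [D_mul, D_X, Finset.sum_add_distrib] at h4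
    linear_combination h4
  have h5 : ∑ a, ∑ b, S.X a * S.D b (∑ e, S.ep b e * S.hs F e a) = 0 := by
    have h6 : ∀ a, ∑ b, S.X a * S.D b (∑ e, S.ep b e * S.hs F e a) =
        S.X a * ∑ e, S.ep a e * S.D e F := by
      intro a; rw [← Finset.mul_sum, dv_ep_hs]
    simp only [h6]
    obtain ⟨e1, e2, e3, e4, e5, e6, e7, e8, e9⟩ := S.ep_entries
    simp only [Fin.sum_univ_three, e1, e2, e3, e4, e5, e6, e7, e8, e9]; ring
  simp only [Finset.sum_sub_distrib, h2, h5]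
  have h7 := S.hs_symm F 1 0
  have h8 := S.hs_symm F 2 0
  have h9 := S.hs_symm F 2 1
  obtain ⟨e1, e2, e3, e4, e5, e6, e7, e8, e9⟩ := S.ep_entries
  simp [Fin.sum_univ_three, e1, e2, e3, e4, e5, e6, e7, e8, e9, sg, h7, h8, h9]
  ring

/-! #### Symmetric traceless tensors in dimension two -/

/-- The cross product of two vectors tangent at x is its own normal component times x; this is the
first component. -/
lemma cross_tangent {R : Type*} [CommRing R] {x0 x1 x2 y0 y1 y2 t0 t1 t2 : R} (hx : x0 * x0 + x1 * x1 + x2 * x2 = 1)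
    (hy : x0 * y0 + x1 * y1 + x2 * y2 = 0) (ht : x0 * t0 + x1 * t1 + x2 * t2 = 0) :
    y1 * t2 - y2 * t1 = x0 * (x0 * (y1 * t2 - y2 * t1) + x1 * (y2 * t0 - y0 * t2) +
      x2 * (y0 * t1 - y1 * t0)) := by
  linear_combination -(x1 * (y2 * ht - t2 * hy) - x2 * (y1 * ht - t1 * hy)) -
    (y1 * t2 - y2 * t1) * hx

/-- In dimension two the derivative of a symmetric traceless tensor is determined, up to its
totally symmetric part, by its divergence. -/
lemma stt_codazzi {T C : Fin 3 → Fin 3 → A} (hT : S.STT T) (hC : S.STT C) {Y : Fin 3 → A}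
    (hY : ∑ a, S.X a * Y a = 0) :
    ∑ a, ∑ b, ∑ d, T a b * Y d * S.D d (C a b) =
      ∑ a, ∑ b, ∑ d, T a b * Y d * S.D a (C d b) + ∑ a, ∑ b, T a b * Y b * S.dv C a := by
  -- Each cross product of Y with a row of T is normal, so its pairing with the curls of C involves
  -- only their contraction with X. That contraction vanishes by the differentiated tangency `k0`
  -- and the symmetry of C. Expanding the pairing gives the claim up to the traces of T and of D C.
  have hX := S.X_sq'
  have k0 : ∀ q r, ∑ e, S.X e * S.D q (C r e) = -C r q + S.X q * ∑ e, S.X e * C r e := by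
    intro q r
    have h1 : ∑ e, S.X e * C r e = 0 := by rw [← hC.tang r]; simp only [hC.symm r]
    have h2 := congrArg (S.D q) h1
    rw [map_sum, map_zero] at h2
    simp only [D_mul, D_X, Finset.sum_add_distrib] at h2
    rw [S.sum_sg' q (fun e => C r e)] at h2
    linear_combination h2
  have kz : ∀ r, ∑ e, S.X e * C r e = 0 := fun r => by
    rw [← hC.tang r]; simp only [hC.symm r]
  simp only [kz, mul_zero, add_zero] at k0
  have g0 := k0 1 2
  have g0' := k0 2 1
  have g1 := k0 2 0
  have g1' := k0 0 2
  have g2 := k0 0 1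
  have g2' := k0 1 0
  have tr := hT.trace
  have tC : ∀ q, S.D q (C 0 0) + S.D q (C 1 1) + S.D q (C 2 2) = 0 := by
    intro q
    have := congrArg (S.D q) hC.trace
    simpa [Fin.sum_univ_three] using this
  have tC0 := tC 0
  have tC1 := tC 1
  have tC2 := tC 2
  have w0 := hT.tang 0
  have w1 := hT.tang 1
  have w2 := hT.tang 2
  simp only [Fin.sum_univ_three, dv, hT.symm 1 0, hT.symm 2 0, hT.symm 2 1, hC.symm 1 0,
    hC.symm 2 0, hC.symm 2 1] at *
  generalize S.D 0 (C 0 0) = E000 at *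
  generalize S.D 1 (C 0 0) = E100 at *
  generalize S.D 2 (C 0 0) = E200 at *
  generalize S.D 0 (C 0 1) = E001 at *
  generalize S.D 1 (C 0 1) = E101 at *
  generalize S.D 2 (C 0 1) = E201 at *
  generalize S.D 0 (C 0 2) = E002 at *
  generalize S.D 1 (C 0 2) = E102 at *
  generalize S.D 2 (C 0 2) = E202 at *
  generalize S.D 0 (C 1 1) = E011 at *
  generalize S.D 1 (C 1 1) = E111 at *
  generalize S.D 2 (C 1 1) = E211 at *
  generalize S.D 0 (C 1 2) = E012 at *
  generalize S.D 1 (C 1 2) = E112 at *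
  generalize S.D 2 (C 1 2) = E212 at *
  generalize S.D 0 (C 2 2) = E022 at *
  generalize S.D 1 (C 2 2) = E122 at *
  generalize S.D 2 (C 2 2) = E222 at *
  generalize S.X 0 = x0 at *
  generalize S.X 1 = x1 at *
  generalize S.X 2 = x2 at *
  generalize Y 0 = y0 at *
  generalize Y 1 = y1 at *
  generalize Y 2 = y2 at *
  generalize T 0 0 = T00 at *
  generalize T 0 1 = T01 at *
  generalize T 0 2 = T02 at *
  generalize T 1 1 = T11 at *
  generalize T 1 2 = T12 at *
  generalize T 2 2 = T22 at *
  have hX1 : x1 * x1 + x2 * x2 + x0 * x0 = 1 := by linear_combination hX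
  have hX2 : x2 * x2 + x0 * x0 + x1 * x1 = 1 := by linear_combination hX
  have hY1 : x1 * y1 + x2 * y2 + x0 * y0 = 0 := by linear_combination hY
  have hY2 : x2 * y2 + x0 * y0 + x1 * y1 = 0 := by linear_combination hY
  have p00 := cross_tangent hX hY w0
  have p01 := cross_tangent hX1 hY1 (show x1 * T01 + x2 * T02 + x0 * T00 = 0 by linear_combination w0)
  have p02 := cross_tangent hX2 hY2 (show x2 * T02 + x0 * T00 + x1 * T01 = 0 by linear_combination w0)
  have p10 := cross_tangent hX hY w1
  have p11 := cross_tangent hX1 hY1 (show x1 * T11 + x2 * T12 + x0 * T01 = 0 by linear_combination w1)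
  have p12 := cross_tangent hX2 hY2 (show x2 * T12 + x0 * T01 + x1 * T11 = 0 by linear_combination w1)
  have p20 := cross_tangent hX hY w2
  have p21 := cross_tangent hX1 hY1 (show x1 * T12 + x2 * T22 + x0 * T02 = 0 by linear_combination w2)
  have p22 := cross_tangent hX2 hY2 (show x2 * T22 + x0 * T02 + x1 * T12 = 0 by linear_combination w2)
  linear_combination (E102 - E201) * p00 + (E112 - E211) * p01 + (E122 - E212) * p02
    + (E200 - E002) * p10 + (E201 - E012) * p11 + (E202 - E022) * p12
    + (E001 - E100) * p20 + (E011 - E101) * p21 + (E012 - E102) * p22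
    + (x0 * (y1 * T02 - y2 * T01) + x1 * (y2 * T00 - y0 * T02) + x2 * (y0 * T01 - y1 * T00)) *
      (g0 - g0')
    + (x0 * (y1 * T12 - y2 * T11) + x1 * (y2 * T01 - y0 * T12) + x2 * (y0 * T11 - y1 * T01)) *
      (g1 - g1')
    + (x0 * (y1 * T22 - y2 * T12) + x1 * (y2 * T02 - y0 * T22) + x2 * (y0 * T12 - y1 * T02)) *
      (g2 - g2')
    - tC0 * (y0 * T00 + y1 * T01 + y2 * T02 - y0 * (T00 + T11 + T22))
    - tC1 * (y0 * T01 + y1 * T11 + y2 * T12 - y1 * (T00 + T11 + T22))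
    - tC2 * (y0 * T02 + y1 * T12 + y2 * T22 - y2 * (T00 + T11 + T22))
    - tr * (y0 * (E000 + E101 + E202) + y1 * (E001 + E111 + E212) + y2 * (E002 + E112 + E222))

/-! #### The angular momentum flux -/

variable {κ : Fin 3 → Fin 3 → ℝ}

lemma D_rv (b a : Fin 3) :
    S.D b (S.rv κ a) = algebraMap ℝ A (κ a b) - S.X b * S.rv κ a := by
  simp only [rv, map_sum, D_mul, D_const, D_X, zero_mul, zero_add]
  have := S.sum_sg' b (fun c => algebraMap ℝ A (κ a c))
  simp only [Fin.sum_univ_three] at this ⊢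
  linear_combination this

/-- `stt_codazzi` trades Y^d D_d C_{ab} for D_a C_{db} plus a divergence. Integration by parts then
moves D_a onto T and onto Y, whose derivative is κ up to normal terms; of the two κTC terms of the
Lie derivative one is used up. -/
lemma I_lie (hκ : Skew κ) {T C : Fin 3 → Fin 3 → A} (hT : S.STT T) (hC : S.STT C) :
    S.I (∑ a, ∑ b, T a b * S.lie κ C a b) =
      S.I (∑ a, ∑ b, T a b * S.rv κ b * S.dv C a) - S.I (∑ a, ∑ b, C a b * S.rv κ b * S.dv T a)
        + S.I (∑ a, ∑ b, ∑ d, algebraMap ℝ A (κ d a) * T a b * C d b) := by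
  have h1 : ∑ a, ∑ b, T a b * S.lie κ C a b = ∑ a, ∑ b, ∑ d, T a b * S.rv κ d * S.D d (C a b) +
      2 * ∑ a, ∑ b, ∑ d, algebraMap ℝ A (κ d a) * T a b * C d b := by
    simp only [lie, rot_apply, Fin.sum_univ_three, hT.symm 1 0, hT.symm 2 0, hT.symm 2 1,
      hC.symm 1 0, hC.symm 2 0, hC.symm 2 1]
    ring
  have h2 : ∑ a, ∑ b, ∑ d, T a b * S.rv κ d * S.D a (C d b) =
      ∑ a, S.D a (∑ b, ∑ d, T a b * S.rv κ d * C d b) - ∑ a, ∑ b, C a b * S.rv κ b * S.dv T a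
        - ∑ a, ∑ b, ∑ d, algebraMap ℝ A (κ d a) * T a b * C d b := by
    have t0 := hT.tang 0
    have t1 := hT.tang 1
    have t2 := hT.tang 2
    simp only [dv, Fin.sum_univ_three, map_add, D_mul, D_rv, hT.symm 1 0, hT.symm 2 0, hT.symm 2 1,
      hC.symm 1 0, hC.symm 2 0, hC.symm 2 1] at t0 t1 t2 ⊢
    linear_combination (S.rv κ 0 * C 0 0 + S.rv κ 1 * C 0 1 + S.rv κ 2 * C 0 2) * t0 +
      (S.rv κ 0 * C 0 1 + S.rv κ 1 * C 1 1 + S.rv κ 2 * C 1 2) * t1 +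
      (S.rv κ 0 * C 0 2 + S.rv κ 1 * C 1 2 + S.rv κ 2 * C 2 2) * t2
  have h3 := S.I_div (fun a => ∑ b, ∑ d, T a b * S.rv κ d * C d b) (by
    have t0 := hT.tang 0
    have t1 := hT.tang 1
    have t2 := hT.tang 2
    simp only [Fin.sum_univ_three] at t0 t1 t2 ⊢
    linear_combination (S.rv κ 0 * C 0 0 + S.rv κ 1 * C 1 0 + S.rv κ 2 * C 2 0) * t0 +
      (S.rv κ 0 * C 0 1 + S.rv κ 1 * C 1 1 + S.rv κ 2 * C 2 1) * t1 +
      (S.rv κ 0 * C 0 2 + S.rv κ 1 * C 1 2 + S.rv κ 2 * C 2 2) * t2)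
  rw [h1, stt_codazzi hT hC (rv_tang hκ), h2, two_mul]
  simp only [map_add, map_sub, h3]
  ring

lemma STT.gdv_eq {T : Fin 3 → Fin 3 → A} (hT : S.STT T) (b : Fin 3) : S.gdv T b = S.dv T b := by
  rw [gdv, S.sum_sg' b (fun e => ∑ d, S.D d (T d e))]
  have := hT.dv_tang
  simp only [dv] at this ⊢
  rw [this]; ring

lemma gdv_rv (hκ : Skew κ) (T : Fin 3 → Fin 3 → A) :
    ∑ b, S.rv κ b * S.gdv T b = ∑ e, ∑ d, S.rv κ e * S.D d (T d e) := by
  have h : ∀ e, ∑ b, S.rv κ b * S.sg b e = S.rv κ e := by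
    intro e
    have := S.sum_sg e (S.rv κ)
    rw [rv_tang hκ] at this
    simp only [mul_comm (S.rv κ _)]
    rw [this]; ring
  have h0 := h 0
  have h1 := h 1
  have h2 := h 2
  simp only [gdv, Fin.sum_univ_three] at h0 h1 h2 ⊢
  linear_combination (S.D 0 (T 0 0) + S.D 1 (T 1 0) + S.D 2 (T 2 0)) * h0 +
    (S.D 0 (T 0 1) + S.D 1 (T 1 1) + S.D 2 (T 2 1)) * h1 +
    (S.D 0 (T 0 2) + S.D 1 (T 1 2) + S.D 2 (T 2 2)) * h2

/-- Integration by parts against a Killing field: D_d Y_e is κ_{ed} up to normal terms. For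
symmetric T the right side is zero. -/
lemma I_gdv_rv (hκ : Skew κ) {T : Fin 3 → Fin 3 → A} (hT : ∀ e, ∑ d, S.X d * T d e = 0) :
    S.I (∑ b, S.rv κ b * S.gdv T b) = -S.I (∑ e, ∑ d, algebraMap ℝ A (κ e d) * T d e) := by
  have h1 := S.I_div (fun d => ∑ e, S.rv κ e * T d e) (by
    have t0 := hT 0
    have t1 := hT 1
    have t2 := hT 2
    simp only [Fin.sum_univ_three] at t0 t1 t2 ⊢
    linear_combination S.rv κ 0 * t0 + S.rv κ 1 * t1 + S.rv κ 2 * t2)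
  have h2 : ∑ d, S.D d (∑ e, S.rv κ e * T d e) = ∑ e, ∑ d, S.rv κ e * S.D d (T d e) +
      ∑ e, ∑ d, algebraMap ℝ A (κ e d) * T d e := by
    have t0 := hT 0
    have t1 := hT 1
    have t2 := hT 2
    simp only [Fin.sum_univ_three, map_add, D_mul, D_rv] at t0 t1 t2 ⊢
    linear_combination -S.rv κ 0 * t0 - S.rv κ 1 * t1 - S.rv κ 2 * t2
  rw [h2, map_add] at h1
  rw [gdv_rv hκ]
  linarith

lemma sum_X_sg (b : Fin 3) : ∑ a, S.X a * S.sg a b = 0 := by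
  rw [← S.sum_sg_X b]; simp only [mul_comm]

/-- The part of the evolution of the angular momentum aspect that is linear in the shear does not
contribute to the angular momentum. -/
lemma I_rv_curl (hκ : Skew κ) {C : Fin 3 → Fin 3 → A} (hC : S.STT C) :
    S.I (∑ b, S.rv κ b * S.gdv (fun d b => S.gr (S.gdv C) d b - S.gr (S.gdv C) b d) b) = 0 := by
  have hV : ∀ b, S.gdv C b = S.dv C b := hC.gdv_eq
  have hfun : S.gdv C = S.dv C := funext hV
  have hg : ∀ a b, S.gr (S.dv C) a b = S.D a (S.dv C b) + S.X b * S.dv C a := by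
    intro a b
    have h1 := congrArg (S.D a) hC.dv_tang
    rw [map_sum, map_zero] at h1
    simp only [D_mul, D_X, Finset.sum_add_distrib] at h1
    rw [S.sum_sg' a (S.dv C), hC.dv_tang] at h1
    rw [gr, S.sum_sg' b (fun d => S.D a (S.dv C d))]
    linear_combination -S.X b * h1
  have ht := hC.dv_tang
  rw [I_gdv_rv hκ, neg_eq_zero]
  · have h1 : ∑ e, ∑ d, algebraMap ℝ A (κ e d) * (S.gr (S.gdv C) d e - S.gr (S.gdv C) e d) =
        2 * (∑ d, (S.D d (∑ e, algebraMap ℝ A (κ e d) * S.dv C e) -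
          2 * (S.X d * ∑ e, algebraMap ℝ A (κ e d) * S.dv C e))) +
        2 * ∑ b, S.rv κ b * S.gdv C b := by
      obtain ⟨h0, h1, h2, h3, h4, h5⟩ := hκ.entries
      simp only [hfun, hg, rv, Fin.sum_univ_three, map_add, D_mul, D_const, h0, h1, h2, h3, h4, h5,
        map_zero, map_neg]
      ring
    have h2 : S.I (∑ d, (S.D d (∑ e, algebraMap ℝ A (κ e d) * S.dv C e) -
          2 * (S.X d * ∑ e, algebraMap ℝ A (κ e d) * S.dv C e))) = 0 := by
      simp only [map_sum, map_sub, two_mul, map_add, I_D, Finset.mul_sum]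
      simp
    have h3 := I_gdv_rv hκ hC.tang
    have h4 : ∑ e, ∑ d, algebraMap ℝ A (κ e d) * C d e = 0 := by
      obtain ⟨h0, h1, h2, h3, h4, h5⟩ := hκ.entries
      simp only [Fin.sum_univ_three, h0, h1, h2, h3, h4, h5, hC.symm 1 0, hC.symm 2 0, hC.symm 2 1,
        map_zero, map_neg]
      ring
    rw [h1, two_mul, two_mul, map_add, map_add, map_add, h2, h3, h4]
    simp
  · intro e
    simp only [hfun, gr]
    have x0 := S.sum_X_sg 0
    have x1 := S.sum_X_sg 1
    have x2 := S.sum_X_sg 2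
    have d0 := S.X_D (S.dv C 0)
    have d1 := S.X_D (S.dv C 1)
    have d2 := S.X_D (S.dv C 2)
    simp only [Fin.sum_univ_three] at x0 x1 x2 d0 d1 d2 ⊢
    linear_combination S.sg e 0 * d0 + S.sg e 1 * d1 + S.sg e 2 * d2 - S.D e (S.dv C 0) * x0 -
      S.D e (S.dv C 1) * x1 - S.D e (S.dv C 2) * x2

/-- The rate of change of the local part of the angular momentum. -/
lemma I_angular_flux (hκ : Skew κ) {C N : Fin 3 → Fin 3 → A} (hC : S.STT C) (hN : S.STT N)
    (m h : A) {n : Fin 3 → A}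
    (hn : ∀ a, 4 * n a = 4 * S.D a m
      - S.gdv (fun d b => S.gr (S.gdv C) d b - S.gr (S.gdv C) b d) a
      + S.D a h - S.gdv (fun b e => ∑ d, C b d * N d e) a + 2 * ∑ b, C a b * S.gdv N b) :
    S.I (∑ a, S.rv κ a * (4 * n a - ∑ d, N a d * S.gdv C d - ∑ d, C a d * S.gdv N d)) =
      -S.I (∑ a, ∑ b, N a b * S.lie κ C a b) := by
  -- The gradients of m and h turn into rotated functions, which integrate to zero; the coefficient
  -- of C·div N drops from 2 to 1.
  have h1 : ∑ a, S.rv κ a * (4 * n a - ∑ d, N a d * S.gdv C d - ∑ d, C a d * S.gdv N d) =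
      (S.rot κ m + S.rot κ m + S.rot κ m + S.rot κ m)
      - ∑ b, S.rv κ b * S.gdv (fun d b => S.gr (S.gdv C) d b - S.gr (S.gdv C) b d) b
      + S.rot κ h - ∑ a, S.rv κ a * S.gdv (fun b e => ∑ d, C b d * N d e) a
      + ∑ a, ∑ b, C a b * S.rv κ b * S.dv N a - ∑ a, ∑ b, N a b * S.rv κ b * S.dv C a := by
    simp only [hn, hC.gdv_eq, hN.gdv_eq, rot_apply]
    simp only [Fin.sum_univ_three, hC.symm 1 0, hC.symm 2 0, hC.symm 2 1,
      hN.symm 1 0, hN.symm 2 0, hN.symm 2 1]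
    ring
  have h2 := I_gdv_rv hκ (T := fun b e => ∑ d, C b d * N d e) (fun e => by
    have t0 := hC.tang 0
    have t1 := hC.tang 1
    have t2 := hC.tang 2
    simp only [Fin.sum_univ_three] at t0 t1 t2 ⊢
    linear_combination N 0 e * t0 + N 1 e * t1 + N 2 e * t2)
  -- The product term of the evolution equation is exactly the κ term of `I_lie`, by skewness of κ.
  have h3 : ∑ e, ∑ d, algebraMap ℝ A (κ e d) * ∑ f, C d f * N f e =
      -∑ a, ∑ b, ∑ d, algebraMap ℝ A (κ d a) * N a b * C d b := by
    obtain ⟨h0, h1, h2, h3, h4, h5⟩ := hκ.entries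
    simp only [Fin.sum_univ_three, h0, h1, h2, h3, h4, h5, hC.symm 1 0, hC.symm 2 0, hC.symm 2 1,
      hN.symm 1 0, hN.symm 2 0, hN.symm 2 1, map_zero, map_neg]
    ring
  rw [h1, I_lie hκ hN hC]
  rw [h3] at h2
  simp only [map_add, map_sub, I_rot hκ, I_rv_curl hκ hC, h2, map_neg]
  ring

end SphereCalculus

/-! ### The calculus on the algebra of smooth functions on the sphere -/

lemma grad0_add {F G : S2 → ℝ} (hF : SmoothS2 F) (hG : SmoothS2 G) (x : S2) (a : Fin 3) :
    grad0 (fun y => F y + G y) x a = grad0 F x a + grad0 G x a := by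
  have h : radialExt (fun y => F y + G y) = fun y => radialExt F y + radialExt G y := by
    ext y
    by_cases hy : y = 0
    · simp [radialExt, hy]
    · simp [radialExt_of_ne _ hy]
  rw [grad0, h, fderiv_fun_add (hF.differentiableAt (coe_ne_zero x))
    (hG.differentiableAt (coe_ne_zero x))]
  rfl

lemma grad0_mul {F G : S2 → ℝ} (hF : SmoothS2 F) (hG : SmoothS2 G) (x : S2) (a : Fin 3) :
    grad0 (fun y => F y * G y) x a = F x * grad0 G x a + G x * grad0 F x a := by
  have h : radialExt (fun y => F y * G y) = fun y => radialExt F y * radialExt G y := by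
    ext y
    by_cases hy : y = 0
    · simp [radialExt, hy]
    · simp [radialExt_of_ne _ hy]
  rw [grad0, h, fderiv_fun_mul (hF.differentiableAt (coe_ne_zero x))
    (hG.differentiableAt (coe_ne_zero x))]
  simp [grad0]

lemma grad0_const (r : ℝ) (x : S2) (a : Fin 3) : grad0 (fun _ => r) x a = 0 := by
  have h : radialExt (fun _ => r) =ᶠ[𝓝 (x : E3)] fun _ => r := by
    filter_upwards [isOpen_ne.mem_nhds (coe_ne_zero x)] with y hy
    rw [radialExt_of_ne _ hy]
  rw [grad0, h.fderiv_eq]; simp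

/-- The algebra of smooth functions on the sphere. -/
abbrev SF : Type := ContMDiffMap (𝓡 2) 𝓘(ℝ, ℝ) S2 ℝ ∞

namespace SF

/-- Bundling a smooth function. -/
def mk {F : S2 → ℝ} (hF : SmoothS2 F) : SF := ⟨F, hF⟩

lemma smooth (F : SF) : SmoothS2 F := F.contMDiff

@[simp] lemma mk_apply {F : S2 → ℝ} (hF : SmoothS2 F) (x : S2) : mk hF x = F x := rfl
@[simp] lemma add_apply (F G : SF) (x : S2) : (F + G) x = F x + G x := rfl
@[simp] lemma sub_apply (F G : SF) (x : S2) : (F - G) x = F x - G x := rfl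
@[simp] lemma neg_apply (F : SF) (x : S2) : (-F) x = -F x := rfl
@[simp] lemma mul_apply (F G : SF) (x : S2) : (F * G) x = F x * G x := rfl
@[simp] lemma smul_apply (r : ℝ) (F : SF) (x : S2) : (r • F) x = r * F x := rfl
@[simp] lemma one_apply (x : S2) : (1 : SF) x = 1 := rfl
@[simp] lemma zero_apply (x : S2) : (0 : SF) x = 0 := rfl
@[simp] lemma const_apply (r : ℝ) (x : S2) : (algebraMap ℝ SF r) x = r := rfl
@[simp] lemma ofNat_apply (n : ℕ) [n.AtLeastTwo] (x : S2) :
    (ofNat(n) : SF) x = ofNat(n) := by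
  have h : (ofNat(n) : SF) = algebraMap ℝ SF ofNat(n) := (map_ofNat _ n).symm
  rw [h]; rfl

@[simp] lemma sum_apply {ι : Type*} (s : Finset ι) (F : ι → SF) (x : S2) :
    (∑ i ∈ s, F i) x = ∑ i ∈ s, F i x := by
  classical
  induction s using Finset.induction_on with
  | empty => simp
  | insert i s hi ih => rw [Finset.sum_insert hi, Finset.sum_insert hi, add_apply, ih]

lemma ext' {F G : SF} (h : ∀ x, F x = G x) : F = G := ContMDiffMap.ext h

lemma integrable (F : SF) : Integrable F areaS2 := SmoothS2.integrable F.smooth.continuous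

/-- A component of the tangential gradient. -/
def grad (a : Fin 3) : Derivation ℝ SF SF :=
  Derivation.mk'
    { toFun := fun F => mk (F.smooth.grad0 a)
      map_add' := fun F G => ext' fun x => grad0_add F.smooth G.smooth x a
      map_smul' := fun r F => ext' fun x => by
        have hr : SmoothS2 (fun _ => r) := contMDiff_const
        have := grad0_mul hr F.smooth x a
        rw [grad0_const, mul_zero, add_zero] at this
        exact this }
    (fun F G => ext' fun x => grad0_mul F.smooth G.smooth x a)

@[simp] lemma grad_apply (a : Fin 3) (F : SF) (x : S2) : grad a F x = grad0 F x a := rfl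

/-- The integral over the sphere. -/
def int : SF →ₗ[ℝ] ℝ where
  toFun F := integralS2 F
  map_add' F G := integral_add F.integrable G.integrable
  map_smul' r _ := integral_const_mul r _

lemma int_nonneg {F : SF} (h : ∀ x, 0 ≤ F x) : 0 ≤ int F := integral_nonneg h

end SF

/-- The coordinate functions as elements of the algebra. -/
def coordSF (a : Fin 3) : SF := SF.mk (smoothS2_coordX a)

@[simp] lemma coordSF_apply (a : Fin 3) (x : S2) : coordSF a x = coordX a x := rfl

/-- The calculus of smooth functions on the round sphere. -/
def sphereCalc : SphereCalculus SF where
  X := coordSF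
  D := SF.grad
  I := SF.int
  X_sq := SF.ext' fun x => by simpa using sum_coordX_sq x
  D_X' a b := SF.ext' fun x => by
    have := grad0_coordX x a b
    split_ifs at this ⊢ with h <;> exact this
  X_D F := SF.ext' fun x => by simpa [coordX] using sum_coe_mul_grad0 F.smooth x
  comm a b F := SF.ext' fun x => grad0_grad0_comm F.smooth x a b
  I_D a F := integralS2_grad0 F.smooth a

@[simp] lemma sphereCalc_X (a : Fin 3) (x : S2) : sphereCalc.X a x = coordX a x := rfl
@[simp] lemma sphereCalc_D (a : Fin 3) (F : SF) (x : S2) : sphereCalc.D a F x = grad0 F x a := rfl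
lemma sphereCalc_I (F : SF) : sphereCalc.I F = integralS2 F := rfl

@[simp] lemma sphereCalc_sg (a b : Fin 3) (x : S2) : sphereCalc.sg a b x = sigma x a b := by
  rw [SphereCalculus.sg, sigma]
  split_ifs <;> rfl

@[simp] lemma sphereCalc_ep (a b : Fin 3) (x : S2) : sphereCalc.ep a b x = epsS2 x a b := by
  simp [SphereCalculus.ep, epsS2, coordX]

lemma grad1_eq (w : Fin 3 → SF) (x : S2) (a b : Fin 3) :
    grad1 (fun y d => w d y) x a b = sphereCalc.gr w a b x := by
  simp [grad1, SphereCalculus.gr]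

lemma hess_eq (F : SF) (x : S2) (a b : Fin 3) : hess F x a b = sphereCalc.hs F a b x := by
  have h := grad1_eq (fun d => sphereCalc.D d F) x a b
  have h2 : sphereCalc.gr (fun d => sphereCalc.D d F) a b = sphereCalc.hs F a b := by
    rw [SphereCalculus.gr, sphereCalc.sum_sg' b (fun d => sphereCalc.D a (sphereCalc.D d F)),
      sphereCalc.X_DD, SphereCalculus.hs]
    ring
  rw [← h2, ← h]; rfl

lemma lap_eq (F : SF) (x : S2) : lap F x = sphereCalc.lp F x := by
  have h : ∑ a, sphereCalc.hs F a a = sphereCalc.lp F := by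
    have := sphereCalc.X_D F
    simp only [SphereCalculus.hs, SphereCalculus.lp, Finset.sum_add_distrib, this, add_zero]
  simp only [lap, hess_eq, ← h, SF.sum_apply]

lemma div2_eq (T : Fin 3 → Fin 3 → SF) (x : S2) (b : Fin 3) :
    div2 (fun y d e => T d e y) x b = sphereCalc.gdv T b x := by
  have h : ∀ e, ∑ a, ∑ d, sphereCalc.sg a d * sphereCalc.D a (T d e) =
      ∑ d, sphereCalc.D d (T d e) := by
    intro e
    rw [Finset.sum_comm]
    refine Finset.sum_congr rfl fun d _ => ?_
    exact sphereCalc.sum_sg_D d (T d e)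
  have h2 : sphereCalc.gdv T b =
      ∑ a, ∑ d, ∑ e, sphereCalc.sg a d * sphereCalc.sg b e * sphereCalc.D a (T d e) := by
    simp only [SphereCalculus.gdv, ← h, Fin.sum_univ_three]; ring
  rw [h2]
  simp [div2, grad2]

lemma div1_eq (w : Fin 3 → SF) (x : S2) :
    div1 (fun y d => w d y) x = (∑ a, sphereCalc.D a (w a)) x := by
  have h : ∑ a, sphereCalc.gr w a a = ∑ a, sphereCalc.D a (w a) := by
    simp only [SphereCalculus.gr]
    rw [Finset.sum_comm]
    refine Finset.sum_congr rfl fun d _ => ?_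
    exact sphereCalc.sum_sg_D d (w d)
  simp only [div1, grad1_eq, ← h, SF.sum_apply]

/-! ### Modes and the spectral gap -/

namespace SphereCalculus

variable {A : Type*} [CommRing A] [Algebra ℝ A] (S : SphereCalculus A)

/-- The Laplacian as a linear map. -/
def lpL : A →ₗ[ℝ] A where
  toFun := S.lp
  map_add' := S.lp_add
  map_smul' := S.lp_smul

/-- The functions of mode `ℓ`. -/
def Mode (ℓ : ℕ) : Submodule ℝ A :=
  LinearMap.ker (S.lpL + ((ℓ : ℝ) * (ℓ + 1)) • LinearMap.id)

lemma mem_Mode {ℓ : ℕ} {F : A} : F ∈ S.Mode ℓ ↔ S.lp F = -(((ℓ : ℝ) * (ℓ + 1)) • F) := by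
  rw [Mode, LinearMap.mem_ker, LinearMap.add_apply, add_eq_zero_iff_eq_neg]
  rfl

lemma Mode_congr {ℓ : ℕ} {F : A} {r : ℝ} (hr : r = ℓ * (ℓ + 1)) (h : S.lp F = -(r • F)) :
    F ∈ S.Mode ℓ := by
  rw [mem_Mode, h, hr]

variable {S}

/-- The roots s = ℓ and s = −(ℓ+1) correspond to differentiating the harmonic extensions r^ℓ F and
r^{−ℓ−1} F in the direction j; the derivative is again harmonic, of mode ℓ − 1 or ℓ + 1. -/
lemma lp_D_add_X {ℓ : ℕ} {F : A} (hF : F ∈ S.Mode ℓ) (j : Fin 3) {s : ℝ}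
    (hs : s * s + s = ℓ * (ℓ + 1)) :
    S.lp (S.D j F + s • (S.X j * F)) =
      -(((ℓ : ℝ) * (ℓ + 1) - 2 * s) • (S.D j F + s • (S.X j * F))) := by
  rw [mem_Mode] at hF
  have h1 : S.lp (S.D j F) = S.D j (S.lp F) - 2 * S.X j * S.lp F := S.lp_D j F
  have h2 := S.lp_mul (S.X j) F
  have h3 := S.sum_sg_D' j F
  simp only [S.sg_symm j] at h3
  simp only [S.D_X, h3, S.lp_X, hF] at h2
  rw [S.lp_add, S.lp_smul, h1, h2, hF]
  rw [← hs]
  simp only [map_neg, Derivation.map_smul]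
  simp only [Algebra.smul_def, map_sub, map_mul, map_add, map_ofNat]
  ring

lemma X_mul_mem {ℓ : ℕ} {F : A} (hF : F ∈ S.Mode ℓ) (j : Fin 3) :
    S.X j * F ∈ ⨆ n, S.Mode n := by
  have h1 : S.D j F + (ℓ : ℝ) • (S.X j * F) ∈ S.Mode (ℓ - 1) := by
    refine S.Mode_congr ?_ (lp_D_add_X hF j (s := ℓ) (by ring))
    -- For ℓ = 0 the truncated index ℓ − 1 is 0, and the eigenvalue is indeed 0.
    rcases ℓ with _ | n
    · simp
    · push_cast [Nat.add_sub_cancel]; ring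
  have h2 : S.D j F + (-(ℓ + 1 : ℝ)) • (S.X j * F) ∈ S.Mode (ℓ + 1) := by
    refine S.Mode_congr ?_ (lp_D_add_X hF j (s := -(ℓ + 1 : ℝ)) (by ring))
    push_cast; ring
  have h3 : S.X j * F = (1 / (2 * ℓ + 1) : ℝ) •
      ((S.D j F + (ℓ : ℝ) • (S.X j * F)) - (S.D j F + (-(ℓ + 1 : ℝ)) • (S.X j * F))) := by
    have h : (2 * ℓ + 1 : ℝ) ≠ 0 := by positivity
    rw [add_sub_add_left_eq_sub, ← sub_smul, smul_smul]
    have : (1 / (2 * ℓ + 1) : ℝ) * (ℓ - -(ℓ + 1)) = 1 := by field_simp; ring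
    rw [this, one_smul]
  rw [h3]
  exact Submodule.smul_mem _ _ (Submodule.sub_mem _ (Submodule.mem_iSup_of_mem _ h1)
    (Submodule.mem_iSup_of_mem _ h2))

lemma X_mul_mem_iSup {F : A} (hF : F ∈ ⨆ n, S.Mode n) (j : Fin 3) :
    S.X j * F ∈ ⨆ n, S.Mode n := by
  have h : (⨆ n, S.Mode n) ≤ (⨆ n, S.Mode n).comap (LinearMap.mulLeft ℝ (S.X j)) :=
    iSup_le fun ℓ F hF => X_mul_mem hF j
  exact h hF

lemma one_mem_Mode : (1 : A) ∈ S.Mode 0 := by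
  rw [mem_Mode]
  simp [lp]

lemma I_lp_mul (F G : A) : S.I (S.lp F * G) = S.I (F * S.lp G) := by
  have h1 := S.I_div (fun a => S.D a F * G - F * S.D a G) (by
    have h1 := S.X_D F
    have h2 := S.X_D G
    simp only [Fin.sum_univ_three] at h1 h2 ⊢
    linear_combination G * h1 - F * h2)
  have h2 : ∑ a, S.D a (S.D a F * G - F * S.D a G) = S.lp F * G - F * S.lp G := by
    simp only [lp, map_sub, D_mul, Fin.sum_univ_three]; ring
  rw [h2, map_sub, sub_eq_zero] at h1
  exact h1

lemma I_lp2_mul (F G : A) : S.I (S.lp2 F * G) = S.I (F * S.lp2 G) := by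
  have h1 : S.lp2 F * G = S.lp (S.lp F) * G + (S.lp F * G + S.lp F * G) := by rw [lp2]; ring
  have h2 : F * S.lp2 G = F * S.lp (S.lp G) + (F * S.lp G + F * S.lp G) := by rw [lp2]; ring
  rw [h1, h2]
  simp only [map_add, I_lp_mul]

lemma Mode_orthogonal {k ℓ : ℕ} (hkl : k ≠ ℓ) {F G : A} (hF : F ∈ S.Mode k) (hG : G ∈ S.Mode ℓ) :
    S.I (F * G) = 0 := by
  rw [mem_Mode] at hF hG
  have h := I_lp_mul (S := S) F G
  rw [hF, hG, neg_mul, mul_neg, smul_mul_assoc, mul_smul_comm, map_neg, map_neg, map_smul, map_smul,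
    smul_eq_mul, smul_eq_mul] at h
  have h2 : ((k : ℝ) * (k + 1) - ℓ * (ℓ + 1)) * S.I (F * G) = 0 := by linarith
  rcases mul_eq_zero.1 h2 with h3 | h3
  · exfalso
    have h4 : ((k : ℝ) - ℓ) * (k + ℓ + 1) = 0 := by linarith
    rcases mul_eq_zero.1 h4 with h5 | h5
    · exact hkl (by exact_mod_cast sub_eq_zero.1 h5)
    · have : (0 : ℝ) < k + ℓ + 1 := by positivity
      linarith
  · exact h3

lemma lp2_Mode {ℓ : ℕ} {F : A} (hF : F ∈ S.Mode ℓ) :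
    S.lp2 F = (((ℓ : ℝ) * (ℓ + 1)) * (ℓ * (ℓ + 1) - 2)) • F := by
  rw [mem_Mode] at hF
  have h : S.lp (-(((ℓ : ℝ) * (ℓ + 1)) • F)) = -(((ℓ : ℝ) * (ℓ + 1)) • S.lp F) := by
    rw [← neg_smul, S.lp_smul, neg_smul]
  rw [lp2, hF, h, hF]
  simp only [Algebra.smul_def, map_sub, map_mul, map_ofNat]
  ring

/-- Cauchy–Schwarz for finite families. -/
lemma I_cauchySchwarz {ι : Type*} [Fintype ι] (hpos : ∀ F, 0 ≤ S.I (F * F)) (F G : ι → A) :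
    S.I (∑ i, F i * G i) ^ 2 ≤ S.I (∑ i, F i * F i) * S.I (∑ i, G i * G i) := by
  have h : ∀ t : ℝ, 0 ≤ S.I (∑ i, G i * G i) * (t * t) + (2 * S.I (∑ i, F i * G i)) * t +
      S.I (∑ i, F i * F i) := by
    intro t
    have h1 : S.I (∑ i, (F i + t • G i) * (F i + t • G i)) = S.I (∑ i, G i * G i) * (t * t) +
        (2 * S.I (∑ i, F i * G i)) * t + S.I (∑ i, F i * F i) := by
      have h2 : ∀ i, S.I ((F i + t • G i) * (F i + t • G i)) =
          S.I (G i * G i) * (t * t) + (2 * S.I (F i * G i)) * t + S.I (F i * F i) := by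
        intro i
        have h3 : (F i + t • G i) * (F i + t • G i) =
            (t * t) • (G i * G i) + (2 * t) • (F i * G i) + F i * F i := by
          simp only [Algebra.smul_def, map_mul, map_ofNat]; ring
        rw [h3]
        simp only [map_add, map_smul, smul_eq_mul]; ring
      simp only [map_sum, h2, Finset.sum_add_distrib, Finset.sum_mul, Finset.mul_sum]
    rw [← h1, map_sum]
    exact Finset.sum_nonneg fun i _ => hpos _
  have := discrim_le_zero h
  rw [discrim] at this
  nlinarith

/-- The spectral gap, in dual form: if `Δ(Δ+2)c = 2 div div T` and `c` is orthogonal to the modes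
`0` and `1`, then `c` is bounded by `T` when tested on a finite sum of modes. -/
lemma I_mul_mode_sum_le (hpos : ∀ F, 0 ≤ S.I (F * F)) {c : A} {T : Fin 3 → Fin 3 → A}
    (hT : S.STT T) (hcT : S.lp2 c = 2 * S.ddv T)
    (hc : ∀ ℓ < 2, ∀ F ∈ S.Mode ℓ, S.I (c * F) = 0) {p : A} (hp : p ∈ ⨆ n, S.Mode n) :
    S.I (c * p) ^ 2 ≤ S.I (∑ a, ∑ b, T a b * T a b) * S.I (p * p) := by
  obtain ⟨q, hq, rfl⟩ := (Submodule.mem_iSup_iff_exists_finsupp S.Mode p).1 hp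
  -- μ is the spectrum of Δ(Δ+2), zero exactly for ℓ < 2. With the weights w, ψ solves Δ(Δ+2)ψ =
  -- (part of p in modes ℓ ≥ 2).
  set μ : ℕ → ℝ := fun ℓ => ((ℓ : ℝ) * (ℓ + 1)) * (ℓ * (ℓ + 1) - 2) with hμ
  set w : ℕ → ℝ := fun ℓ => if ℓ < 2 then 0 else (μ ℓ)⁻¹ with hw
  have hw0 : ∀ ℓ, ℓ < 2 → w ℓ = 0 := fun ℓ hℓ => if_pos hℓ
  -- The least value is 24; the bound 2 is what absorbs the factor 2 in `e3`.
  have hμ2 : ∀ ℓ, 2 ≤ ℓ → 2 ≤ μ ℓ := by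
    intro ℓ hℓ
    have : (2 : ℝ) ≤ ℓ := by exact_mod_cast hℓ
    simp only [hμ]
    nlinarith [mul_nonneg (by linarith : (0 : ℝ) ≤ ℓ - 2) (by linarith : (0 : ℝ) ≤ ℓ)]
  set ψ : A := ∑ ℓ ∈ q.support, w ℓ • q ℓ with hψ
  have hsum : q.sum (fun _ x => x) = ∑ ℓ ∈ q.support, q ℓ := rfl
  have lp2_sum : ∀ (s : Finset ℕ) (F : ℕ → A), S.lp2 (∑ ℓ ∈ s, F ℓ) = ∑ ℓ ∈ s, S.lp2 (F ℓ) := by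
    intro s F
    have : ∀ G, S.lp2 G = (S.lpL.comp S.lpL + (2 : ℝ) • S.lpL) G := by
      intro G; simp [lp2, lpL, Algebra.smul_def, map_ofNat]
    simp only [this, map_sum]
  have lp2_smul : ∀ (r : ℝ) (F : A), S.lp2 (r • F) = r • S.lp2 F := by
    intro r F
    simp only [lp2, lp_smul]; simp only [Algebra.smul_def]; ring
  have hlp2 : S.lp2 ψ = ∑ ℓ ∈ q.support, (w ℓ * μ ℓ) • q ℓ := by
    rw [hψ, lp2_sum]
    refine Finset.sum_congr rfl fun ℓ _ => ?_
    rw [lp2_smul, lp2_Mode (hq ℓ), smul_smul]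
  have hwμ : ∀ ℓ, ¬ ℓ < 2 → w ℓ * μ ℓ = 1 := by
    intro ℓ hℓ
    have := hμ2 ℓ (not_lt.1 hℓ)
    simp only [hw, if_neg hℓ]
    exact inv_mul_cancel₀ (by linarith)
  have e1 : S.I (c * ∑ ℓ ∈ q.support, q ℓ) = S.I (c * S.lp2 ψ) := by
    rw [hlp2, Finset.mul_sum, Finset.mul_sum, map_sum, map_sum]
    refine Finset.sum_congr rfl fun ℓ _ => ?_
    by_cases hℓ : ℓ < 2
    · rw [hc ℓ hℓ _ (hq ℓ), mul_smul_comm, map_smul, hc ℓ hℓ _ (hq ℓ), smul_zero]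
    · rw [hwμ ℓ hℓ, one_smul]
  -- Duality: Δ(Δ+2) moves onto c, becomes 2 div div T, and the two divergences return to ψ as a
  -- traceless Hessian.
  have e2 : S.I (c * S.lp2 ψ) = S.I (∑ a, ∑ b, T a b * S.hess2 ψ a b) := by
    rw [hT.I_hess2, ← I_lp2_mul, hcT, mul_assoc, two_mul, map_add, two_mul]
  have orth : ∀ (v : ℕ → ℝ), S.I ((∑ ℓ ∈ q.support, v ℓ • q ℓ) * ∑ ℓ ∈ q.support, q ℓ) =
      ∑ ℓ ∈ q.support, v ℓ * S.I (q ℓ * q ℓ) := by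
    intro v
    rw [Finset.sum_mul, map_sum]
    refine Finset.sum_congr rfl fun ℓ hℓ => ?_
    rw [Finset.mul_sum, map_sum, Finset.sum_eq_single ℓ]
    · rw [smul_mul_assoc, map_smul, smul_eq_mul]
    · intro k _ hk
      rw [smul_mul_assoc, map_smul, Mode_orthogonal hk.symm (hq ℓ) (hq k), smul_zero]
    · intro h; exact absurd hℓ h
  have e3 : S.I (∑ a, ∑ b, S.hess2 ψ a b * S.hess2 ψ a b) = 2 * S.I (ψ * S.lp2 ψ) := by
    rw [(S.hess2_stt ψ).I_hess2, S.ddv_hess2, mul_comm ψ]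
  have e4 : S.I (ψ * S.lp2 ψ) = ∑ ℓ ∈ q.support, w ℓ * S.I (q ℓ * q ℓ) := by
    rw [← orth]
    have : S.I (ψ * S.lp2 ψ) - S.I (ψ * ∑ ℓ ∈ q.support, q ℓ) = 0 := by
      rw [← map_sub, ← mul_sub, hlp2, ← Finset.sum_sub_distrib, hψ, Finset.sum_mul, map_sum]
      refine Finset.sum_eq_zero fun ℓ hℓ => ?_
      by_cases h2 : ℓ < 2
      · rw [hw0 ℓ h2, zero_smul, zero_mul, map_zero]
      · rw [Finset.mul_sum, map_sum]
        refine Finset.sum_eq_zero fun k _ => ?_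
        by_cases hk : k < 2
        · have : ℓ ≠ k := fun h => h2 (h ▸ hk)
          rw [show ((w k * μ k) • q k - q k) = (w k * μ k - 1) • q k by rw [sub_smul, one_smul],
            smul_mul_smul_comm, map_smul, Mode_orthogonal this (hq ℓ) (hq k), smul_zero]
        · rw [hwμ k hk, one_smul, sub_self, mul_zero, map_zero]
    linarith
  have e5 : S.I ((∑ ℓ ∈ q.support, q ℓ) * ∑ ℓ ∈ q.support, q ℓ) =
      ∑ ℓ ∈ q.support, S.I (q ℓ * q ℓ) := by
    simpa using orth (fun _ => 1)
  have e6 : 2 * S.I (ψ * S.lp2 ψ) ≤ ∑ ℓ ∈ q.support, S.I (q ℓ * q ℓ) := by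
    rw [e4, Finset.mul_sum]
    refine Finset.sum_le_sum fun ℓ _ => ?_
    have h0 := hpos (q ℓ)
    have : 2 * w ℓ ≤ 1 := by
      by_cases hℓ : ℓ < 2
      · rw [hw0 ℓ hℓ]; norm_num
      · have := hμ2 ℓ (not_lt.1 hℓ)
        simp only [hw, if_neg hℓ]
        rw [← div_eq_mul_inv, div_le_one (by linarith)]; exact this
    nlinarith
  rw [hsum, e1, e2, e5]
  have cs := S.I_cauchySchwarz hpos (fun i : Fin 3 × Fin 3 => T i.1 i.2) (fun i => S.hess2 ψ i.1 i.2)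
  simp only [Fintype.sum_prod_type] at cs
  refine cs.trans ?_
  rw [e3]
  have hT0 : 0 ≤ S.I (∑ a, ∑ b, T a b * T a b) := by
    simp only [map_sum]
    exact Finset.sum_nonneg fun a _ => Finset.sum_nonneg fun b _ => hpos _
  exact mul_le_mul_of_nonneg_left e6 hT0

end SphereCalculus

lemma SF.int_mul_self_nonneg (F : SF) : 0 ≤ sphereCalc.I (F * F) :=
  SF.int_nonneg fun x => mul_self_nonneg (F x)

/-- Smooth functions as continuous functions. -/
def SF.toC : SF →ₗ[ℝ] C(S2, ℝ) where
  toFun F := ⟨F, F.smooth.continuous⟩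
  map_add' _ _ := rfl
  map_smul' _ _ := rfl

@[simp] lemma SF.toC_apply (F : SF) (x : S2) : SF.toC F x = F x := rfl

/-- Finite sums of modes are uniformly dense. -/
lemma exists_mode_sum_near (c : SF) {δ : ℝ} (hδ : 0 < δ) :
    ∃ p ∈ ⨆ n, sphereCalc.Mode n, ∀ x, |p x - c x| ≤ δ := by
  set Pol : Subalgebra ℝ C(S2, ℝ) := Algebra.adjoin ℝ (Set.range fun a => SF.toC (coordSF a)) with hPol
  have hsep : Pol.SeparatesPoints := by
    intro x y hxy
    have : ∃ a, coordX a x ≠ coordX a y := by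
      by_contra hc
      push Not at hc
      exact hxy (Subtype.ext (PiLp.ext fun a => hc a))
    obtain ⟨a, ha⟩ := this
    exact ⟨_, ⟨SF.toC (coordSF a), Algebra.subset_adjoin ⟨a, rfl⟩, rfl⟩, ha⟩
  have hdense := ContinuousMap.subalgebra_topologicalClosure_eq_top_of_separatesPoints Pol hsep
  -- For the induction over products the claim is that multiplication by H preserves finite sums of
  -- modes; applied to the constant 1 it puts H itself among them.
  have hmem : ∀ h ∈ Pol, ∃ H : SF, SF.toC H = h ∧
      ∀ m ∈ ⨆ n, sphereCalc.Mode n, H * m ∈ ⨆ n, sphereCalc.Mode n := by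
    intro h hh
    induction hh using Algebra.adjoin_induction with
    | mem h hh =>
      obtain ⟨a, rfl⟩ := hh
      exact ⟨coordSF a, rfl, fun m hm => SphereCalculus.X_mul_mem_iSup hm a⟩
    | algebraMap r =>
      refine ⟨algebraMap ℝ SF r, rfl, fun m hm => ?_⟩
      rw [← Algebra.smul_def]
      exact Submodule.smul_mem _ _ hm
    | add h₁ h₂ _ _ ih₁ ih₂ =>
      obtain ⟨H₁, rfl, k₁⟩ := ih₁
      obtain ⟨H₂, rfl, k₂⟩ := ih₂
      refine ⟨H₁ + H₂, rfl, fun m hm => ?_⟩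
      rw [add_mul]
      exact Submodule.add_mem _ (k₁ m hm) (k₂ m hm)
    | mul h₁ h₂ _ _ ih₁ ih₂ =>
      obtain ⟨H₁, rfl, k₁⟩ := ih₁
      obtain ⟨H₂, rfl, k₂⟩ := ih₂
      refine ⟨H₁ * H₂, rfl, fun m hm => ?_⟩
      rw [mul_assoc]
      exact k₁ _ (k₂ m hm)
  have hc : SF.toC c ∈ closure (Pol : Set C(S2, ℝ)) := by
    have : SF.toC c ∈ Pol.topologicalClosure := by rw [hdense]; trivial
    exact this
  obtain ⟨h, hh, hd⟩ := Metric.mem_closure_iff.1 hc δ hδ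
  obtain ⟨H, rfl, k⟩ := hmem h hh
  refine ⟨H, ?_, fun x => ?_⟩
  · simpa using k 1 (Submodule.mem_iSup_of_mem 0 SphereCalculus.one_mem_Mode)
  · have := (ContinuousMap.dist_apply_le_dist (f := SF.toC c) (g := SF.toC H) x).trans hd.le
    rwa [dist_comm, Real.dist_eq] at this

/-- The spectral gap: `‖c‖ ≤ ‖T‖` in `L²` if `Δ(Δ+2)c = 2 div div T` and `c` is orthogonal to the
modes `0` and `1`. -/
lemma int_mul_self_le_of_lp2_eq {c : SF} {T : Fin 3 → Fin 3 → SF} (hT : sphereCalc.STT T)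
    (hcT : sphereCalc.lp2 c = 2 * sphereCalc.ddv T)
    (hc : ∀ ℓ < 2, ∀ F ∈ sphereCalc.Mode ℓ, sphereCalc.I (c * F) = 0) :
    sphereCalc.I (c * c) ≤ sphereCalc.I (∑ a, ∑ b, T a b * T a b) := by
  set B := sphereCalc.I (∑ a, ∑ b, T a b * T a b) with hB
  have hB0 : 0 ≤ B := by
    simp only [hB, map_sum]
    exact Finset.sum_nonneg fun a _ => Finset.sum_nonneg fun b _ => SF.int_mul_self_nonneg _
  choose p hp hpc using fun n : ℕ => exists_mode_sum_near c (δ := 1 / ((n : ℝ) + 1)) (by positivity)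
  have hδ : Tendsto (fun n : ℕ => 1 / ((n : ℝ) + 1)) atTop (𝓝 0) :=
    tendsto_one_div_add_atTop_nhds_zero_nat
  have hunif : ∀ G : SF, Tendsto (fun n => sphereCalc.I (G * (p n - c))) atTop (𝓝 0) := by
    intro G
    have hb : ∀ n, |sphereCalc.I (G * (p n - c))| ≤ (∫ x, |G x| ∂areaS2) * (1 / ((n : ℝ) + 1)) := by
      intro n
      rw [sphereCalc_I, integralS2, ← integral_mul_const]
      refine abs_integral_le_integral_abs.trans (integral_mono ?_ ?_ fun x => ?_)
      · exact (SF.integrable (G * (p n - c))).abs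
      · exact G.integrable.abs.mul_const _
      · simp only [SF.mul_apply, SF.sub_apply, abs_mul]
        exact mul_le_mul_of_nonneg_left (hpc n x) (abs_nonneg _)
    refine squeeze_zero_norm hb ?_
    simpa using hδ.const_mul (∫ x, |G x| ∂areaS2)
  have hself : Tendsto (fun n => sphereCalc.I ((p n - c) * (p n - c))) atTop (𝓝 0) := by
    have hb : ∀ n, |sphereCalc.I ((p n - c) * (p n - c))| ≤
        areaS2.real Set.univ * (1 / ((n : ℝ) + 1)) := by
      intro n
      rw [sphereCalc_I, integralS2, ← Real.norm_eq_abs]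
      have h1 : ∀ x, ‖((p n - c) * (p n - c)) x‖ ≤ 1 / ((n : ℝ) + 1) := by
        intro x
        simp only [SF.mul_apply, SF.sub_apply, Real.norm_eq_abs, abs_mul]
        have h2 := hpc n x
        have h3 : 1 / ((n : ℝ) + 1) ≤ 1 := by
          rw [div_le_one (by positivity)]; linarith [(Nat.cast_nonneg n : (0 : ℝ) ≤ n)]
        nlinarith [abs_nonneg (p n x - c x)]
      exact (norm_integral_le_of_norm_le_const (μ := areaS2)
        (Eventually.of_forall h1)).trans_eq (mul_comm _ _)
    refine squeeze_zero_norm hb ?_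
    simpa using hδ.const_mul (areaS2.real Set.univ)
  have l1 : Tendsto (fun n => sphereCalc.I (c * p n)) atTop (𝓝 (sphereCalc.I (c * c))) := by
    have := (hunif c).add_const (sphereCalc.I (c * c))
    rw [zero_add] at this
    refine this.congr fun n => ?_
    rw [← map_add]; congr 1; ring
  have l2 : Tendsto (fun n => sphereCalc.I (p n * p n)) atTop (𝓝 (sphereCalc.I (c * c))) := by
    have := (hself.add ((hunif c).const_mul 2)).add_const (sphereCalc.I (c * c))
    simp only [mul_zero, zero_add] at this
    refine this.congr fun n => ?_
    rw [two_mul, ← map_add, ← map_add, ← map_add]; congr 1; ring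
  -- In the limit (c,p)² ≤ B (p,p) becomes (c,c)² ≤ B (c,c), and (c,c) is divided out unless it is
  -- zero.
  have h := le_of_tendsto_of_tendsto' (l1.pow 2) (l2.const_mul B) fun n =>
    SphereCalculus.I_mul_mode_sum_le SF.int_mul_self_nonneg hT hcT hc (hp n)
  have h0 := SF.int_mul_self_nonneg c
  rcases h0.eq_or_lt with h1 | h1
  · rw [← h1]; exact hB0
  · nlinarith

/-! ### Families of smooth functions depending on retarded time -/

/-- `F` is a smooth family of functions on the sphere with `u`-derivative `F'`. -/
structure FamDeriv (F F' : ℝ → SF) : Prop where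
  smooth : SmoothScri (fun u x => F u x)
  smooth' : SmoothScri (fun u x => F' u x)
  deriv : ∀ u x, HasDerivAt (fun s => F s x) (F' u x) u

namespace FamDeriv

variable {F F' G G' : ℝ → SF}

lemma of_smoothScri {F : ℝ → S2 → ℝ} (hF : SmoothScri F) :
    FamDeriv (fun u => SF.mk (hF.slice u)) (fun u => SF.mk (hF.dU.slice u)) :=
  ⟨hF, hF.dU, hF.hasDerivAt_dU⟩

lemma dU_eq (h : FamDeriv F F') (u : ℝ) (x : S2) : dU (fun u x => F u x) u x = F' u x :=
  (h.deriv u x).deriv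

/-- Used to differentiate identities between families in u, such as the linear constraints on the
shear. -/
lemma unique (h : FamDeriv F F') (h' : FamDeriv F G') : F' = G' :=
  funext fun u => SF.ext' fun x => (h.deriv u x).unique (h'.deriv u x)

lemma const (F : SF) : FamDeriv (fun _ => F) (fun _ => 0) :=
  ⟨F.smooth.const_scri, smoothScri_const 0, fun u x => hasDerivAt_const u (F x)⟩

lemma add (hF : FamDeriv F F') (hG : FamDeriv G G') :
    FamDeriv (fun u => F u + G u) (fun u => F' u + G' u) :=
  ⟨hF.smooth.add hG.smooth, hF.smooth'.add hG.smooth', fun u x => (hF.deriv u x).add (hG.deriv u x)⟩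

lemma mul (hF : FamDeriv F F') (hG : FamDeriv G G') :
    FamDeriv (fun u => F u * G u) (fun u => F' u * G u + F u * G' u) :=
  ⟨hF.smooth.mul hG.smooth, (hF.smooth'.mul hG.smooth).add (hF.smooth.mul hG.smooth'),
    fun u x => (hF.deriv u x).mul (hG.deriv u x)⟩

lemma const_mul (H : SF) (hF : FamDeriv F F') :
    FamDeriv (fun u => H * F u) (fun u => H * F' u) := by
  simpa using (const H).mul hF

lemma smul (r : ℝ) (hF : FamDeriv F F') : FamDeriv (fun u => r • F u) (fun u => r • F' u) := by
  simp only [Algebra.smul_def]; exact hF.const_mul _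

lemma neg (hF : FamDeriv F F') : FamDeriv (fun u => -F u) (fun u => -F' u) := by
  simpa using hF.smul (-1)

lemma sub (hF : FamDeriv F F') (hG : FamDeriv G G') :
    FamDeriv (fun u => F u - G u) (fun u => F' u - G' u) := by
  simpa only [sub_eq_add_neg] using hF.add hG.neg

lemma sum {ι : Type*} {s : Finset ι} {F F' : ι → ℝ → SF} (h : ∀ i ∈ s, FamDeriv (F i) (F' i)) :
    FamDeriv (fun u => ∑ i ∈ s, F i u) (fun u => ∑ i ∈ s, F' i u) := by
  classical
  induction s using Finset.induction_on with
  | empty => simpa using const 0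
  | insert i s hi ih =>
    simp only [Finset.sum_insert hi]
    exact (h i (Finset.mem_insert_self i s)).add (ih fun j hj => h j (Finset.mem_insert_of_mem hj))

lemma D (hF : FamDeriv F F') (a : Fin 3) :
    FamDeriv (fun u => sphereCalc.D a (F u)) (fun u => sphereCalc.D a (F' u)) := by
  have h : ∀ u x, dU (fun s y => grad0 (F s) y a) u x = grad0 (F' u) x a := by
    intro u x
    rw [hF.smooth.dU_grad0]
    congr 1
    ext y
    exact hF.dU_eq u y
  refine ⟨hF.smooth.grad0 a, hF.smooth'.grad0 a, fun u x => ?_⟩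
  have := (hF.smooth.grad0 a).hasDerivAt_dU u x
  rwa [h] at this

lemma rot (hF : FamDeriv F F') (κ : Fin 3 → Fin 3 → ℝ) :
    FamDeriv (fun u => sphereCalc.rot κ (F u)) (fun u => sphereCalc.rot κ (F' u)) := by
  simp only [SphereCalculus.rot_apply]
  exact sum fun a _ => (hF.D a).const_mul _

lemma continuous (hF : FamDeriv F F') : Continuous (fun p : ℝ × S2 => F p.1 p.2) :=
  hF.smooth.continuous

lemma continuous' (hF : FamDeriv F F') : Continuous (fun p : ℝ × S2 => F' p.1 p.2) :=
  hF.smooth'.continuous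

end FamDeriv

lemma FamDeriv.ddv {T T' : Fin 3 → Fin 3 → ℝ → SF} (h : ∀ a b, FamDeriv (T a b) (T' a b)) :
    FamDeriv (fun u => sphereCalc.ddv (fun a b => T a b u))
      (fun u => sphereCalc.ddv (fun a b => T' a b u)) :=
  FamDeriv.sum fun b _ => FamDeriv.D (FamDeriv.sum fun a _ => (h a b).D a) b

lemma FamDeriv.gdv {T T' : Fin 3 → Fin 3 → ℝ → SF} (h : ∀ a b, FamDeriv (T a b) (T' a b))
    (b : Fin 3) :
    FamDeriv (fun u => sphereCalc.gdv (fun a b => T a b u) b)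
      (fun u => sphereCalc.gdv (fun a b => T' a b u) b) :=
  FamDeriv.sum fun e _ => (FamDeriv.sum fun a _ => (h a e).D a).const_mul _

lemma FamDeriv.lie {T T' : Fin 3 → Fin 3 → ℝ → SF} (h : ∀ a b, FamDeriv (T a b) (T' a b))
    (κ : Fin 3 → Fin 3 → ℝ) (a b : Fin 3) :
    FamDeriv (fun u => sphereCalc.lie κ (fun a b => T a b u) a b)
      (fun u => sphereCalc.lie κ (fun a b => T' a b u) a b) :=
  (((h a b).rot κ).add (FamDeriv.sum fun d _ => (h d b).const_mul _)).add
    (FamDeriv.sum fun d _ => (h a d).const_mul _)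

/-- Differentiation under the integral over the sphere. -/
lemma hasDerivAt_integralS2 {F F' : ℝ → S2 → ℝ} (hF : ∀ u, Continuous (F u))
    (hF' : Continuous (fun p : ℝ × S2 => F' p.1 p.2))
    (h : ∀ u x, HasDerivAt (fun s => F s x) (F' u x) u) (u : ℝ) :
    HasDerivAt (fun s => integralS2 (F s)) (integralS2 (F' u)) u := by
  obtain ⟨K, hK⟩ := ((isCompact_Icc (a := u - 1) (b := u + 1)).prod
    (isCompact_univ (X := S2))).exists_bound_of_continuousOn hF'.continuousOn
  have hF'c : ∀ s, Continuous (F' s) := fun s => hF'.comp (Continuous.prodMk_right s)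
  refine (hasDerivAt_integral_of_dominated_loc_of_deriv_le (μ := areaS2) (bound := fun _ => K)
    (Metric.ball_mem_nhds u zero_lt_one) ?_ (SmoothS2.integrable (hF u))
    (hF'c u).aestronglyMeasurable ?_ (integrable_const _) ?_).2
  · exact Eventually.of_forall fun s => (hF s).aestronglyMeasurable
  · refine Eventually.of_forall fun x s hs => hK (s, x) ⟨?_, Set.mem_univ _⟩
    rw [Metric.mem_ball, Real.dist_eq, abs_lt] at hs
    constructor <;> linarith [hs.1, hs.2]
  · exact Eventually.of_forall fun x s _ => h s x

lemma FamDeriv.I {F F' : ℝ → SF} (h : FamDeriv F F') (u : ℝ) :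
    HasDerivAt (fun s => sphereCalc.I (F s)) (sphereCalc.I (F' u)) u :=
  hasDerivAt_integralS2 (fun u => (F u).smooth.continuous) h.continuous' h.deriv u

/-! ### Decay in retarded time -/

/-- The weight that measures the decay in retarded time. -/
def env (ε u : ℝ) : ℝ := (1 + |u|) ^ (-(1 + ε))

/-- The primitive of the weight. -/
def envInt (ε u : ℝ) : ℝ := ∫ s in (0 : ℝ)..u, env ε s

lemma env_pos (ε u : ℝ) : 0 < env ε u := Real.rpow_pos_of_pos (by positivity) _

lemma continuous_env (ε : ℝ) : Continuous (env ε) :=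
  (continuous_const.add continuous_abs).rpow_const fun u => Or.inl
    (show (0 : ℝ) < 1 + |u| by positivity).ne'

lemma integrable_env {ε : ℝ} (hε : 0 < ε) : Integrable (env ε) := by
  have := integrable_one_add_norm (E := ℝ) (μ := volume) (r := 1 + ε) (by simp [hε])
  exact this

lemma hasDerivAt_envInt (ε u : ℝ) : HasDerivAt (envInt ε) (env ε u) u :=
  intervalIntegral.integral_hasDerivAt_right ((continuous_env ε).intervalIntegrable _ _)
    ((continuous_env ε).stronglyMeasurableAtFilter _ _) (continuous_env ε).continuousAt

lemma envInt_mono (ε : ℝ) : Monotone (envInt ε) :=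
  monotone_of_deriv_nonneg (fun u => (hasDerivAt_envInt ε u).differentiableAt) fun u => by
    rw [(hasDerivAt_envInt ε u).deriv]; exact (env_pos ε u).le

lemma env_le_one {ε : ℝ} (hε : 0 < ε) (u : ℝ) : env ε u ≤ 1 :=
  Real.rpow_le_one_of_one_le_of_nonpos (by linarith [abs_nonneg u]) (by linarith)

/-- The shifted weight is comparable with the weight. -/
lemma env_add_le {ε : ℝ} (hε : 0 < ε) {M : ℝ} {t : ℝ} (ht : |t| ≤ M) (u : ℝ) :
    env ε (u + t) ≤ (1 + M) ^ (1 + ε) * env ε u := by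
  have hM : 0 ≤ M := (abs_nonneg t).trans ht
  have h1 : 1 + |u| ≤ (1 + M) * (1 + |u + t|) := by
    have h2 : |u| ≤ |u + t| + |t| := by
      have := abs_sub (u + t) t
      simpa using this
    nlinarith [abs_nonneg (u + t), mul_nonneg hM (abs_nonneg (u + t))]
  have hu : 0 < 1 + |u| := by positivity
  have hut : 0 < 1 + |u + t| := by positivity
  rw [env, env, Real.rpow_neg hut.le, Real.rpow_neg hu.le, ← div_eq_mul_inv, ← one_div,
    div_le_div_iff₀ (Real.rpow_pos_of_pos hut _) (Real.rpow_pos_of_pos hu _), one_mul,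
    ← Real.mul_rpow (by linarith) hut.le]
  exact Real.rpow_le_rpow hu.le h1 (by linarith)

/-- The two ends of the time axis. -/
structure IsEnd (ε : ℝ) (l : Filter ℝ) : Prop where
  neBot : l.NeBot
  conv : ∃ g, Tendsto (envInt ε) l (𝓝 g)
  shift : ∀ M : ℝ, Tendsto (fun u => u + M) l l
  env_zero : Tendsto (env ε) l (𝓝 0)

lemma isEnd_atTop {ε : ℝ} (hε : 0 < ε) : IsEnd ε atTop where
  neBot := inferInstance
  conv := ⟨_, intervalIntegral_tendsto_integral_Ioi 0 (integrable_env hε).integrableOn tendsto_id⟩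
  shift M := tendsto_atTop_add_const_right _ M tendsto_id
  env_zero := (tendsto_rpow_neg_atTop (by linarith : (0 : ℝ) < 1 + ε)).comp
    (tendsto_atTop_add_const_left _ 1 tendsto_abs_atTop_atTop)

lemma isEnd_atBot {ε : ℝ} (hε : 0 < ε) : IsEnd ε atBot where
  neBot := inferInstance
  conv := by
    refine ⟨_, ((intervalIntegral_tendsto_integral_Iic 0 (integrable_env hε).integrableOn
      tendsto_id).neg).congr fun u => ?_⟩
    rw [id, envInt, intervalIntegral.integral_symm]
    simp
  shift M := tendsto_atBot_add_const_right _ M tendsto_id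
  env_zero := (tendsto_rpow_neg_atTop (by linarith : (0 : ℝ) < 1 + ε)).comp
    (tendsto_atTop_add_const_left _ 1 tendsto_abs_atBot_atTop)

/-- A family of functions that is dominated by the weight. -/
def Decays (ε : ℝ) (F : ℝ → S2 → ℝ) : Prop := ∃ K, 0 ≤ K ∧ ∀ u x, |F u x| ≤ K * env ε u

/-- A family of functions that is bounded. -/
def FamBdd (F : ℝ → S2 → ℝ) : Prop := ∃ K, 0 ≤ K ∧ ∀ u x, |F u x| ≤ K

section decay

variable {ε : ℝ} {F G : ℝ → S2 → ℝ}

lemma Decays.congr (hF : Decays ε F) (h : ∀ u x, G u x = F u x) : Decays ε G := by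
  obtain ⟨K, h0, hK⟩ := hF
  exact ⟨K, h0, fun u x => by rw [h]; exact hK u x⟩

lemma Decays.add (hF : Decays ε F) (hG : Decays ε G) : Decays ε (fun u x => F u x + G u x) := by
  obtain ⟨K, h0, hK⟩ := hF
  obtain ⟨L, h1, hL⟩ := hG
  refine ⟨K + L, by positivity, fun u x => ?_⟩
  have := abs_add_le (F u x) (G u x)
  linarith [hK u x, hL u x]

lemma Decays.mul_bdd (hF : Decays ε F) (hG : FamBdd G) : Decays ε (fun u x => F u x * G u x) := by
  obtain ⟨K, h0, hK⟩ := hF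
  obtain ⟨L, h1, hL⟩ := hG
  refine ⟨K * L, by positivity, fun u x => ?_⟩
  rw [abs_mul]
  have := mul_le_mul (hK u x) (hL u x) (abs_nonneg _) ((abs_nonneg _).trans (hK u x))
  linarith

lemma Decays.bdd_mul (hF : Decays ε F) (hG : FamBdd G) : Decays ε (fun u x => G u x * F u x) :=
  (hF.mul_bdd hG).congr fun _ _ => mul_comm _ _

lemma Decays.bdd (hε : 0 < ε) (hF : Decays ε F) : FamBdd F := by
  obtain ⟨K, h0, hK⟩ := hF
  refine ⟨K, h0, fun u x => (hK u x).trans ?_⟩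
  exact mul_le_of_le_one_right h0 (env_le_one hε u)

lemma famBdd_const {H : S2 → ℝ} (hH : Continuous H) : FamBdd (fun _ => H) := by
  obtain ⟨K, hK⟩ := isCompact_univ.exists_bound_of_continuousOn hH.continuousOn
  exact ⟨|K|, abs_nonneg _, fun u x => (hK x (Set.mem_univ x)).trans (le_abs_self K)⟩

lemma SF.famBdd (H : SF) : FamBdd (fun _ x => H x) := famBdd_const H.smooth.continuous

lemma decays_zero : Decays ε (fun _ _ => 0) :=
  ⟨0, le_rfl, fun u x => by simp⟩

lemma decays_sum {ι : Type*} {s : Finset ι} {F : ι → ℝ → S2 → ℝ}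
    (h : ∀ i ∈ s, Decays ε (F i)) : Decays ε (fun u x => ∑ i ∈ s, F i u x) := by
  classical
  induction s using Finset.induction_on with
  | empty => simpa using decays_zero
  | insert i s hi ih =>
    simp only [Finset.sum_insert hi]
    exact (h i (Finset.mem_insert_self i s)).add (ih fun j hj => h j (Finset.mem_insert_of_mem hj))

lemma Decays.shift (hε : 0 < ε) (hF : Decays ε F) {f : S2 → ℝ} (hf : Continuous f) :
    Decays ε (fun u x => F (u + f x) x) := by
  obtain ⟨K, h0, hK⟩ := hF
  obtain ⟨M, hM0, hM⟩ := famBdd_const hf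
  refine ⟨K * (1 + M) ^ (1 + ε), by positivity, fun u x => (hK _ x).trans ?_⟩
  rw [mul_assoc]
  exact mul_le_mul_of_nonneg_left (env_add_le hε (hM 0 x) u) h0

/-- Integrating a decaying derivative. -/
lemma abs_sub_le_envInt {φ φ' : ℝ → ℝ} {K : ℝ} (h : ∀ u, HasDerivAt φ (φ' u) u)
    (hK : ∀ u, |φ' u| ≤ K * env ε u) (u v : ℝ) :
    |φ u - φ v| ≤ K * |envInt ε u - envInt ε v| := by
  have key : ∀ v u, v ≤ u → |φ u - φ v| ≤ K * (envInt ε u - envInt ε v) := by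
    intro v u hvu
    have m1 : Monotone (fun s => K * envInt ε s - φ s) :=
      monotone_of_hasDerivAt_nonneg (f' := fun s => K * env ε s - φ' s)
        (fun s => ((hasDerivAt_envInt ε s).const_mul K).sub (h s)) fun s => by
          have := (abs_le.1 (hK s)).2
          simp only [Pi.zero_apply]; linarith
    have m2 : Monotone (fun s => K * envInt ε s + φ s) :=
      monotone_of_hasDerivAt_nonneg (f' := fun s => K * env ε s + φ' s)
        (fun s => ((hasDerivAt_envInt ε s).const_mul K).add (h s)) fun s => by
          have := (abs_le.1 (hK s)).1
          simp only [Pi.zero_apply]; linarith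
    have h1 := m1 hvu
    have h2 := m2 hvu
    simp only at h1 h2
    rw [abs_le]
    constructor <;> linarith
  rcases le_total v u with hvu | huv
  · rw [abs_of_nonneg (sub_nonneg.2 (envInt_mono ε hvu))]
    exact key v u hvu
  · rw [abs_sub_comm, abs_sub_comm (envInt ε u), abs_of_nonneg (sub_nonneg.2 (envInt_mono ε huv))]
    exact key u v huv

/-- A family that varies at most as fast as the primitive of the weight. -/
def EnvLip (ε : ℝ) (F : ℝ → S2 → ℝ) : Prop :=
  ∃ K, 0 ≤ K ∧ ∀ u v x, |F u x - F v x| ≤ K * |envInt ε u - envInt ε v|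

lemma EnvLip.of_decays {F F' : ℝ → S2 → ℝ} (h : ∀ u x, HasDerivAt (fun s => F s x) (F' u x) u)
    (hF' : Decays ε F') : EnvLip ε F := by
  obtain ⟨K, h0, hK⟩ := hF'
  exact ⟨K, h0, fun u v x => abs_sub_le_envInt (fun s => h s x) (fun s => hK s x) u v⟩

/-- `envInt` converges at the end, so F is Cauchy there. No regularity of F in u is required, which
matters for the potential. -/
lemma exists_tendsto_of_dist_le {X : Type*} [MetricSpace X] [CompleteSpace X] {l : Filter ℝ}
    (hl : IsEnd ε l) {F : ℝ → X} {K : ℝ}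
    (h : ∀ u v, dist (F u) (F v) ≤ K * |envInt ε u - envInt ε v|) :
    ∃ y, Tendsto F l (𝓝 y) := by
  have := hl.neBot
  obtain ⟨g, hg⟩ := hl.conv
  refine cauchy_map_iff_exists_tendsto.1 (cauchy_map_iff.2 ⟨hl.neBot, ?_⟩)
  rw [tendsto_uniformity_iff_dist_tendsto_zero]
  refine squeeze_zero (fun _ => dist_nonneg) (fun p => h p.1 p.2) ?_
  have h1 : Tendsto (fun p : ℝ × ℝ => envInt ε p.1 - envInt ε p.2) (l ×ˢ l) (𝓝 (g - g)) :=
    (hg.comp tendsto_fst).sub (hg.comp tendsto_snd)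
  simpa using (h1.abs).const_mul K

/-- The mass of the weight in a window of fixed width around u tends to zero; this is why a bounded
shift of retarded time is invisible at the ends. -/
lemma isEnd_window {l : Filter ℝ} (hl : IsEnd ε l) (M : ℝ) :
    Tendsto (fun u => envInt ε (u + M) - envInt ε (u + -M)) l (𝓝 0) := by
  obtain ⟨g, hg⟩ := hl.conv
  simpa using (hg.comp (hl.shift M)).sub (hg.comp (hl.shift (-M)))

lemma EnvLip.shift_sub_le (hF : EnvLip ε F) {f : S2 → ℝ} (hf : Continuous f) :
    ∃ K M : ℝ, ∀ u x, |F (u + f x) x - F u x| ≤ K * (envInt ε (u + M) - envInt ε (u + -M)) := by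
  obtain ⟨K, h0, hK⟩ := hF
  obtain ⟨M, hM0, hM⟩ := famBdd_const hf
  refine ⟨K, M, fun u x => (hK _ _ x).trans (mul_le_mul_of_nonneg_left ?_ h0)⟩
  have h1 := abs_le.1 (hM 0 x)
  have m1 := envInt_mono ε (show u + f x ≤ u + M by linarith)
  have m2 := envInt_mono ε (show u + -M ≤ u + f x by linarith)
  have m3 := envInt_mono ε (show u ≤ u + M by linarith)
  have m4 := envInt_mono ε (show u + -M ≤ u by linarith)
  rw [abs_le]
  constructor <;> linarith

/-- The weight has finite total mass gp − gm, which bounds the deviation from the continuous slice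
at u = 0. -/
lemma EnvLip.famBdd (hF : EnvLip ε F) (hε : 0 < ε) (h0 : Continuous (F 0)) : FamBdd F := by
  obtain ⟨K, hK0, hK⟩ := hF
  obtain ⟨B, hB0, hB⟩ := famBdd_const h0
  obtain ⟨gp, hgp⟩ := (isEnd_atTop hε).conv
  obtain ⟨gm, hgm⟩ := (isEnd_atBot hε).conv
  have hmono := envInt_mono ε
  have b1 : ∀ u, envInt ε u ≤ gp := fun u => hmono.ge_of_tendsto hgp u
  have b2 : ∀ u, gm ≤ envInt ε u := fun u => hmono.le_of_tendsto hgm u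
  have hg : 0 ≤ gp - gm := by linarith [b1 0, b2 0]
  refine ⟨K * (gp - gm) + B, by positivity, fun u x => ?_⟩
  have h1 : |envInt ε u - envInt ε 0| ≤ gp - gm := by
    rw [abs_le]
    constructor <;> linarith [b1 0, b2 0, b1 u, b2 u]
  have h2 := (hK u 0 x).trans (mul_le_mul_of_nonneg_left h1 hK0)
  have h3 := abs_add_le (F u x - F 0 x) (F 0 x)
  rw [sub_add_cancel] at h3
  linarith [hB 0 x]

/-- A shift of retarded time does not change the limit of the integral over the sphere. -/
lemma EnvLip.tendsto_integral_shift_sub (hF : EnvLip ε F)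
    (hc : Continuous (fun p : ℝ × S2 => F p.1 p.2)) {f : S2 → ℝ} (hf : Continuous f)
    {l : Filter ℝ} (hl : IsEnd ε l) :
    Tendsto (fun u => integralS2 (fun x => F (u + f x) x) - integralS2 (F u)) l (𝓝 0) := by
  obtain ⟨K, M, h⟩ := hF.shift_sub_le hf
  have c1 : ∀ u, Continuous (F u) := fun u => hc.comp (Continuous.prodMk_right u)
  have c2 : ∀ u, Continuous (fun x => F (u + f x) x) := fun u =>
    hc.comp ((continuous_const.add hf).prodMk continuous_id)
  refine squeeze_zero_norm (a := fun u => K * (envInt ε (u + M) - envInt ε (u + -M)) *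
    areaS2.real Set.univ) (fun u => ?_) ?_
  · rw [integralS2, integralS2, ← integral_sub (SmoothS2.integrable (c2 u))
      (SmoothS2.integrable (c1 u))]
    exact norm_integral_le_of_norm_le_const (Eventually.of_forall fun x => h u x)
  · simpa using ((isEnd_window hl M).const_mul K).mul_const (areaS2.real Set.univ)

end decay

/-! ### Convergence in `L²` -/

/-- A smooth function as an element of `L²`. -/
def SF.toL2 : SF →ₗ[ℝ] Lp ℝ 2 areaS2 :=
  (ContinuousMap.toLp (E := ℝ) 2 areaS2 ℝ).toLinearMap.comp SF.toC

lemma SF.inner_toL2 (F G : SF) : inner ℝ F.toL2 G.toL2 = sphereCalc.I (F * G) := by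
  have h := ContinuousMap.inner_toLp (𝕜 := ℝ) areaS2 (SF.toC F) (SF.toC G)
  refine h.trans (integral_congr_ae (Eventually.of_forall fun x => ?_))
  simp [mul_comm]

lemma SF.norm_sq_toL2 (F : SF) : ‖F.toL2‖ ^ 2 = sphereCalc.I (F * F) := by
  rw [← SF.inner_toL2, real_inner_self_eq_norm_sq]

lemma tendsto_toL2_zero {l : Filter ℝ} {F : ℝ → SF} {r : ℝ → ℝ} (h : ∀ u x, |F u x| ≤ r u)
    (hr : Tendsto r l (𝓝 0)) : Tendsto (fun u => (F u).toL2) l (𝓝 0) := by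
  have h1 : Tendsto (fun u => SF.toC (F u)) l (𝓝 0) := by
    rw [tendsto_zero_iff_norm_tendsto_zero]
    refine squeeze_zero (fun _ => norm_nonneg _) (fun u => ?_) hr
    -- A point of the sphere is needed only to see that the bound r u is nonnegative.
    have x0 : S2 := ⟨EuclideanSpace.single 0 1, by simp⟩
    exact (ContinuousMap.norm_le _ ((abs_nonneg _).trans (h u x0))).2 (h u)
  have h2 := ((ContinuousMap.toLp (E := ℝ) 2 areaS2 ℝ).continuous.tendsto 0).comp h1
  rw [map_zero] at h2
  exact h2

lemma Decays.tendsto_toL2 {ε : ℝ} {F : ℝ → SF} (hF : Decays ε (fun u x => F u x)) {l : Filter ℝ}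
    (hl : IsEnd ε l) : Tendsto (fun u => (F u).toL2) l (𝓝 0) := by
  obtain ⟨K, _, hK⟩ := hF
  refine tendsto_toL2_zero hK ?_
  simpa using hl.env_zero.const_mul K

lemma EnvLip.exists_tendsto_toL2 {ε : ℝ} {F : ℝ → SF} (hF : EnvLip ε (fun u x => F u x))
    {l : Filter ℝ} (hl : IsEnd ε l) : ∃ v, Tendsto (fun u => (F u).toL2) l (𝓝 v) := by
  obtain ⟨K, h0, hK⟩ := hF
  have h1 : ∃ y, Tendsto (fun u => SF.toC (F u)) l (𝓝 y) := by
    refine exists_tendsto_of_dist_le hl (K := K) fun u v => ?_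
    exact (ContinuousMap.dist_le (by positivity)).2 fun x => hK u v x
  obtain ⟨y, hy⟩ := h1
  exact ⟨_, ((ContinuousMap.toLp (E := ℝ) 2 areaS2 ℝ).continuous.tendsto y).comp hy⟩

lemma EnvLip.tendsto_toL2_shift_sub {ε : ℝ} {F Fs : ℝ → SF} (hF : EnvLip ε (fun u x => F u x))
    {f : S2 → ℝ} (hf : Continuous f) (hs : ∀ u x, Fs u x = F (u + f x) x)
    {l : Filter ℝ} (hl : IsEnd ε l) : Tendsto (fun u => (Fs u - F u).toL2) l (𝓝 0) := by
  obtain ⟨K, M, h⟩ := hF.shift_sub_le hf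
  refine tendsto_toL2_zero (r := fun u => K * (envInt ε (u + M) - envInt ε (u + -M)))
    (fun u x => ?_) ?_
  · rw [SF.sub_apply, hs]; exact h u x
  · simpa using (isEnd_window hl M).const_mul K

/-! ### The data on null infinity in terms of the calculus -/

namespace SphereCalculus

variable {A : Type*} [CommRing A] [Algebra ℝ A] {S : SphereCalculus A}

lemma STT.sub {T U : Fin 3 → Fin 3 → A} (hT : S.STT T) (hU : S.STT U) :
    S.STT (fun a b => T a b - U a b) where
  symm a b := by rw [hT.symm, hU.symm]
  tang b := by simp only [mul_sub, Finset.sum_sub_distrib, hT.tang, hU.tang, sub_zero]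
  trace := by simp only [Finset.sum_sub_distrib, hT.trace, hU.trace, sub_zero]

lemma STT.add {T U : Fin 3 → Fin 3 → A} (hT : S.STT T) (hU : S.STT U) :
    S.STT (fun a b => T a b + U a b) where
  symm a b := by rw [hT.symm, hU.symm]
  tang b := by simp only [mul_add, Finset.sum_add_distrib, hT.tang, hU.tang, add_zero]
  trace := by simp only [Finset.sum_add_distrib, hT.trace, hU.trace, add_zero]

lemma ddv_add (T U : Fin 3 → Fin 3 → A) :
    S.ddv (fun a b => T a b + U a b) = S.ddv T + S.ddv U := by
  simp only [ddv, dv, map_add, Finset.sum_add_distrib]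

lemma ddv_sub (T U : Fin 3 → Fin 3 → A) :
    S.ddv (fun a b => T a b - U a b) = S.ddv T - S.ddv U := by
  simp only [ddv, dv, map_sub, Finset.sum_sub_distrib]

lemma lp2_add (F G : A) : S.lp2 (F + G) = S.lp2 F + S.lp2 G := by
  simp only [lp2, lp_add]; ring

lemma lp2_smul (r : ℝ) (F : A) : S.lp2 (r • F) = r • S.lp2 F := by
  simp only [lp2, lp_smul]; simp only [Algebra.smul_def]; ring

lemma lp2_sub (F G : A) : S.lp2 (F - G) = S.lp2 F - S.lp2 G := by
  have h : F - G = F + (-1 : ℝ) • G := by rw [neg_one_smul, sub_eq_add_neg]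
  rw [h, lp2_add, lp2_smul, neg_one_smul, sub_eq_add_neg]

/-- `Δ(Δ+2)` of the closed potential is twice the double divergence of the shear. -/
lemma lp2_of_potential {T : Fin 3 → Fin 3 → A} {c cu : A}
    (h : ∀ a b, 2 * T a b = S.hess2 c a b + S.curl2 cu a b) : S.lp2 c = 2 * S.ddv T := by
  have h1 : S.ddv (fun a b => T a b + T a b) = S.lp2 c := by
    have h2 : (fun a b => T a b + T a b) = fun a b => S.hess2 c a b + S.curl2 cu a b := by
      funext a b; rw [← h, two_mul]
    rw [h2, ddv_add, ddv_curl2, add_zero]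
    exact S.ddv_hess2 c
  rw [← h1, ddv_add, two_mul]

variable {κ : Fin 3 → Fin 3 → ℝ}

/-- The double divergence of the shear does not contribute to the potential term. -/
lemma I_mul_rot_lp2 (hκ : Skew κ) (c : A) : S.I (c * S.rot κ (S.lp2 c)) = 0 := by
  -- The rotation is skew, Δ(Δ+2) is symmetric, and they commute; the integral equals its own
  -- negative.
  have h1 := I_rot_mul (S := S) hκ c (S.lp2 c)
  have h2 := I_lp2_mul (S := S) c (S.rot κ c)
  rw [rot_lp2 hκ] at h2
  have h3 : S.I (S.rot κ c * S.lp2 c) = S.I (S.lp2 c * S.rot κ c) := by rw [mul_comm]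
  linarith

/-- Rewrites the part of the excess flux linear in the shear through the potential c, in the form
that cancels against the change of the potential term. -/
lemma I_lie_hess2 (hκ : Skew κ) {T : Fin 3 → Fin 3 → A} (hT : S.STT T) {c : A}
    (hc : S.lp2 c = 2 * S.ddv T) (f : A) :
    S.I (∑ a, ∑ b, T a b * S.lie κ (S.hess2 f) a b) = S.I (c * S.rot κ (S.lp2 f)) := by
  simp only [lie_hess2 hκ]
  rw [hT.I_hess2, ← rot_lp2 hκ, ← I_lp2_mul, hc, mul_assoc, two_mul, two_mul, map_add]

end SphereCalculus

open SphereCalculus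

/-- The matrix that generates the rotation about the `k`-th axis. -/
def axis (k a c : Fin 3) : ℝ := leviCivita a k c

lemma skew_axis (k : Fin 3) : Skew (axis k) := fun a c => by
  simp only [axis, leviCivita]; ring

/-- The volume form is tangential, so the projection in D_b X_k can be dropped. What remains is
ε_{ak}, which fixes the index order in `axis`. -/
lemma sum_ep_mul_grad (k a : Fin 3) :
    ∑ b, sphereCalc.ep a b * sphereCalc.D b (sphereCalc.X k) = sphereCalc.rv (axis k) a := by
  have h1 := sphereCalc.sum_sg k (fun b => sphereCalc.ep a b)
  have h2 : ∑ b, sphereCalc.X b * sphereCalc.ep a b = 0 := by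
    obtain ⟨e1, e2, e3, e4, e5, e6, e7, e8, e9⟩ := sphereCalc.ep_entries
    fin_cases a <;> simp [Fin.sum_univ_three, e1, e2, e3, e4, e5, e6, e7, e8, e9] <;> ring
  rw [h2, mul_zero, sub_zero] at h1
  simp only [D_X, mul_comm (sphereCalc.ep a _)]
  rw [h1]; rfl

lemma rv_axis_apply (k a : Fin 3) (x : S2) :
    sphereCalc.rv (axis k) a x = ∑ b, epsS2 x a b * grad0 (coordX k) x b := by
  rw [← sum_ep_mul_grad]
  simp only [SF.sum_apply, SF.mul_apply, sphereCalc_ep, sphereCalc_D]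
  rfl

namespace NullInfinityData

variable (D : NullInfinityData)

/-- The mass aspect at retarded time `u`. -/
def mS (u : ℝ) : SF := SF.mk (D.smooth_m.slice u)
/-- The angular momentum aspect at retarded time `u`. -/
def nS (a : Fin 3) (u : ℝ) : SF := SF.mk ((D.smooth_NA a).slice u)
/-- The shear at retarded time `u`. -/
def cS (a b : Fin 3) (u : ℝ) : SF := SF.mk ((D.smooth_C a b).slice u)
/-- The news at retarded time `u`. -/
def wS (a b : Fin 3) (u : ℝ) : SF := SF.mk ((D.smooth_C a b).dU.slice u)
/-- The rate of change of the mass aspect. -/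
def dmS (u : ℝ) : SF := SF.mk (D.smooth_m.dU.slice u)
/-- The rate of change of the angular momentum aspect. -/
def dnS (a : Fin 3) (u : ℝ) : SF := SF.mk ((D.smooth_NA a).dU.slice u)
/-- The rate of change of the news. -/
def dwS (a b : Fin 3) (u : ℝ) : SF := SF.mk ((D.smooth_C a b).dU.dU.slice u)

lemma fam_m : FamDeriv D.mS D.dmS := FamDeriv.of_smoothScri D.smooth_m
lemma fam_n (a : Fin 3) : FamDeriv (D.nS a) (D.dnS a) :=
  FamDeriv.of_smoothScri (D.smooth_NA a)
lemma fam_c (a b : Fin 3) : FamDeriv (D.cS a b) (D.wS a b) :=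
  FamDeriv.of_smoothScri (D.smooth_C a b)
lemma fam_w (a b : Fin 3) : FamDeriv (D.wS a b) (D.dwS a b) :=
  FamDeriv.of_smoothScri (D.smooth_C a b).dU

lemma wS_apply (a b : Fin 3) (u : ℝ) (x : S2) : D.wS a b u x = news D.C u x a b := rfl

lemma stt_c (u : ℝ) : sphereCalc.STT (fun a b => D.cS a b u) where
  symm a b := SF.ext' fun x => D.symm_C u x a b
  tang b := SF.ext' fun x => by
    rw [SF.sum_apply]
    exact D.tangent_C u x b
  trace := SF.ext' fun x => by
    rw [SF.sum_apply]
    exact D.traceless_C u x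

/-- The constraints on the shear are linear with coefficients independent of u, so they pass to its
u-derivative. -/
lemma stt_w (u : ℝ) : sphereCalc.STT (fun a b => D.wS a b u) where
  symm a b := by
    have h : D.cS a b = D.cS b a := funext fun u => (D.stt_c u).symm a b
    have h1 := D.fam_c a b
    rw [h] at h1
    exact congrFun (h1.unique (D.fam_c b a)) u
  tang b := by
    have h1 : FamDeriv (fun u => ∑ a, sphereCalc.X a * D.cS a b u)
      (fun u => ∑ a, sphereCalc.X a * D.wS a b u) :=
      FamDeriv.sum fun a _ => (D.fam_c a b).const_mul _
    have h2 : (fun u => ∑ a, sphereCalc.X a * D.cS a b u) = fun _ => 0 :=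
      funext fun u => (D.stt_c u).tang b
    rw [h2] at h1
    exact congrFun (h1.unique (FamDeriv.const 0)) u
  trace := by
    have h1 : FamDeriv (fun u => ∑ a, D.cS a a u) (fun u => ∑ a, D.wS a a u) :=
      FamDeriv.sum fun a _ => D.fam_c a a
    have h2 : (fun u => ∑ a, D.cS a a u) = fun _ => 0 := funext fun u => (D.stt_c u).trace
    rw [h2] at h1
    exact congrFun (h1.unique (FamDeriv.const 0)) u

lemma div2_c (u : ℝ) : div2 (D.C u) = fun y d => sphereCalc.gdv (fun a b => D.cS a b u) d y := by
  funext y d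
  exact div2_eq (fun a b => D.cS a b u) y d

lemma div2_w (u : ℝ) :
    div2 (news D.C u) = fun y d => sphereCalc.gdv (fun a b => D.wS a b u) d y := by
  funext y d
  exact div2_eq (fun a b => D.wS a b u) y d

lemma evol_n (u : ℝ) (a : Fin 3) :
    4 * D.dnS a u = 4 * sphereCalc.D a (D.mS u)
      - sphereCalc.gdv (fun d b => sphereCalc.gr (sphereCalc.gdv fun a b => D.cS a b u) d b
          - sphereCalc.gr (sphereCalc.gdv fun a b => D.cS a b u) b d) a
      + sphereCalc.D a (∑ b, ∑ e, D.cS b e u * D.wS b e u)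
      - sphereCalc.gdv (fun b e => ∑ d, D.cS b d u * D.wS d e u) a
      + 2 * ∑ b, D.cS a b u * sphereCalc.gdv (fun a b => D.wS a b u) b := by
  refine SF.ext' fun x => ?_
  have h := D.evol_NA u x a
  have e1 : div2 (fun y d b => grad1 (div2 (D.C u)) y d b - grad1 (div2 (D.C u)) y b d) x a =
      sphereCalc.gdv (fun d b => sphereCalc.gr (sphereCalc.gdv fun a b => D.cS a b u) d b
          - sphereCalc.gr (sphereCalc.gdv fun a b => D.cS a b u) b d) a x := by
    rw [← div2_eq, D.div2_c]
    simp only [grad1_eq, SF.sub_apply]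
  have e2 : grad0 (fun y => ∑ b, ∑ e, D.C u y b e * news D.C u y b e) x a =
      sphereCalc.D a (∑ b, ∑ e, D.cS b e u * D.wS b e u) x := by
    rw [sphereCalc_D]
    congr 1
  have e3 : div2 (fun y b e => ∑ d, D.C u y b d * news D.C u y d e) x a =
      sphereCalc.gdv (fun b e => ∑ d, D.cS b d u * D.wS d e u) a x := by
    rw [← div2_eq]
    simp only [SF.sum_apply]
    rfl
  rw [e1, e2, e3, D.div2_w] at h
  simp only [SF.add_apply, SF.sub_apply, SF.mul_apply, SF.ofNat_apply, SF.sum_apply]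
  have h' : D.dnS a u x = deriv (fun s => D.NA s x a) u := rfl
  have h2 : sphereCalc.D a (D.mS u) x = grad0 (D.m u) x a := rfl
  have h3 : ∀ b, D.cS a b u x = D.C u x a b := fun b => rfl
  rw [h', h, h2]
  simp only [h3]
  ring

/-- The local part of the angular momentum. -/
def localJ (κ : Fin 3 → Fin 3 → ℝ) (u : ℝ) : ℝ :=
  sphereCalc.I (∑ a, sphereCalc.rv κ a * (D.nS a u -
    (1 / 4 : ℝ) • ∑ d, D.cS a d u * sphereCalc.gdv (fun a b => D.cS a b u) d))

/-- The flux density of the angular momentum. -/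
def fluxS (κ : Fin 3 → Fin 3 → ℝ) (u : ℝ) : SF :=
  ∑ a, ∑ b, D.wS a b u * sphereCalc.lie κ (fun a b => D.cS a b u) a b

lemma hasDerivAt_localJ {κ : Fin 3 → Fin 3 → ℝ} (hκ : Skew κ) (u : ℝ) :
    HasDerivAt (D.localJ κ) (-(1 / 4) * sphereCalc.I (D.fluxS κ u)) u := by
  have h1 : FamDeriv (fun u => ∑ a, sphereCalc.rv κ a * (D.nS a u -
      (1 / 4 : ℝ) • ∑ d, D.cS a d u * sphereCalc.gdv (fun a b => D.cS a b u) d)) _ :=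
    FamDeriv.sum fun a _ => ((D.fam_n a).sub ((FamDeriv.sum fun d _ =>
      (D.fam_c a d).mul (FamDeriv.gdv D.fam_c d)).smul (1 / 4))).const_mul (sphereCalc.rv κ a)
  refine (h1.I u).congr_deriv ?_
  have h2 := I_angular_flux (S := sphereCalc) hκ (D.stt_c u) (D.stt_w u) (D.mS u)
    (∑ b, ∑ e, D.cS b e u * D.wS b e u) (n := fun a => D.dnS a u) (D.evol_n u)
  rw [fluxS, neg_mul, ← mul_neg, ← h2, ← smul_eq_mul, ← map_smul]
  congr 1
  rw [Finset.smul_sum]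
  refine Finset.sum_congr rfl fun a _ => ?_
  have h3 : (algebraMap ℝ SF (1 / 4)) * 4 = 1 := by
    rw [show (4 : SF) = algebraMap ℝ SF 4 from (map_ofNat _ 4).symm, ← map_mul]
    norm_num
  simp only [Algebra.smul_def, Finset.sum_add_distrib]
  linear_combination -(sphereCalc.rv κ a * D.dnS a u) * h3

/-- The mass aspect without its part that is linear in the shear. -/
def qS (u : ℝ) : SF := D.mS u - (1 / 4 : ℝ) • sphereCalc.ddv (fun a b => D.cS a b u)

/-- The rate of change of `qS`. -/
def dqS (u : ℝ) : SF := -((1 / 8 : ℝ) • ∑ a, ∑ b, D.wS a b u * D.wS a b u)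

/-- The linear news term in `evol_m` is the u-derivative of ¼ div div C; removing it leaves only the
quadratic, integrable term. -/
lemma fam_q : FamDeriv D.qS D.dqS := by
  have h := D.fam_m.sub ((FamDeriv.ddv D.fam_c).smul (1 / 4))
  have e : D.dqS = fun u => D.dmS u - (1 / 4 : ℝ) • sphereCalc.ddv (fun a b => D.wS a b u) := by
    funext u
    refine SF.ext' fun x => ?_
    have h1 : D.dmS u x = _ := D.evol_m u x
    have h2 : div1 (div2 (news D.C u)) x = sphereCalc.ddv (fun a b => D.wS a b u) x := by
      rw [D.div2_w, div1_eq]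
      simp only [(D.stt_w u).gdv_eq, ddv]
    rw [h2] at h1
    rw [SF.sub_apply, h1]
    simp only [dqS, SF.neg_apply, SF.smul_apply, SF.sum_apply, SF.mul_apply, D.wS_apply, sq]
    ring
  rw [e]
  exact h

end NullInfinityData

/-- Orthogonality to the modes `0` and `1`. -/
lemma SupportedGE2.I_mul_eq_zero {c : SF} (h : SupportedGE2 c) :
    ∀ ℓ < 2, ∀ F ∈ sphereCalc.Mode ℓ, sphereCalc.I (c * F) = 0 := by
  intro ℓ hℓ F hF
  refine h ℓ hℓ F ⟨F.smooth, fun x => ?_⟩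
  rw [sphereCalc.mem_Mode] at hF
  rw [lap_eq, hF, SF.neg_apply, SF.smul_apply]
  ring

namespace IsPotentialPair

variable {D : NullInfinityData} {u : ℝ}

lemma lp2_eq {c cu : S2 → ℝ} (h : IsPotentialPair (D.C u) c cu) :
    sphereCalc.lp2 (SF.mk h.smooth_c) = 2 * sphereCalc.ddv (fun a b => D.cS a b u) := by
  refine lp2_of_potential (cu := SF.mk h.smooth_cu) fun a b => SF.ext' fun x => ?_
  have h1 : D.cS a b u x = _ := h.eq x a b
  have h2 : ∀ e b, hess c x e b = sphereCalc.hs (SF.mk h.smooth_c) e b x :=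
    fun e b => hess_eq (SF.mk h.smooth_c) x e b
  have h3 : ∀ e b, hess cu x e b = sphereCalc.hs (SF.mk h.smooth_cu) e b x :=
    fun e b => hess_eq (SF.mk h.smooth_cu) x e b
  have h4 : lap c x = sphereCalc.lp (SF.mk h.smooth_c) x := lap_eq (SF.mk h.smooth_c) x
  simp only [SF.mul_apply, SF.ofNat_apply, h1, h2, h3, h4, hess2, curl2, SF.add_apply,
    SF.sub_apply, SF.sum_apply, sphereCalc_sg, sphereCalc_ep]
  ring

/-- m − q is a multiple of Δ(Δ+2)c, which `I_mul_rot_lp2` removes. The gain is that Y(q) needs only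
the first angular derivative of the news to converge. -/
lemma cwy_eq {c : ℝ → S2 → ℝ} {cu : S2 → ℝ} (h : IsPotentialPair (D.C u) (c u) cu) (k : Fin 3) :
    cwyAngularMomentum D c k u = D.localJ (axis k) u -
      sphereCalc.I (SF.mk h.smooth_c * sphereCalc.rot (axis k) (D.qS u)) := by
  have h1 : cwyAngularMomentum D c k u = D.localJ (axis k) u -
      sphereCalc.I (SF.mk h.smooth_c * sphereCalc.rot (axis k) (D.mS u)) := by
    rw [NullInfinityData.localJ, ← map_sub, sphereCalc_I, cwyAngularMomentum]
    congr 1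
    funext x
    simp only [SF.sub_apply, SF.sum_apply, SF.mul_apply, SF.smul_apply, rot_apply, ← rv_axis_apply,
      D.div2_c, Finset.mul_sum, ← Finset.sum_sub_distrib, sphereCalc_D]
    refine Finset.sum_congr rfl fun a _ => ?_
    have e1 : D.nS a u x = D.NA u x a := rfl
    have e2 : ∀ d, D.cS a d u x = D.C u x a d := fun d => rfl
    have e3 : grad0 (D.mS u) x a = grad0 (D.m u) x a := rfl
    rw [e1, e3]
    simp only [e2, SF.mk_apply, mul_sub, ← Finset.mul_sum]
    ring
  have h2 := h.lp2_eq
  have h3 := I_mul_rot_lp2 (S := sphereCalc) (skew_axis k) (SF.mk h.smooth_c)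
  rw [h1]
  congr 1
  have h4 : D.mS u = D.qS u + (1 / 8 : ℝ) • sphereCalc.lp2 (SF.mk h.smooth_c) := by
    refine SF.ext' fun x => ?_
    rw [h2]
    simp only [NullInfinityData.qS, SF.add_apply, SF.sub_apply, SF.smul_apply, SF.mul_apply,
      SF.ofNat_apply]
    ring
  rw [h4, map_add, Derivation.map_smul, mul_add, map_add, mul_smul_comm, map_smul, h3, smul_zero,
    add_zero]

end IsPotentialPair

/-- Here m may be replaced by q because div div C is orthogonal to X^k, by `STT.I_hess2` and
`hess2_X`. -/
lemma linearMomentum_eq (D : NullInfinityData) (k : Fin 3) (u : ℝ) :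
    linearMomentum D k u = 2 * sphereCalc.I (D.qS u * sphereCalc.X k) := by
  have h1 := (D.stt_c u).I_hess2 (sphereCalc.X k)
  simp only [hess2_X, mul_zero, Finset.sum_const_zero, map_zero] at h1
  have h2 : linearMomentum D k u = 2 * sphereCalc.I (D.mS u * sphereCalc.X k) := by
    rw [two_mul, ← map_add, linearMomentum, sphereCalc_I]
    congr 1
    funext x
    have : D.mS u x = D.m u x := rfl
    simp only [SF.add_apply, SF.mul_apply, sphereCalc_X, this]
    ring
  rw [h2, NullInfinityData.qS, sub_mul, map_sub, smul_mul_assoc, map_smul]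
  have : sphereCalc.I (sphereCalc.ddv (fun a b => D.cS a b u) * sphereCalc.X k) = 0 := by linarith
  rw [this, smul_zero, sub_zero]

/-! ### Consequences of the decay of the news -/

lemma Decays.of_isBigO {ε : ℝ} (hε : 0 < ε) {F : ℝ → S2 → ℝ}
    (hc : Continuous (fun p : ℝ × S2 => F p.1 p.2))
    (h : (fun p : ℝ × S2 => F p.1 p.2) =O[(atBot ⊔ atTop) ×ˢ ⊤]
      (fun p : ℝ × S2 => |p.1| ^ (-1 - ε))) : Decays ε F := by
  obtain ⟨K, hK⟩ := h.bound
  rw [← principal_univ, eventually_prod_principal_iff, eventually_sup, eventually_atBot,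
    eventually_atTop] at hK
  obtain ⟨⟨a, ha⟩, ⟨b, hb⟩⟩ := hK
  set R : ℝ := max 1 (max |a| |b|)
  have hR1 : 1 ≤ R := le_max_left _ _
  have hRa : |a| ≤ R := (le_max_left _ _).trans (le_max_right _ _)
  have hRb : |b| ≤ R := (le_max_right _ _).trans (le_max_right _ _)
  obtain ⟨B, hB⟩ := ((isCompact_Icc (a := -R) (b := R)).prod
    (isCompact_univ (X := S2))).exists_bound_of_continuousOn hc.continuousOn
  have hRe := env_pos ε R
  -- The second summand covers |u| ≤ R by compactness, where `env` is at least its value at R. The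
  -- first covers |u| > R ≥ 1, where 1 + |u| ≤ 2|u|.
  refine ⟨|K| * 2 ^ (1 + ε) + |B| / env ε R, by positivity, fun u x => ?_⟩
  have hue := env_pos ε u
  rw [add_mul]
  rcases le_or_gt |u| R with hu | hu
  · have h1 : env ε R ≤ env ε u :=
      Real.rpow_le_rpow_of_nonpos (by positivity)
        (by rw [abs_of_nonneg (zero_le_one.trans hR1)]; linarith) (by linarith)
    have h2 : |F u x| ≤ |B| := (hB (u, x) ⟨abs_le.1 hu, Set.mem_univ _⟩).trans (le_abs_self B)
    have h3 : |B| ≤ |B| / env ε R * env ε u := by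
      rw [div_mul_eq_mul_div, le_div_iff₀ hRe]
      exact mul_le_mul_of_nonneg_left h1 (abs_nonneg B)
    have h4 : 0 ≤ |K| * 2 ^ (1 + ε) * env ε u := by positivity
    linarith
  · have hu1 : 1 < |u| := lt_of_le_of_lt hR1 hu
    have h1 : |F u x| ≤ K * ‖|u| ^ (-1 - ε)‖ := by
      rcases le_total 0 u with h0 | h0
      · rw [abs_of_nonneg h0] at hu
        exact hb u (by linarith [le_abs_self b]) x (Set.mem_univ x)
      · rw [abs_of_nonpos h0] at hu
        exact ha u (by linarith [neg_abs_le a]) x (Set.mem_univ x)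
    have h2 : |u| ^ (-1 - ε) ≤ 2 ^ (1 + ε) * env ε u := by
      have e1 : (2 * |u|) ^ (-(1 + ε)) ≤ env ε u :=
        Real.rpow_le_rpow_of_nonpos (by positivity) (by linarith) (by linarith)
      have e2 : |u| ^ (-1 - ε) = 2 ^ (1 + ε) * (2 * |u|) ^ (-(1 + ε)) := by
        rw [Real.mul_rpow (by norm_num) (abs_nonneg u), ← mul_assoc,
          ← Real.rpow_add (by norm_num), add_neg_cancel, Real.rpow_zero, one_mul]
        congr 1
        ring
      rw [e2]
      exact mul_le_mul_of_nonneg_left e1 (by positivity)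
    rw [Real.norm_of_nonneg (Real.rpow_nonneg (abs_nonneg u) _)] at h1
    have h3 : K * |u| ^ (-1 - ε) ≤ |K| * (2 ^ (1 + ε) * env ε u) :=
      mul_le_mul (le_abs_self K) h2 (Real.rpow_nonneg (abs_nonneg u) _) (abs_nonneg K)
    have h4 : 0 ≤ |B| / env ε R * env ε u := by positivity
    linarith

namespace SphereCalculus

variable {A : Type*} [CommRing A] [Algebra ℝ A] {S : SphereCalculus A}

/-- The tangential gradient of the components of a tensor in terms of the covariant derivative. -/
lemma STT.D_eq {T : Fin 3 → Fin 3 → A} (hT : S.STT T) (d b c : Fin 3) :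
    S.D d (T b c) = ∑ a, ∑ e, S.sg b a * S.sg c e * S.D d (T a e)
      - S.X b * T d c - S.X c * T b d := by
  have ht : ∀ c, ∑ a, S.X a * S.D d (T a c) = -T d c := by
    intro c
    have h1 := congrArg (S.D d) (hT.tang c)
    have h2 := S.sum_sg' d (fun a => T a c)
    rw [hT.tang c] at h2
    simp only [map_sum, D_mul, D_X, map_zero, Finset.sum_add_distrib] at h1
    rw [h2] at h1
    linear_combination h1
  have h1 : ∀ e, ∑ a, S.sg b a * S.D d (T a e) = S.D d (T b e) + S.X b * T d e := by
    intro e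
    rw [S.sum_sg' b (fun a => S.D d (T a e)), ht]; ring
  have h2 : ∑ a, ∑ e, S.sg b a * S.sg c e * S.D d (T a e) =
      ∑ e, S.sg c e * (S.D d (T b e) + S.X b * T d e) := by
    simp only [← h1, Fin.sum_univ_three]; ring
  have h3 := S.sum_sg' c (fun e => S.D d (T b e) + S.X b * T d e)
  have h4 : ∑ e, S.X e * (S.D d (T b e) + S.X b * T d e) = -T b d := by
    have e1 : ∑ e, S.X e * S.D d (T b e) = -T d b := by
      rw [← ht b]; exact Finset.sum_congr rfl fun e _ => by rw [hT.symm b e]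
    have e2 : ∑ e, S.X e * T d e = 0 := by
      rw [← hT.tang d]; exact Finset.sum_congr rfl fun e _ => by rw [hT.symm d e]
    rw [hT.symm b d]
    simp only [Fin.sum_univ_three] at e1 e2 ⊢
    linear_combination e1 + S.X b * e2
  rw [h2, h3, h4]
  ring

end SphereCalculus

namespace NullInfinityData

variable (D : NullInfinityData)

lemma grad2_w (u : ℝ) (x : S2) (d b c : Fin 3) : grad2 (news D.C u) x d b c =
    (∑ a, ∑ e, sphereCalc.sg b a * sphereCalc.sg c e * sphereCalc.D d (D.wS a e u)) x := by
  simp only [grad2, SF.sum_apply, SF.mul_apply, sphereCalc_sg, sphereCalc_D]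
  rfl

variable {D} {ε : ℝ}

/-- The decay of the news and of its derivative in ambient components. -/
structure Falloff (D : NullInfinityData) (ε : ℝ) : Prop where
  pos : 0 < ε
  news : ∀ a b, Decays ε (fun u x => D.wS a b u x)
  grad : ∀ d a b, Decays ε (fun u x => sphereCalc.D d (D.wS a b u) x)

end NullInfinityData

open NullInfinityData

lemma NewsDecay.exists_falloff {D : NullInfinityData} (h : NewsDecay D) :
    ∃ ε, D.Falloff ε := by
  obtain ⟨ε, hε, h1, h2⟩ := h
  have hw : ∀ a b, Decays ε (fun u x => D.wS a b u x) := fun a b =>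
    Decays.of_isBigO hε (D.fam_w a b).continuous (h1 a b)
  refine ⟨ε, hε, hw, fun d b c => ?_⟩
  have hfam : FamDeriv (fun u => ∑ a, ∑ e, sphereCalc.sg b a * sphereCalc.sg c e *
      sphereCalc.D d (D.wS a e u)) _ :=
    FamDeriv.sum fun a _ => FamDeriv.sum fun e _ => ((D.fam_w a e).D d).const_mul _
  have hg : Decays ε (fun u x => (∑ a, ∑ e, sphereCalc.sg b a * sphereCalc.sg c e *
      sphereCalc.D d (D.wS a e u)) x) := by
    refine Decays.of_isBigO hε hfam.continuous ?_
    simpa only [D.grad2_w] using h2 d b c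
  refine ((hg.add ((hw d c).bdd_mul (-sphereCalc.X b).famBdd)).add
    ((hw b d).bdd_mul (-sphereCalc.X c).famBdd)).congr fun u x => ?_
  rw [(D.stt_w u).D_eq d b c]
  simp only [SF.sub_apply, SF.mul_apply, SF.neg_apply]
  ring

namespace NullInfinityData.Falloff

variable {D : NullInfinityData} {ε : ℝ} (h : D.Falloff ε) (κ : Fin 3 → Fin 3 → ℝ)
include h

lemma rot_news (a b : Fin 3) : Decays ε (fun u x => sphereCalc.rot κ (D.wS a b u) x) := by
  refine (decays_sum (s := Finset.univ) fun d _ =>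
    (h.grad d a b).bdd_mul (sphereCalc.rv κ d).famBdd).congr fun u x => ?_
  rw [rot_apply, SF.sum_apply]; rfl

lemma lie_news (a b : Fin 3) :
    Decays ε (fun u x => sphereCalc.lie κ (fun a b => D.wS a b u) a b x) := by
  refine (((h.rot_news κ a b).add (decays_sum (s := Finset.univ) fun d _ =>
    (h.news d b).bdd_mul (algebraMap ℝ SF (κ d a)).famBdd)).add
    (decays_sum (s := Finset.univ) fun d _ =>
    (h.news a d).bdd_mul (algebraMap ℝ SF (κ d b)).famBdd)).congr fun u x => ?_
  simp only [lie, SF.add_apply, SF.sum_apply, SF.mul_apply]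

lemma shear_envLip (a b : Fin 3) : EnvLip ε (fun u x => D.cS a b u x) :=
  EnvLip.of_decays (D.fam_c a b).deriv (h.news a b)

/-- The shear need not decay, but its Lie derivative stays bounded because that of the news is
integrable in u; the decay of ∇N enters here. -/
lemma lie_shear_famBdd (a b : Fin 3) :
    FamBdd (fun u x => sphereCalc.lie κ (fun a b => D.cS a b u) a b x) :=
  (EnvLip.of_decays (FamDeriv.lie D.fam_c κ a b).deriv (h.lie_news κ a b)).famBdd h.pos
    (SF.smooth _).continuous

lemma flux : Decays ε (fun u x => D.fluxS κ u x) := by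
  refine (decays_sum (s := Finset.univ) fun a _ => decays_sum (s := Finset.univ) fun b _ =>
    (h.news a b).mul_bdd (h.lie_shear_famBdd κ a b)).congr fun u x => ?_
  simp only [fluxS, SF.sum_apply, SF.mul_apply]

lemma dq : Decays ε (fun u x => D.dqS u x) := by
  refine ((decays_sum (s := Finset.univ) fun a _ => decays_sum (s := Finset.univ) fun b _ =>
    (h.news a b).mul_bdd ((h.news a b).bdd h.pos)).bdd_mul
      (algebraMap ℝ SF (-(1 / 8))).famBdd).congr fun u x => ?_
  simp only [dqS, SF.neg_apply, SF.smul_apply, SF.sum_apply, SF.mul_apply, SF.const_apply]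
  ring

lemma rot_dq : Decays ε (fun u x => sphereCalc.rot κ (D.dqS u) x) := by
  refine ((decays_sum (s := Finset.univ) fun a _ => decays_sum (s := Finset.univ) fun b _ =>
    (h.rot_news κ a b).mul_bdd ((h.news a b).bdd h.pos)).bdd_mul
      (algebraMap ℝ SF (-(1 / 4))).famBdd).congr fun u x => ?_
  simp only [dqS, map_neg, Derivation.map_smul, map_sum, rot_mul]
  simp only [SF.neg_apply, SF.smul_apply, SF.add_apply, SF.mul_apply, SF.const_apply,
    Fin.sum_univ_three]
  ring

lemma q_envLip : EnvLip ε (fun u x => D.qS u x) :=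
  EnvLip.of_decays D.fam_q.deriv h.dq

/-- Gives a limit of Y(q) itself, so that its pairing with the merely L²-convergent potential
converges. -/
lemma rot_q_envLip : EnvLip ε (fun u x => sphereCalc.rot κ (D.qS u) x) :=
  EnvLip.of_decays (D.fam_q.rot κ).deriv (h.rot_dq κ)

/-- The local part of the angular momentum has a limit at each end. -/
lemma exists_tendsto_localJ (hκ : Skew κ) {l : Filter ℝ} (hl : IsEnd ε l) :
    ∃ j, Tendsto (D.localJ κ) l (𝓝 j) := by
  obtain ⟨K, h0, hK⟩ := h.flux κ
  refine exists_tendsto_of_dist_le hl (K := K * areaS2.real Set.univ) fun u v => ?_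
  refine abs_sub_le_envInt (D.hasDerivAt_localJ hκ) (fun s => ?_) u v
  have h1 : |sphereCalc.I (D.fluxS κ s)| ≤ K * env ε s * areaS2.real Set.univ := by
    change ‖∫ x, D.fluxS κ s x ∂areaS2‖ ≤ _
    exact norm_integral_le_of_norm_le_const (Eventually.of_forall fun x => hK s x)
  rw [abs_mul, abs_neg, abs_of_pos (by norm_num : (0 : ℝ) < 1 / 4)]
  have h2 := abs_nonneg (sphereCalc.I (D.fluxS κ s))
  linarith

end NullInfinityData.Falloff

/-! ### Primitives in retarded time -/

/-- The primitive of a family of functions in retarded time. -/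
def primU (F : ℝ → S2 → ℝ) (u : ℝ) (x : S2) : ℝ := ∫ s in (0 : ℝ)..u, F s x

lemma hasDerivAt_primU {F : ℝ → S2 → ℝ} (hF : Continuous (fun p : ℝ × S2 => F p.1 p.2))
    (u : ℝ) (x : S2) : HasDerivAt (fun s => primU F s x) (F u x) u := by
  have hc : Continuous (fun s => F s x) := hF.comp (Continuous.prodMk_left x)
  exact intervalIntegral.integral_hasDerivAt_right (hc.intervalIntegrable _ _)
    (hc.stronglyMeasurableAtFilter _ _) hc.continuousAt

lemma continuous_primU {F : ℝ → S2 → ℝ} (hF : Continuous (fun p : ℝ × S2 => F p.1 p.2)) :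
    Continuous (fun p : ℝ × S2 => primU F p.1 p.2) := by
  have hc : Continuous (Function.uncurry fun (p : ℝ × S2) (s : ℝ) => F s p.2) :=
    hF.comp (continuous_snd.prodMk (continuous_snd.comp continuous_fst))
  exact intervalIntegral.continuous_parametric_intervalIntegral_of_continuous hc continuous_fst

/-- Two quantities whose fluxes agree up to a shift of retarded time and a total derivative differ
asymptotically by a constant that is the same at both ends. -/
lemma exists_tendsto_sub_of_shifted_flux {ε : ℝ} {F E E' : ℝ → S2 → ℝ} {f : S2 → ℝ} {J J' : ℝ → ℝ}
    (hFc : Continuous (fun p : ℝ × S2 => F p.1 p.2)) (hF : Decays ε F)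
    (hEc : Continuous (fun p : ℝ × S2 => E p.1 p.2))
    (hEc' : Continuous (fun p : ℝ × S2 => E' p.1 p.2))
    (hE : ∀ u x, HasDerivAt (fun s => E s x) (E' u x) u) (hE' : Decays ε E')
    (hfc : Continuous f) (hJ : ∀ u, HasDerivAt J (-(1 / 4) * integralS2 (F u)) u)
    (hJ' : ∀ u, HasDerivAt J'
      (-(1 / 4) * integralS2 (fun x => F (u + f x) x + E' (u + f x) x)) u) :
    ∃ K : ℝ, ∀ l, IsEnd ε l →
      Tendsto (fun u => J' u - J u + 1 / 4 * integralS2 (E u)) l (𝓝 K) := by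
  -- P is a pointwise primitive of F + E′, so evaluating P at u + f(x) integrates the shifted flux.
  -- Both J′ + ¼∫P(u+f) and J + ¼∫primU F are therefore constant in u.
  set P : ℝ → S2 → ℝ := fun u x => primU F u x + E u x with hP
  set p : ℝ → S2 → ℝ := fun u x => F u x + E' u x with hp
  have hPp : ∀ u x, HasDerivAt (fun s => P s x) (p u x) u := fun u x =>
    (hasDerivAt_primU hFc u x).add (hE u x)
  have hPc : Continuous (fun q : ℝ × S2 => P q.1 q.2) := (continuous_primU hFc).add hEc
  have hpc : Continuous (fun q : ℝ × S2 => p q.1 q.2) := hFc.add hEc'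
  have hsh : Continuous (fun q : ℝ × S2 => ((q.1 + f q.2, q.2) : ℝ × S2)) :=
    (continuous_fst.add (hfc.comp continuous_snd)).prodMk continuous_snd
  have d1 : ∀ u, HasDerivAt (fun s => integralS2 (fun x => P (s + f x) x))
      (integralS2 (fun x => p (u + f x) x)) u :=
    hasDerivAt_integralS2 (F := fun s x => P (s + f x) x) (F' := fun s x => p (s + f x) x)
      (fun u => (hPc.comp hsh).comp (Continuous.prodMk_right u)) (hpc.comp hsh)
      (fun u x => (hPp (u + f x) x).comp_add_const u (f x))
  have d2 : ∀ u, HasDerivAt (fun s => integralS2 (primU F s)) (integralS2 (F u)) u :=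
    hasDerivAt_integralS2 (fun u => (continuous_primU hFc).comp (Continuous.prodMk_right u))
      hFc (hasDerivAt_primU hFc)
  have d3 : ∀ u, HasDerivAt (fun u => J' u + 1 / 4 * integralS2 (fun x => P (u + f x) x)) 0 u :=
    fun u => ((hJ' u).add ((d1 u).const_mul (1 / 4))).congr_deriv (by ring)
  have d4 : ∀ u, HasDerivAt (fun u => J u + 1 / 4 * integralS2 (primU F u)) 0 u :=
    fun u => ((hJ u).add ((d2 u).const_mul (1 / 4))).congr_deriv (by ring)
  have const1 := fun u => is_const_of_deriv_eq_zero (fun u => (d3 u).differentiableAt)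
    (fun u => (d3 u).deriv) u 0
  have const2 := fun u => is_const_of_deriv_eq_zero (fun u => (d4 u).differentiableAt)
    (fun u => (d4 u).deriv) u 0
  -- The constant is read off at u = 0 and so does not know the end; at either end the shift in P is
  -- removed by `EnvLip.tendsto_integral_shift_sub`.
  refine ⟨(J' 0 + 1 / 4 * integralS2 (fun x => P (0 + f x) x)) -
    (J 0 + 1 / 4 * integralS2 (primU F 0)), fun l hl => ?_⟩
  have h1 := (EnvLip.of_decays hPp (hF.add hE')).tendsto_integral_shift_sub hPc hfc hl
  have h2 : ∀ u, integralS2 (P u) = integralS2 (primU F u) + integralS2 (E u) := fun u =>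
    integral_add (SmoothS2.integrable ((continuous_primU hFc).comp (Continuous.prodMk_right u)))
      (SmoothS2.integrable (hEc.comp (Continuous.prodMk_right u)))
  have h3 := (h1.const_mul (-(1 / 4))).add_const
    ((J' 0 + 1 / 4 * integralS2 (fun x => P (0 + f x) x)) -
      (J 0 + 1 / 4 * integralS2 (primU F 0)))
  rw [mul_zero, zero_add] at h3
  refine h3.congr fun u => ?_
  have c1 := const1 u
  have c2 := const2 u
  rw [← c1, ← c2, h2]
  ring

/-! ### Supertranslations -/

open NullInfinityData

/-- The family `F` at the retarded time `u + f`. -/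
def SF.shift {F : ℝ → SF} (hF : SmoothScri fun u x => F u x) (f : SF) (u : ℝ) : SF :=
  SF.mk ((hF.shift f.smooth).slice u)

@[simp] lemma SF.shift_apply {F : ℝ → SF} (hF : SmoothScri fun u x => F u x) (f : SF) (u : ℝ)
    (x : S2) : SF.shift hF f u x = F (u + f x) x := rfl

section shift

variable {F F' : ℝ → SF} (hF : FamDeriv F F') (f : SF) (u : ℝ)

lemma FamDeriv.D_shift (a : Fin 3) : sphereCalc.D a (SF.shift hF.smooth f u) =
    SF.shift (hF.D a).smooth f u + SF.shift hF.smooth' f u * sphereCalc.D a f := by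
  refine SF.ext' fun x => ?_
  have h := hF.smooth.grad0_shift f.smooth u x a
  rw [hF.dU_eq] at h
  exact h

lemma FamDeriv.rot_shift (κ : Fin 3 → Fin 3 → ℝ) : sphereCalc.rot κ (SF.shift hF.smooth f u) =
    SF.shift (hF.rot κ).smooth f u + SF.shift hF.smooth' f u * sphereCalc.rot κ f := by
  refine SF.ext' fun x => ?_
  simp only [rot_apply, hF.D_shift, SF.add_apply, SF.mul_apply, SF.sum_apply, SF.shift_apply,
    Finset.mul_sum, ← Finset.sum_add_distrib]
  exact Finset.sum_congr rfl fun a _ => by ring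

end shift

/-- The double divergence of a tensor at the shifted retarded time. -/
lemma ddv_shift_apply {T T' T'' : Fin 3 → Fin 3 → ℝ → SF}
    (hT : ∀ a b, FamDeriv (T a b) (T' a b)) (hT' : ∀ a b, FamDeriv (T' a b) (T'' a b))
    (f : SF) (u : ℝ) (x : S2) :
    sphereCalc.ddv (fun a b => SF.shift (hT a b).smooth f u) x =
      sphereCalc.ddv (fun a b => T a b (u + f x)) x +
      ∑ b, ∑ a, (sphereCalc.D a (T' a b (u + f x)) x * sphereCalc.D b f x +
        sphereCalc.D b (T' a b (u + f x)) x * sphereCalc.D a f x +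
        T'' a b (u + f x) x * sphereCalc.D a f x * sphereCalc.D b f x +
        T' a b (u + f x) x * sphereCalc.D b (sphereCalc.D a f) x) := by
  have h : ∀ a b, sphereCalc.D b (sphereCalc.D a (SF.shift (hT a b).smooth f u)) =
      SF.shift (((hT a b).D a).D b).smooth f u
        + SF.shift ((hT a b).D a).smooth' f u * sphereCalc.D b f
        + ((SF.shift ((hT' a b).D b).smooth f u
            + SF.shift (hT' a b).smooth' f u * sphereCalc.D b f) * sphereCalc.D a f
          + SF.shift (hT a b).smooth' f u * sphereCalc.D b (sphereCalc.D a f)) := by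
    intro a b
    rw [(hT a b).D_shift, map_add, D_mul, ((hT a b).D a).D_shift]
    have h2 := (hT' a b).D_shift f u b
    rw [h2]
  simp only [ddv, dv, map_sum, h, SF.sum_apply, SF.add_apply, SF.mul_apply, SF.shift_apply,
    ← Finset.sum_add_distrib]
  exact Finset.sum_congr rfl fun b _ => Finset.sum_congr rfl fun a _ => by ring

namespace IsSupertranslation

variable {D D' : NullInfinityData} {f : SF} (h : IsSupertranslation f D D')
include h

lemma shear_eq (a b : Fin 3) (u : ℝ) :
    D'.cS a b u = SF.shift (D.fam_c a b).smooth f u - sphereCalc.hess2 f a b := by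
  refine SF.ext' fun x => ?_
  have h1 : D'.cS a b u x = _ := h.shear u x a b
  have h2 : D.C (u + f x) x a b = D.cS a b (u + f x) x := rfl
  rw [h1, hess_eq, lap_eq, h2]
  simp only [hess2, SF.sub_apply, SF.mul_apply, SF.ofNat_apply, sphereCalc_sg, SF.shift_apply]
  ring

lemma news_eq (a b : Fin 3) (u : ℝ) (x : S2) : D'.wS a b u x = D.wS a b (u + f x) x := by
  have h1 := (D'.fam_c a b).deriv u x
  simp only [h.shear_eq, SF.sub_apply, SF.shift_apply] at h1
  exact h1.unique ((((D.fam_c a b).deriv (u + f x) x).comp_add_const u (f x)).sub_const _)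

/-- The nonlinear part of the mass aspect is shifted and changes by a multiple of
`Δ(Δ + 2) f`. -/
lemma q_eq (u : ℝ) :
    D'.qS u = SF.shift D.fam_q.smooth f u + (1 / 4 : ℝ) • sphereCalc.lp2 f := by
  refine SF.ext' fun x => ?_
  have h1 : D'.mS u x = _ := h.mass u x
  have h2 : sphereCalc.ddv (fun a b => D'.cS a b u) =
      sphereCalc.ddv (fun a b => SF.shift (D.fam_c a b).smooth f u) - sphereCalc.lp2 f := by
    rw [← ddv_hess2, ← ddv_sub]
    simp only [h.shear_eq]
  -- Carrying two divergences through u + f(x) creates exactly the news terms of the mass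
  -- transformation, so they cancel in q.
  have h3 := ddv_shift_apply D.fam_c D.fam_w f u x
  have e1 : ∀ d, div2 (news D.C (u + f x)) x d =
      (∑ a, sphereCalc.D a (D.wS a d (u + f x))) x := by
    intro d
    rw [D.div2_w]
    exact congrArg (fun F : SF => F x) ((D.stt_w (u + f x)).gdv_eq d)
  have e2 : ∀ b d, hess f x b d = _ := fun b d => hess_eq f x b d
  have e3 : ∀ b d, deriv (fun s => news D.C s x b d) (u + f x) = D.dwS b d (u + f x) x :=
    fun b d => rfl
  have e4 : ∀ b d, news D.C (u + f x) x b d = D.wS b d (u + f x) x := fun b d => rfl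
  have e5 : D.m (u + f x) x = D.mS (u + f x) x := rfl
  have e6 : ∀ d, grad0 f x d = sphereCalc.D d f x := fun d => rfl
  simp only [e1, e2, e3, e4, e5, e6] at h1
  have hs : ∀ a b, D.wS a b (u + f x) = D.wS b a (u + f x) := (D.stt_w _).symm
  have ht : ∀ b, ∑ d, sphereCalc.X d x * D.wS b d (u + f x) x = 0 := by
    intro b
    have := congrArg (fun F : SF => F x) ((D.stt_w (u + f x)).tang b)
    simp only [SF.sum_apply, SF.mul_apply, SF.zero_apply] at this
    rw [← this]
    exact Finset.sum_congr rfl fun d _ => by rw [hs]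
  have hs' : ∀ b d, sphereCalc.hs f b d = sphereCalc.D b (sphereCalc.D d f) +
      sphereCalc.X d * sphereCalc.D b f := fun b d => rfl
  -- The correction X_d D_b f in the Hessian drops out because the news is tangential.
  have e7 : ∑ b, ∑ d, D.wS b d (u + f x) x * sphereCalc.hs f b d x =
      ∑ b, ∑ d, D.wS b d (u + f x) x * sphereCalc.D b (sphereCalc.D d f) x := by
    refine Finset.sum_congr rfl fun b _ => ?_
    simp only [hs', SF.add_apply, SF.mul_apply, mul_add, Finset.sum_add_distrib]
    have h4 := ht b
    simp only [Fin.sum_univ_three] at h4 ⊢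
    linear_combination sphereCalc.D b f x * h4
  have s1 := hs 1 0
  have s2 := hs 2 0
  have s3 := hs 2 1
  rw [e7] at h1
  rw [qS, SF.sub_apply, SF.smul_apply, h2, SF.sub_apply, h3, h1, SF.add_apply, SF.smul_apply,
    SF.shift_apply, qS, SF.sub_apply, SF.smul_apply]
  simp only [SF.sum_apply]
  simp only [Fin.sum_univ_three, s1, s2, s3]
  ring

lemma rot_q_eq (κ : Fin 3 → Fin 3 → ℝ) (u : ℝ) :
    sphereCalc.rot κ (D'.qS u) = SF.shift (D.fam_q.rot κ).smooth f u +
      SF.shift D.fam_q.smooth' f u * sphereCalc.rot κ f +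
      (1 / 4 : ℝ) • sphereCalc.rot κ (sphereCalc.lp2 f) := by
  rw [h.q_eq, map_add, D.fam_q.rot_shift, Derivation.map_smul]

end IsSupertranslation

/-! ### The excess flux and its primitive in retarded time. -/

namespace NullInfinityData

variable (D : NullInfinityData) (κ : Fin 3 → Fin 3 → ℝ) (f : SF)

/-- The part of the flux density of the supertranslated data that depends on the
supertranslation, at unshifted retarded time. -/
def excess (u : ℝ) : SF :=
  ∑ a, ∑ b, (D.wS a b u * D.wS a b u * sphereCalc.rot κ f
    - D.wS a b u * sphereCalc.lie κ (sphereCalc.hess2 f) a b)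

/-- A primitive of `excess`. -/
def excessPrim (u : ℝ) : SF :=
  (-8 : ℝ) • (D.qS u * sphereCalc.rot κ f)
    - ∑ a, ∑ b, D.cS a b u * sphereCalc.lie κ (sphereCalc.hess2 f) a b

/-- The factor −8 inverts ∂_u q = −⅛|N|²; f and its traceless Hessian do not depend on u. -/
lemma fam_excessPrim : FamDeriv (D.excessPrim κ f) (D.excess κ f) := by
  have h : FamDeriv (D.excessPrim κ f) _ :=
    ((D.fam_q.mul (FamDeriv.const (sphereCalc.rot κ f))).smul (-8)).sub
      (FamDeriv.sum fun a _ => FamDeriv.sum fun b _ =>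
        (D.fam_c a b).mul (FamDeriv.const (sphereCalc.lie κ (sphereCalc.hess2 f) a b)))
  convert h using 1
  funext u
  refine SF.ext' fun x => ?_
  simp only [excess, dqS, SF.sub_apply, SF.mul_apply, SF.neg_apply, SF.smul_apply,
    SF.sum_apply, mul_zero, add_zero, Finset.sum_sub_distrib, ← Finset.sum_mul]
  ring

lemma I_excessPrim {κ : Fin 3 → Fin 3 → ℝ} (hκ : Skew κ) {u : ℝ} {c : SF}
    (hc : sphereCalc.lp2 c = 2 * sphereCalc.ddv (fun a b => D.cS a b u)) :
    sphereCalc.I (D.excessPrim κ f u) = -8 * sphereCalc.I (D.qS u * sphereCalc.rot κ f)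
      - sphereCalc.I (c * sphereCalc.rot κ (sphereCalc.lp2 f)) := by
  rw [excessPrim, map_sub, map_smul, smul_eq_mul, I_lie_hess2 hκ (D.stt_c u) hc f]

lemma continuous_flux : Continuous (fun p : ℝ × S2 => D.fluxS κ p.1 p.2) :=
  FamDeriv.continuous (FamDeriv.sum fun a _ => FamDeriv.sum fun b _ =>
    (D.fam_w a b).mul (FamDeriv.lie D.fam_c κ a b))

end NullInfinityData

lemma NullInfinityData.Falloff.excess {D : NullInfinityData} {ε : ℝ} (h : D.Falloff ε)
    (κ : Fin 3 → Fin 3 → ℝ) (f : SF) : Decays ε (fun u x => D.excess κ f u x) := by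
  refine (decays_sum (s := Finset.univ) fun a _ => decays_sum (s := Finset.univ) fun b _ =>
    (((h.news a b).mul_bdd ((h.news a b).bdd h.pos)).mul_bdd (sphereCalc.rot κ f).famBdd).add
      ((h.news a b).mul_bdd (-sphereCalc.lie κ (sphereCalc.hess2 f) a b).famBdd)).congr
      fun u x => ?_
  simp only [NullInfinityData.excess, SF.sum_apply, SF.sub_apply, SF.mul_apply, SF.neg_apply,
    mul_neg, ← sub_eq_add_neg]

namespace IsSupertranslation

variable {D D' : NullInfinityData} {f : SF} (h : IsSupertranslation f D D')
include h

/-- The rotation of a shifted shear is the shifted rotation plus N Y(f); paired with the news this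
gives |N|² Y(f). The subtracted traceless Hessian of f gives the other term of `excess`. -/
lemma flux_eq (κ : Fin 3 → Fin 3 → ℝ) (u : ℝ) (x : S2) :
    D'.fluxS κ u x = D.fluxS κ (u + f x) x + D.excess κ f (u + f x) x := by
  have h1 : ∀ a b, D'.cS a b u x = D.cS a b (u + f x) x - sphereCalc.hess2 f a b x :=
    fun a b => by rw [h.shear_eq, SF.sub_apply, SF.shift_apply]
  have h2 : ∀ a b, sphereCalc.rot κ (D'.cS a b u) x = sphereCalc.rot κ (D.cS a b (u + f x)) x
      + D.wS a b (u + f x) x * sphereCalc.rot κ f x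
      - sphereCalc.rot κ (sphereCalc.hess2 f a b) x := fun a b => by
    rw [h.shear_eq, map_sub, (D.fam_c a b).rot_shift]; rfl
  simp only [fluxS, NullInfinityData.excess, lie, SF.sum_apply, SF.mul_apply, SF.add_apply,
    SF.sub_apply, h.news_eq, h1, h2, ← Finset.sum_add_distrib]
  refine Finset.sum_congr rfl fun a _ => Finset.sum_congr rfl fun b _ => ?_
  simp only [Fin.sum_univ_three]
  ring

/-- The local parts of the angular momenta of the two sets of data differ asymptotically by a
constant that is the same at both ends. -/
lemma exists_tendsto_localJ_sub {ε : ℝ} (hD : D.Falloff ε) {κ : Fin 3 → Fin 3 → ℝ}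
    (hκ : Skew κ) : ∃ K : ℝ, ∀ l, IsEnd ε l →
      Tendsto (fun u => D'.localJ κ u - D.localJ κ u + 1 / 4 * sphereCalc.I (D.excessPrim κ f u))
        l (𝓝 K) := by
  refine exists_tendsto_sub_of_shifted_flux (F := fun u x => D.fluxS κ u x)
    (E := fun u x => D.excessPrim κ f u x) (E' := fun u x => D.excess κ f u x)
    (D.continuous_flux κ) (hD.flux κ) (D.fam_excessPrim κ f).continuous
    (D.fam_excessPrim κ f).continuous' (D.fam_excessPrim κ f).deriv (hD.excess κ f)
    f.smooth.continuous (D.hasDerivAt_localJ hκ) (fun u => ?_)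
  refine (D'.hasDerivAt_localJ hκ u).congr_deriv ?_
  rw [sphereCalc_I]
  congr 2
  funext x
  exact h.flux_eq κ u x

end IsSupertranslation

/-! ### Limits at the two ends -/

/-- The closed potential of the shear has a limit in `L²` at each end. -/
lemma NullInfinityData.Falloff.exists_tendsto_potential {D : NullInfinityData} {ε : ℝ}
    (h : D.Falloff ε) {c : ℝ → SF}
    (hc : ∀ u, sphereCalc.lp2 (c u) = 2 * sphereCalc.ddv (fun a b => D.cS a b u))
    (hc2 : ∀ u, ∀ ℓ < 2, ∀ F ∈ sphereCalc.Mode ℓ, sphereCalc.I (c u * F) = 0)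
    {l : Filter ℝ} (hl : IsEnd ε l) : ∃ v, Tendsto (fun u => (c u).toL2) l (𝓝 v) := by
  choose K hK0 hK using h.shear_envLip
  set L := ∑ a, ∑ b, K a b ^ 2 with hL
  have hL0 : 0 ≤ L := Finset.sum_nonneg fun a _ => Finset.sum_nonneg fun b _ => sq_nonneg _
  set V := areaS2.real Set.univ with hV
  refine exists_tendsto_of_dist_le hl (K := √(V * L)) fun u v => ?_
  rw [dist_eq_norm, ← map_sub, ← Real.sqrt_sq_eq_abs, ← Real.sqrt_mul (by positivity)]
  refine Real.le_sqrt_of_sq_le ?_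
  rw [SF.norm_sq_toL2]
  -- The potentials are linked for different u only through the shear, so the spectral gap is
  -- applied to the difference of two slices.
  have h1 := int_mul_self_le_of_lp2_eq (c := c u - c v) ((D.stt_c u).sub (D.stt_c v))
    (by rw [lp2_sub, hc, hc, ddv_sub, mul_sub]) (fun ℓ hℓ F hF => by
      rw [sub_mul, map_sub, hc2 u ℓ hℓ F hF, hc2 v ℓ hℓ F hF, sub_zero])
  refine h1.trans ?_
  have h2 : ∀ x, (∑ a, ∑ b, (D.cS a b u - D.cS a b v) * (D.cS a b u - D.cS a b v) : SF) x ≤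
      L * (envInt ε u - envInt ε v) ^ 2 := by
    intro x
    simp only [SF.sum_apply, SF.mul_apply, SF.sub_apply, hL, Finset.sum_mul]
    refine Finset.sum_le_sum fun a _ => Finset.sum_le_sum fun b _ => ?_
    have h3 := sq_le_sq' (by
      have := abs_nonneg (D.cS a b u x - D.cS a b v x)
      linarith [hK a b u v x]) (hK a b u v x)
    rw [sq_abs, mul_pow, sq_abs] at h3
    linarith
  have h3 := integral_mono (SF.integrable _) (integrable_const (L * (envInt ε u - envInt ε v) ^ 2)) h2
  rw [integral_const, smul_eq_mul] at h3
  refine h3.trans (le_of_eq ?_)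
  ring

/-- Here Δ(Δ+2) of c′ + 2g − c is twice the double divergence of C(u+f,·) − C(u,·), which tends
uniformly to zero, so the spectral gap applies. It involves g rather than f because potentials are
orthogonal to modes ℓ ≤ 1, which Δ(Δ+2) does not see. -/
lemma IsSupertranslation.tendsto_potential_sub {D D' : NullInfinityData} {f g : SF}
    (hD' : IsSupertranslation f D D') {ε : ℝ} (h : D.Falloff ε) {c c' : ℝ → SF}
    (hc : ∀ u, sphereCalc.lp2 (c u) = 2 * sphereCalc.ddv (fun a b => D.cS a b u))
    (hc2 : ∀ u, ∀ ℓ < 2, ∀ F ∈ sphereCalc.Mode ℓ, sphereCalc.I (c u * F) = 0)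
    (hc' : ∀ u, sphereCalc.lp2 (c' u) = 2 * sphereCalc.ddv (fun a b => D'.cS a b u))
    (hc2' : ∀ u, ∀ ℓ < 2, ∀ F ∈ sphereCalc.Mode ℓ, sphereCalc.I (c' u * F) = 0)
    (hg2 : ∀ ℓ < 2, ∀ F ∈ sphereCalc.Mode ℓ, sphereCalc.I (g * F) = 0)
    (hfg : sphereCalc.lp2 f = sphereCalc.lp2 g) {l : Filter ℝ} (hl : IsEnd ε l) :
    Tendsto (fun u => (c' u + (2 : ℝ) • g - c u).toL2) l (𝓝 0) := by
  set T : Fin 3 → Fin 3 → ℝ → SF := fun a b u => D'.cS a b u + sphereCalc.hess2 f a b - D.cS a b u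
    with hT
  have h1 : ∀ u, sphereCalc.I ((c' u + (2 : ℝ) • g - c u) * (c' u + (2 : ℝ) • g - c u)) ≤
      sphereCalc.I (∑ a, ∑ b, T a b u * T a b u) := fun u => by
    refine int_mul_self_le_of_lp2_eq
      (((D'.stt_c u).add (sphereCalc.hess2_stt f)).sub (D.stt_c u)) ?_ (fun ℓ hℓ F hF => ?_)
    · rw [lp2_sub, lp2_add, lp2_smul, hc, hc', ddv_sub, ddv_add, ← hfg]
      have h1 : (2 : ℝ) • sphereCalc.lp2 f = 2 * sphereCalc.lp2 f := by
        rw [Algebra.smul_def, map_ofNat]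
      rw [sphereCalc.ddv_hess2 f, h1]
      ring
    · rw [sub_mul, add_mul, smul_mul_assoc, map_sub, map_add, map_smul, hc2' u ℓ hℓ F hF,
        hc2 u ℓ hℓ F hF, hg2 ℓ hℓ F hF]
      simp
  have h2 : ∀ a b, Tendsto (fun u => ‖(T a b u).toL2‖ ^ 2) l (𝓝 0) := fun a b => by
    have := (h.shear_envLip a b).tendsto_toL2_shift_sub
      (F := D.cS a b) (Fs := fun u => SF.shift (D.fam_c a b).smooth f u) f.smooth.continuous
      (fun u x => rfl) hl
    have h3 : ∀ u, T a b u = SF.shift (D.fam_c a b).smooth f u - D.cS a b u := fun u => by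
      simp only [hT, hD'.shear_eq, sub_add_cancel]
    simp only [h3]
    simpa using (this.norm).pow 2
  have h3 : Tendsto (fun u => ∑ a, ∑ b, ‖(T a b u).toL2‖ ^ 2) l (𝓝 0) := by
    simpa using tendsto_finsetSum Finset.univ fun a _ =>
      tendsto_finsetSum Finset.univ fun b _ => h2 a b
  rw [tendsto_zero_iff_norm_tendsto_zero]
  have h4 : Tendsto (fun u => ‖(c' u + (2 : ℝ) • g - c u).toL2‖ ^ 2) l (𝓝 0) := by
    refine squeeze_zero (fun u => sq_nonneg _) (fun u => ?_) h3
    rw [SF.norm_sq_toL2]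
    refine (h1 u).trans (le_of_eq ?_)
    simp only [map_sum, SF.norm_sq_toL2]
  have h5 := (Real.continuous_sqrt.tendsto 0).comp h4
  rw [Real.sqrt_zero] at h5
  exact h5.congr fun u => Real.sqrt_sq (norm_nonneg _)

/-- The rotation about an axis acts on the coordinate functions by the Levi-Civita symbol. -/
lemma rot_axis_X (i k : Fin 3) :
    sphereCalc.rot (axis k) (sphereCalc.X i) = ∑ j, leviCivita i k j • sphereCalc.X j := by
  rw [rot_X (skew_axis k)]
  simp only [rv, axis, Algebra.smul_def]

/-- The limits at one end. -/
lemma IsSupertranslation.exists_limits {D D' : NullInfinityData} {f g : SF} {α₀ : ℝ}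
    {α : Fin 3 → ℝ} (hf : f = algebraMap ℝ SF α₀ + ∑ i, α i • sphereCalc.X i + g)
    (hD' : IsSupertranslation f D D') {ε : ℝ} (h : D.Falloff ε) {c c' : ℝ → SF}
    (hc : ∀ u, sphereCalc.lp2 (c u) = 2 * sphereCalc.ddv (fun a b => D.cS a b u))
    (hc2 : ∀ u, ∀ ℓ < 2, ∀ F ∈ sphereCalc.Mode ℓ, sphereCalc.I (c u * F) = 0)
    (hc' : ∀ u, sphereCalc.lp2 (c' u) = 2 * sphereCalc.ddv (fun a b => D'.cS a b u))
    (hc2' : ∀ u, ∀ ℓ < 2, ∀ F ∈ sphereCalc.Mode ℓ, sphereCalc.I (c' u * F) = 0)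
    (hg2 : ∀ ℓ < 2, ∀ F ∈ sphereCalc.Mode ℓ, sphereCalc.I (g * F) = 0) (k : Fin 3) {K : ℝ}
    {l : Filter ℝ} (hl : IsEnd ε l)
    (hK : Tendsto (fun u => D'.localJ (axis k) u - D.localJ (axis k) u +
      1 / 4 * sphereCalc.I (D.excessPrim (axis k) f u)) l (𝓝 K)) :
    ∃ (J J' : ℝ) (P : Fin 3 → ℝ),
      Tendsto (fun u => D.localJ (axis k) u -
        sphereCalc.I (c u * sphereCalc.rot (axis k) (D.qS u))) l (𝓝 J) ∧
      Tendsto (fun u => D'.localJ (axis k) u -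
        sphereCalc.I (c' u * sphereCalc.rot (axis k) (D'.qS u))) l (𝓝 J') ∧
      (∀ j, Tendsto (linearMomentum D j) l (𝓝 (P j))) ∧
      J' - J = K + ∑ i, ∑ j, α i * leviCivita i k j * P j := by
  have hκ := skew_axis k
  have hlp : sphereCalc.lp2 f = sphereCalc.lp2 g := by
    have e : ∀ i, sphereCalc.lp2 (α i • sphereCalc.X i) = 0 := fun i => by
      rw [lp2_smul, ← ddv_hess2]
      simp [ddv, dv, hess2_X]
    have e0 : sphereCalc.lp2 (algebraMap ℝ SF α₀) = 0 := by
      rw [← ddv_hess2]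
      simp [ddv, dv, hess2_const]
    rw [hf, lp2_add, lp2_add, e0, Fin.sum_univ_three, lp2_add, lp2_add, e, e, e]
    simp
  obtain ⟨j, hj⟩ := h.exists_tendsto_localJ (axis k) hκ hl
  obtain ⟨vc, hvc⟩ := h.exists_tendsto_potential hc hc2 hl
  obtain ⟨vq, hvq⟩ := h.q_envLip.exists_tendsto_toL2 hl
  obtain ⟨vr, hvr⟩ := (h.rot_q_envLip (axis k)).exists_tendsto_toL2
    (F := fun u => sphereCalc.rot (axis k) (D.qS u)) hl
  set R := sphereCalc.rot (axis k)
  set H : SF := R (sphereCalc.lp2 f) with hH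
  have := hl.neBot
  -- the limits of the supertranslated quantities
  have hvc' : Tendsto (fun u => (c' u).toL2) l (𝓝 (vc - (2 : ℝ) • g.toL2)) := by
    have h1 := (hD'.tendsto_potential_sub h hc hc2 hc' hc2' hg2 hlp hl).add
      (hvc.sub_const ((2 : ℝ) • g.toL2))
    rw [zero_add] at h1
    refine h1.congr fun u => ?_
    simp only [map_add, map_sub, map_smul]
    abel
  have hvr' : Tendsto (fun u => (R (D'.qS u)).toL2) l (𝓝 (vr + (1 / 4 : ℝ) • H.toL2)) := by
    have h1 := (h.rot_q_envLip (axis k)).tendsto_toL2_shift_sub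
      (F := fun u => R (D.qS u))
      (Fs := fun u => SF.shift (D.fam_q.rot (axis k)).smooth f u) f.smooth.continuous
      (fun u x => rfl) hl
    have h2 : Tendsto (fun u => (SF.shift D.fam_q.smooth' f u * R f).toL2) l (𝓝 0) :=
      Decays.tendsto_toL2 ((h.dq.shift h.pos f.smooth.continuous).mul_bdd (R f).famBdd) hl
    have h3 := ((h1.add h2).add hvr).add_const ((1 / 4 : ℝ) • H.toL2)
    rw [zero_add, zero_add] at h3
    refine h3.congr fun u => ?_
    rw [hD'.rot_q_eq]
    simp only [map_add, map_sub, map_smul, hH]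
    abel
  have hcr : Tendsto (fun u => sphereCalc.I (c u * R (D.qS u))) l (𝓝 (inner ℝ vc vr)) :=
    (hvc.inner hvr).congr fun u => SF.inner_toL2 _ _
  have hcr' : Tendsto (fun u => sphereCalc.I (c' u * R (D'.qS u))) l
      (𝓝 (inner ℝ (vc - (2 : ℝ) • g.toL2) (vr + (1 / 4 : ℝ) • H.toL2))) :=
    (hvc'.inner hvr').congr fun u => SF.inner_toL2 _ _
  have hE : Tendsto (fun u => sphereCalc.I (D.excessPrim (axis k) f u)) l
      (𝓝 (-8 * inner ℝ vq (R f).toL2 - inner ℝ vc H.toL2)) := by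
    refine (((hvq.inner tendsto_const_nhds).const_mul (-8)).sub
      (hvc.inner tendsto_const_nhds)).congr fun u => ?_
    rw [SF.inner_toL2, SF.inner_toL2, D.I_excessPrim f hκ (hc u)]
  -- integration by parts in the limit
  have hgH : inner ℝ g.toL2 H.toL2 = 0 := by
    rw [SF.inner_toL2, hH, hlp]
    exact I_mul_rot_lp2 hκ g
  -- The limits vq and vr of q and Y(q) are only elements of L²; skewness of Y is applied at finite
  -- u and passed to the limit.
  have hgr : inner ℝ g.toL2 vr = -inner ℝ vq (R g).toL2 := by
    have h1 : Tendsto (fun u => inner ℝ g.toL2 (R (D.qS u)).toL2) l (𝓝 (inner ℝ g.toL2 vr)) :=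
      tendsto_const_nhds.inner hvr
    have h2 : Tendsto (fun u => -inner ℝ (D.qS u).toL2 (R g).toL2) l
      (𝓝 (-inner ℝ vq (R g).toL2)) := (hvq.inner tendsto_const_nhds).neg
    refine tendsto_nhds_unique h1 (h2.congr fun u => ?_)
    rw [SF.inner_toL2, SF.inner_toL2, mul_comm (D.qS u), I_rot_mul hκ, neg_neg]
  have hP : ∀ j, Tendsto (linearMomentum D j) l
      (𝓝 (2 * inner ℝ vq (sphereCalc.X j).toL2)) := fun j => by
    refine ((hvq.inner tendsto_const_nhds).const_mul 2).congr fun u => ?_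
    rw [SF.inner_toL2, linearMomentum_eq]
  have hJ' : Tendsto (fun u => D'.localJ (axis k) u) l
      (𝓝 (K - 1 / 4 * (-8 * inner ℝ vq (R f).toL2 - inner ℝ vc H.toL2) + j)) := by
    refine ((hK.sub (hE.const_mul (1 / 4))).add hj).congr fun u => ?_
    ring
  refine ⟨_, _, _, hj.sub hcr, hJ'.sub hcr', hP, ?_⟩
  -- The constant mode is annihilated, and the ℓ = 1 modes give the Levi-Civita symbol.
  have hRf : R f = (∑ i, ∑ j, (α i * leviCivita i k j) • sphereCalc.X j) + R g := by
    rw [hf, map_add, map_add, map_sum, Derivation.map_algebraMap, zero_add]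
    congr 1
    refine Finset.sum_congr rfl fun i _ => ?_
    rw [Derivation.map_smul, rot_axis_X, Finset.smul_sum]
    exact Finset.sum_congr rfl fun j _ => smul_smul _ _ _
  have hRf' : inner ℝ vq (R f).toL2 =
      (∑ i, ∑ j, α i * leviCivita i k j * inner ℝ vq (sphereCalc.X j).toL2)
        + inner ℝ vq (R g).toL2 := by
    rw [hRf]
    simp only [map_add, map_sum, map_smul, inner_add_right, inner_sum, real_inner_smul_right]
  have hsum : ∑ i, ∑ j, α i * leviCivita i k j * (2 * inner ℝ vq (sphereCalc.X j).toL2) =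
      2 * ∑ i, ∑ j, α i * leviCivita i k j * inner ℝ vq (sphereCalc.X j).toL2 := by
    simp only [Finset.mul_sum]
    exact Finset.sum_congr rfl fun i _ => Finset.sum_congr rfl fun j _ => by ring
  rw [hsum]
  -- The ¼⟨c,H⟩ of the local part cancels that of the potential term, and 2⟨q, Y g⟩ cancels
  -- likewise. What is left of 2⟨q, Y f⟩ comes from the ℓ = 1 modes.
  simp only [inner_add_right, inner_sub_left, real_inner_smul_left, real_inner_smul_right, hgH,
    hgr, hRf']
  ring

end

/-! ### The main theorem. -/

theorem mainTheorem5
    (D D' : NullInfinityData) (hN : NewsDecay D)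
    (f g : S2 → ℝ) (α₀ : ℝ) (α : Fin 3 → ℝ)
    (hg : SmoothS2 g) (hg2 : SupportedGE2 g)
    (hf : ∀ x, f x = α₀ + ∑ i, α i * coordX i x + g x)
    (hD' : IsSupertranslation f D D')
    (c cu c' cu' : ℝ → S2 → ℝ)
    (hc : ∀ u, IsPotentialPair (D.C u) (c u) (cu u))
    (hc' : ∀ u, IsPotentialPair (D'.C u) (c' u) (cu' u)) :
    ∃ Jp Jm Jfp Jfm Pp Pm : Fin 3 → ℝ,
      (∀ k, Tendsto (cwyAngularMomentum D c k) atTop (𝓝 (Jp k))) ∧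
      (∀ k, Tendsto (cwyAngularMomentum D c k) atBot (𝓝 (Jm k))) ∧
      (∀ k, Tendsto (cwyAngularMomentum D' c' k) atTop (𝓝 (Jfp k))) ∧
      (∀ k, Tendsto (cwyAngularMomentum D' c' k) atBot (𝓝 (Jfm k))) ∧
      (∀ k, Tendsto (linearMomentum D k) atTop (𝓝 (Pp k))) ∧
      (∀ k, Tendsto (linearMomentum D k) atBot (𝓝 (Pm k))) ∧
      ∀ k, (Jfp k - Jfm k) - (Jp k - Jm k)
        = ∑ i, ∑ j, α i * leviCivita i k j * (Pp j - Pm j) := by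
  obtain ⟨ε, hε⟩ := hN.exists_falloff
  have hf' : SmoothS2 f := by
    have h1 := (SF.smooth (algebraMap ℝ SF α₀ + ∑ i, α i • sphereCalc.X i + SF.mk hg))
    convert h1 using 1
    funext x
    rw [hf x]
    simp
  have hf2 : SF.mk hf' = algebraMap ℝ SF α₀ + ∑ i, α i • sphereCalc.X i + SF.mk hg :=
    SF.ext' fun x => by simp [hf x]
  have hS : IsSupertranslation (SF.mk hf') D D' := hD'
  -- K depends on the axis but not on the end, so it cancels in the flux. It also absorbs the
  -- freedom of a one-form constant in retarded time in the angular momentum aspect of `D'`.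
  choose K hK using fun k => hS.exists_tendsto_localJ_sub hε (skew_axis k)
  have hlim := fun (k : Fin 3) (l : Filter ℝ) (hl : IsEnd ε l) =>
    hS.exists_limits hf2 hε (c := fun u => SF.mk (hc u).smooth_c)
      (c' := fun u => SF.mk (hc' u).smooth_c) (fun u => (hc u).lp2_eq)
      (fun u => SupportedGE2.I_mul_eq_zero (c := SF.mk (hc u).smooth_c) (hc u).supported_c)
      (fun u => (hc' u).lp2_eq)
      (fun u => SupportedGE2.I_mul_eq_zero (c := SF.mk (hc' u).smooth_c) (hc' u).supported_c)
      (SupportedGE2.I_mul_eq_zero (c := SF.mk hg) hg2) k hl (hK k l hl)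
  have hcwy : ∀ k, cwyAngularMomentum D c k = _ := fun k => funext fun u => (hc u).cwy_eq k
  have hcwy' : ∀ k, cwyAngularMomentum D' c' k = _ := fun k => funext fun u => (hc' u).cwy_eq k
  choose Jp Jfp Pp hJp hJfp hPp hp using fun k => hlim k atTop (isEnd_atTop hε.pos)
  choose Jm Jfm Pm hJm hJfm hPm hm using fun k => hlim k atBot (isEnd_atBot hε.pos)
  -- The momentum limits were chosen separately for each axis k; those for k = 0 serve for all by
  -- uniqueness of limits.
  refine ⟨Jp, Jm, Jfp, Jfm, Pp 0, Pm 0, ?_, ?_, ?_, ?_, hPp 0, hPm 0, fun k => ?_⟩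
  · intro k; rw [hcwy]; exact hJp k
  · intro k; rw [hcwy]; exact hJm k
  · intro k; rw [hcwy']; exact hJfp k
  · intro k; rw [hcwy']; exact hJfm k
  · have e1 : Pp k = Pp 0 := funext fun j => tendsto_nhds_unique (hPp k j) (hPp 0 j)
    have e2 : Pm k = Pm 0 := funext fun j => tendsto_nhds_unique (hPm k j) (hPm 0 j)
    have h1 := hp k
    have h2 := hm k
    rw [e1] at h1
    rw [e2] at h2
    simp only [mul_sub, Finset.sum_sub_distrib]
    linarith
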